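/- Let $S,S'$ be compact metric spaces with Borel $\sigma$-algebras and Borel probability measures $\alpha$ on $S$, $\alpha'$ on $S'$. Write $\mathcal M(S)$, $\mathcal M_+(S)$, $\mathcal P(S)$ for the finite signed, finite positive and probability measures on $S$. Let $\Phi:\mathcal M_+(S)\to\mathbb R$ be a proper mean-field interaction: (1) $\Phi$ is weakly continuous; (2) for all $\nu\in\mathcal M_+(S)$ and $\mu\in\mathcal M(S)$ with $\nu+\mu\in\mathcal M_+(S)$ the derivative $\Phi^{(1)}(\nu,\mu)=\frac{d}{dt}\Phi(\nu+t\mu)\big|_{t=0^+}$ exists, and with $r_\nu(\mu)=\Phi(\nu+\mu)-\Phi(\nu)-\Phi^{(1)}(\nu,\mu)$ one has $r_\nu(t\mu)/t\to0$ as $t\to0^+$, for every $R<\infty$ uniformly in all such $\mu$ of total variation at most $R$; (3) for each $\mu\in\mathcal M(S)$ the function $\nu\mapsto\Phi^{(1)}(\nu,\mu)$ is weakly continuous on $\{\nu\in\mathcal M_+(S):\nu+\mu\in\mathcal M_+(S)\}$. Let $k:S\times S'\to(0,\infty)$ be measurable with $\sup|\log k|<\infty$, $\int k(\sigma,\eta)\,\alpha'(d\eta)=1$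 for $\alpha$-a.e. $\sigma$, $\int k(\sigma,\eta)\,\alpha(d\sigma)=1$ for $\alpha'$-a.e. $\eta$, and such that $\eta\mapsto k(\sigma,\eta)\,\alpha(d\sigma)$ is weakly continuous (for example $k$ continuous, or $S'$ finite). For $N\ge1$ let $\mu_N(d\sigma)=Z_N^{-1}e^{-N\Phi(L_N(\sigma))}\alpha^{\otimes N}(d\sigma)$ on $S^N$, where $L_N(\sigma)=\frac1N\sum_{i=1}^N\delta_{\sigma_i}$. For $1\le n<N$ and $\bar\eta\in S'^{\mathbb N}$ let $\mu'_{n,N}(d\eta_1\cdots d\eta_n\mid\bar\eta_{n+1},\dots,\bar\eta_N)$ be the finite-volume conditional distribution of the transformed system, i.e. the probability measure on $S'^n$ proportional to $\int_{S^N}\mu_N(d\sigma)\prod_{j=n+1}^Nk(\sigma_j,\bar\eta_j)\prod_{i=1}^nk(\sigma_i,\eta_i)\,\alpha'(d\eta_i)$. For $\nu'\in\mathcal P(S')$ let $M_{\nu'}$ be the set of $\tilde\nu\in\mathcal P(S\times S')$ with second marginal $\nu'$, and for $\tilde\nu\in M_{\nu'}$ let $$J_{\nu'}(\tilde\nu)=S(\tilde\nu\mid\alpha\otimes\nu')+\Phi(\pi_1\tilde\nu)-\int\log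 k\,d\tilde\nu\in\mathbb R\cup\{+\infty\},$$ where $S(\cdot|\cdot)$ is relative entropy and $\pi_1\tilde\nu$ is the first marginal. Suppose that for a given $\nu'\in\mathcal P(S')$ the function $J_{\nu'}$ has a unique global minimizer $\tilde\nu^*$ on $M_{\nu'}$. (I) For every $n$ there is a unique measure $\gamma'_n(\cdot\mid\nu')$ on $S'^n$ such that, for every $\bar\eta\in S'^{\mathbb N}$ with $\frac1N\sum_{j=n+1}^N\delta_{\bar\eta_j}\to\nu'$ weakly, $\mu'_{n,N}(A\mid\bar\eta_{n+1},\dots,\bar\eta_N)\to\gamma'_n(A\mid\nu')$ as $N\to\infty$ for all Borel $A\subset S'^n$. Moreover $\gamma'_n(d\eta_1\cdots d\eta_n\mid\nu')=\prod_{i=1}^n\gamma'_1(d\eta_i\mid\nu')$ with $$\gamma'_1(d\eta\mid\nu')=\frac{\int_S\alpha(d\sigma)\,e^{-\Phi^{(1)}(\pi_1\tilde\nu^*,\delta_\sigma)}\,k(\sigma,\eta)}{\int_S\alpha(d\sigma)\,e^{-\Phi^{(1)}(\pi_1\tilde\nu^*,\delta_\sigma)}}\,\alpha'(d\eta).$$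 (II) If moreover $J_{\lambda'}$ has a unique global minimizer on $M_{\lambda'}$ for all $\lambda'$ in a weak neighbourhood of $\nu'$, then for every $n$ and every Borel $A\subset S'^n$ the function $\lambda'\mapsto\gamma'_n(A\mid\lambda')$ is continuous at $\nu'$ for the weak topology of $\mathcal P(S')$. -/

import Mathlib

open MeasureTheory Filter Topology
open scoped ENNReal NNReal

noncomputable section

namespace MeanField

/-! ### Mean-field interactions -/

section Interaction

variable {X : Type*} [MeasurableSpace X]

/-- A nonnegative signed measure, regarded as a finite positive measure
(for a general signed measure: its positive part). -/
def ofSigned (s : SignedMeasure X) : FiniteMeasure X :=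
  ⟨s.toJordanDecomposition.posPart, inferInstance⟩

/-- `ν + μ` is again a positive measure. -/
def Admissible (ν : FiniteMeasure X) (μ : SignedMeasure X) : Prop :=
  0 ≤ (ν : Measure X).toSignedMeasure + μ

/-- The measure `ν + μ`; only used when it is a positive measure. -/
def shift (ν : FiniteMeasure X) (μ : SignedMeasure X) : FiniteMeasure X :=
  ofSigned ((ν : Measure X).toSignedMeasure + μ)

theorem ofSigned_toSignedMeasure {s : SignedMeasure X} (h : 0 ≤ s) :
    (ofSigned s : Measure X).toSignedMeasure = s := by
  have h' : 0 ≤[Set.univ] s := by simpa using h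
  have key : s.toJordanDecomposition =
      { posPart := s.toMeasureOfZeroLE Set.univ .univ h'
        negPart := 0
        posPart_finite := inferInstance
        negPart_finite := inferInstance
        mutuallySingular := Measure.MutuallySingular.zero_right } := by
    apply SignedMeasure.toJordanDecomposition_eq
    simp [JordanDecomposition.toSignedMeasure, SignedMeasure.toMeasureOfZeroLE_toSignedMeasure]
  have h2 := s.toSignedMeasure_toJordanDecomposition
  have h3 : s.toJordanDecomposition.negPart = 0 := by rw [key]
  simp only [JordanDecomposition.toSignedMeasure, h3] at h2
  simpa [ofSigned] using h2

/-- For admissible directions, `shift ν μ` is the measure `ν + μ`. -/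
theorem shift_toSignedMeasure {ν : FiniteMeasure X} {μ : SignedMeasure X} (h : Admissible ν μ) :
    (shift ν μ : Measure X).toSignedMeasure = (ν : Measure X).toSignedMeasure + μ :=
  ofSigned_toSignedMeasure h

/-- The directional derivative `Φ⁽¹⁾(ν, μ) = d/dt Φ(ν + t μ)` at `t = 0+`. -/
def dirDeriv (Φ : FiniteMeasure X → ℝ) (ν : FiniteMeasure X) (μ : SignedMeasure X) : ℝ :=
  derivWithin (fun t : ℝ => Φ (shift ν (t • μ))) (Set.Ici 0) 0

/-- The remainder `Φ(ν + μ) - Φ(ν) - Φ⁽¹⁾(ν, μ)`. -/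
def remainder (Φ : FiniteMeasure X → ℝ) (ν : FiniteMeasure X) (μ : SignedMeasure X) : ℝ :=
  Φ (shift ν μ) - Φ ν - dirDeriv Φ ν μ

/-- Proper mean-field interactions: weakly continuous functions on the finite positive measures,
differentiable in every direction `μ` that stays in the cone of positive measures, uniformly over
such `μ` of bounded total variation, with `Φ⁽¹⁾(ν, μ)` weakly continuous in `ν`. -/
structure IsProperInteraction [TopologicalSpace X] [OpensMeasurableSpace X]
    (Φ : FiniteMeasure X → ℝ) : Prop where
  continuous : Continuous Φ
  differentiable : ∀ (ν : FiniteMeasure X) (μ : SignedMeasure X), Admissible ν μ →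
    DifferentiableWithinAt ℝ (fun t : ℝ => Φ (shift ν (t • μ))) (Set.Ici 0) 0
  uniform : ∀ (ν : FiniteMeasure X) (R : ℝ≥0) (ε : ℝ), 0 < ε → ∃ t₀ : ℝ, 0 < t₀ ∧
    ∀ t : ℝ, 0 < t → t ≤ 1 → t < t₀ → ∀ μ : SignedMeasure X, Admissible ν μ →
      μ.totalVariation Set.univ ≤ R → |remainder Φ ν (t • μ) / t| ≤ ε
  continuous_dirDeriv : ∀ μ : SignedMeasure X,
    ContinuousOn (fun ν : FiniteMeasure X => dirDeriv Φ ν μ) {ν | Admissible ν μ}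

/-- The point mass at `x` as a finite measure. -/
def pointMass (x : X) : FiniteMeasure X := ⟨Measure.dirac x, inferInstance⟩

/-- The empirical measure `L_N(x) = (1/N) ∑ᵢ δ_{xᵢ}`. -/
def empirical (N : ℕ) (x : Fin N → X) : FiniteMeasure X :=
  (N : ℝ≥0)⁻¹ • ∑ i, pointMass (x i)

/-- `Φ⁽¹⁾(ν, δ_x)`. -/
def pointDeriv (Φ : FiniteMeasure X → ℝ) (ν : FiniteMeasure X) (x : X) : ℝ :=
  dirDeriv Φ ν (pointMass x : Measure X).toSignedMeasure

/-- The finite-volume Gibbs measure `μ_N ∝ exp (-N Φ(L_N(σ))) α^{⊗N}(dσ)`. -/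
def gibbs (Φ : FiniteMeasure X → ℝ) (α : Measure X) (N : ℕ) : Measure (Fin N → X) :=
  (Measure.pi fun _ => α).tilted fun σ => -((N : ℝ) * Φ (empirical N σ))

end Interaction

/-! ### The transformed system -/

section Transform

variable {S S' : Type*} [MeasurableSpace S] [MeasurableSpace S']

/-- `k` is the density of a coupling `K(dσ, dη) = k(σ, η) α(dσ) α'(dη)` of `α` and `α'`, with
`log k` bounded and with `η ↦ k(σ, η) α(dσ)` weakly continuous. -/
structure IsCouplingDensity [TopologicalSpace S] [TopologicalSpace S']
    (α : Measure S) (α' : Measure S') (k : S → S' → ℝ) : Prop where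
  measurable : Measurable (Function.uncurry k)
  pos : ∀ σ η, 0 < k σ η
  bounded_log : ∃ C : ℝ, ∀ σ η, |Real.log (k σ η)| ≤ C
  fst_marginal : ∀ᵐ σ ∂α, ∫ η, k σ η ∂α' = 1
  snd_marginal : ∀ᵐ η ∂α', ∫ σ, k σ η ∂α = 1
  weakly_continuous : ∀ f : S → ℝ, Continuous f → Continuous fun η => ∫ σ, f σ * k σ η ∂α

/-- The second-layer configuration that is `x` in the first `n` sites and `η` elsewhere. -/
def splice (n : ℕ) (x : Fin n → S') (η : ℕ → S') (j : ℕ) : S' :=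
  if h : j < n then x ⟨j, h⟩ else η j

/-- The restriction to `{η_j fixed for n ≤ j < N}` of the law
`μ'_N(dη) = ∫ μ_N(dσ) ∏ᵢ k(σᵢ, ηᵢ) α'(dηᵢ)` of the transformed spins, that is the measure
`∫ μ_N(dσ) ∏_{j ≥ n} k(σⱼ, ηⱼ) ∏_{i < n} k(σᵢ, xᵢ) α'(dxᵢ)` before normalization. -/
def transformedWeight (Φ : FiniteMeasure S → ℝ) (α : Measure S) (α' : Measure S')
    (k : S → S' → ℝ) (n N : ℕ) (η : ℕ → S') : Measure (Fin n → S') :=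
  (Measure.pi fun _ => α').withDensity fun x =>
    ∫⁻ σ, ∏ j : Fin N, ENNReal.ofReal (k (σ j) (splice n x η j)) ∂(gibbs Φ α N)

/-- The finite-volume conditional distribution `μ'_{n,N}(dη_{V_n} | η_{V_N ∖ V_n})`. -/
def transformedCond (Φ : FiniteMeasure S → ℝ) (α : Measure S) (α' : Measure S')
    (k : S → S' → ℝ) (n N : ℕ) (η : ℕ → S') : Measure (Fin n → S') :=
  (transformedWeight Φ α α' k n N η Set.univ)⁻¹ • transformedWeight Φ α α' k n N η

/-- `γ` is the infinite-volume limit of the conditional distributions of the first `n`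
transformed spins, for every boundary condition whose empirical measures converge weakly
to `ν'`. -/
def IsLimitKernel [TopologicalSpace S'] [OpensMeasurableSpace S']
    (Φ : FiniteMeasure S → ℝ) (α : Measure S) (α' : Measure S')
    (k : S → S' → ℝ) (n : ℕ) (ν' : ProbabilityMeasure S') (γ : Measure (Fin n → S')) : Prop :=
  ∀ η : ℕ → S',
    Tendsto (fun N : ℕ => (N : ℝ≥0)⁻¹ • ∑ j ∈ Finset.Ico n N, pointMass (η j)) atTop
      (𝓝 ν'.toFiniteMeasure) →
    ∀ A : Set (Fin n → S'), MeasurableSet A →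
      Tendsto (fun N : ℕ => transformedCond Φ α α' k n N η A) atTop (𝓝 (γ A))

open Classical in
/-- The infinite-volume kernel `γ'_n(· | ν')`: the limit of the finite-volume conditional
distributions (and `0` if there is no such limit). -/
def limitKernel [TopologicalSpace S'] [OpensMeasurableSpace S']
    (Φ : FiniteMeasure S → ℝ) (α : Measure S) (α' : Measure S')
    (k : S → S' → ℝ) (n : ℕ) (ν' : ProbabilityMeasure S') : Measure (Fin n → S') :=
  if h : ∃ γ, IsLimitKernel Φ α α' k n ν' γ then h.choose else 0

/-! ### The constrained first-layer model -/

/-- The set `M_{ν'}` of probability measures with second marginal `ν'`. -/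
def constrained (ν' : ProbabilityMeasure S') : Set (ProbabilityMeasure (S × S')) :=
  {ρ | (ρ : Measure (S × S')).map Prod.snd = (ν' : Measure S')}

/-- The first marginal `π₁ ρ`. -/
def firstMarginal (ρ : ProbabilityMeasure (S × S')) : FiniteMeasure S :=
  ρ.toFiniteMeasure.map Prod.fst

/-- `J_{ν'}(ρ) = S(ρ | α ⊗ ν') + Φ(π₁ ρ) - ρ[log k]`, with values in `ℝ ∪ {+∞}`. -/
def rateFunction (Φ : FiniteMeasure S → ℝ) (α : Measure S) (k : S → S' → ℝ)
    (ν' : ProbabilityMeasure S') (ρ : ProbabilityMeasure (S × S')) : EReal :=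
  ((InformationTheory.klDiv (ρ : Measure (S × S')) (α.prod (ν' : Measure S')) : ℝ≥0∞) : EReal)
    + ((Φ (firstMarginal ρ) - ∫ ξ, Real.log (k ξ.1 ξ.2) ∂(ρ : Measure (S × S')) : ℝ) : EReal)

/-- `ρ` is the unique global minimizer of `J_{ν'}` on `M_{ν'}`. -/
def IsUniqueMinimizer (Φ : FiniteMeasure S → ℝ) (α : Measure S) (k : S → S' → ℝ)
    (ν' : ProbabilityMeasure S') (ρ : ProbabilityMeasure (S × S')) : Prop :=
  (ρ ∈ constrained ν' ∧ IsMinOn (rateFunction Φ α k ν') (constrained ν') ρ) ∧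
    ∀ ρ' ∈ constrained ν', IsMinOn (rateFunction Φ α k ν') (constrained ν') ρ' → ρ' = ρ

/-- The single-site kernel
`∫ α(dσ) exp (-Φ⁽¹⁾(π₁ ρ, δ_σ)) k(σ, η) α'(dη) / ∫ α(dσ) exp (-Φ⁽¹⁾(π₁ ρ, δ_σ))`. -/
def singleSite (Φ : FiniteMeasure S → ℝ) (α : Measure S) (α' : Measure S') (k : S → S' → ℝ)
    (ρ : ProbabilityMeasure (S × S')) : Measure S' :=
  α'.withDensity fun η => ENNReal.ofReal
    ((∫ σ, Real.exp (-pointDeriv Φ (firstMarginal ρ) σ) * k σ η ∂α)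
      / ∫ σ, Real.exp (-pointDeriv Φ (firstMarginal ρ) σ) ∂α)

end Transform

end MeanField

end

/-!
Fix the minimizer `ρ` and put `g(σ) = Φ⁽¹⁾(π₁ ρ, δ_σ)`, a continuous function. Everything is
expressed relative to the field `g`. Let `q(σ, η) = e^{-g(σ)} k(σ, η) / ∫ e^{-g} k(·, η) dα`
(`tiltDensity`), let the coupling of a law `λ` of second-layer spins be the measure
`q(σ, η) α(dσ) λ(dη)`, and let `Ψ(μ) = Φ(π₁ μ) - ∫ g d(π₁ μ)` (`residual`). Up to a constant,
`J_λ` is relative entropy with respect to the coupling of `λ`, plus `Ψ` (`rateFunction_eq`).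
Moving from `ρ` towards the coupling of `ν'` does not change `Ψ` to first order, but would decrease
the entropy to first order if `ρ` were not the coupling; hence `ρ` is itself the
coupling of `ν'` (`eq_coupling_of_isMinOn`), and uniqueness says that every other element of
`M_{ν'}` has entropy plus `Ψ` strictly above `Ψ(ρ)`.

Given a boundary condition `η`, integrate out the first-layer spins at the sites beyond `n`. Under
the product of the laws `q(·, ηⱼ) α` their joint empirical measure with `η` satisfies a large
deviation upper bound with rate relative entropy with respect to the coupling. It is proved locally
by exponential Chebyshev with a continuous test function, found by the Donsker–Varadhan formula
(`exists_continuous_lt_integral_sub_log`), and then globally by compactness. The matching lower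
bound is needed only at `ρ`, where it is the law of large numbers. With the weight `e^{-N Ψ}` the
empirical measure therefore concentrates at `ρ` (`tendsto_blockWeight_div`). The first `n` spins
enter through the factor `e^{-N (Φ(ν + N⁻¹ ∑ᵢ δ_{uᵢ}) - Φ(ν))}`, which is bounded and converges
to `∏ᵢ e^{-g(uᵢ)}` as `N → ∞` and `ν → π₁ ρ`; dominated convergence gives the product form of the
limit.

The uniform bound on `Φ⁽¹⁾(ν, δ_x)` behind this is not part of the hypotheses; it comes from a
Baire category argument (`IsProperInteraction.exists_abs_pointDeriv_le`). The limit kernel is unique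
because every `ν'` is the limit of the empirical measures of some sequence, by the strong law of
large numbers.

For the continuity in `ν'`, compare a minimizer for `λ` with the coupling of `λ` built from the same
`g`. By compactness and the lower semicontinuity of entropy, every cluster point of these minimizers
as `λ → ν'` minimizes `J_{ν'}`, hence is `ρ` (`tendsto_minimizer`), and the product kernel is a
continuous function of the minimizer.
-/

set_option linter.unusedSectionVars false

noncomputable section

namespace MeanField

/-! ### Derivatives in positive directions -/

section PosDeriv

variable {X : Type*} [MeasurableSpace X]

theorem admissible_toSignedMeasure (ν μ : FiniteMeasure X) :
    Admissible ν (μ : Measure X).toSignedMeasure := by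
  unfold Admissible
  intro s hs
  rw [_root_.add_apply, Measure.toSignedMeasure_apply_measurable hs,
    Measure.toSignedMeasure_apply_measurable hs]
  simp only [FunLike.coe_zero, Pi.zero_apply]
  positivity

theorem smul_toSignedMeasure (μ : FiniteMeasure X) {t : ℝ} (ht : 0 ≤ t) :
    t • (μ : Measure X).toSignedMeasure =
      ((t.toNNReal • μ : FiniteMeasure X) : Measure X).toSignedMeasure := by
  ext s hs
  rw [_root_.smul_apply, Measure.toSignedMeasure_apply_measurable hs,
    Measure.toSignedMeasure_apply_measurable hs, FiniteMeasure.toMeasure_smul]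
  simp [Measure.real, ht]

theorem shift_smul (ν μ : FiniteMeasure X) {t : ℝ} (ht : 0 ≤ t) :
    shift ν (t • (μ : Measure X).toSignedMeasure) = ν + t.toNNReal • μ := by
  apply FiniteMeasure.toMeasure_injective
  rw [smul_toSignedMeasure μ ht]
  have h := shift_toSignedMeasure (admissible_toSignedMeasure ν (t.toNNReal • μ))
  rw [← Measure.toSignedMeasure_eq_toSignedMeasure_iff, h, ← Measure.toSignedMeasure_add]
  rfl

theorem totalVariation_toSignedMeasure (μ : FiniteMeasure X) :
    (μ : Measure X).toSignedMeasure.totalVariation Set.univ = μ.mass := by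
  have key : (μ : Measure X).toSignedMeasure.toJordanDecomposition =
      { posPart := μ
        negPart := 0
        posPart_finite := inferInstance
        negPart_finite := inferInstance
        mutuallySingular := Measure.MutuallySingular.zero_right } := by
    apply SignedMeasure.toJordanDecomposition_eq
    simp [JordanDecomposition.toSignedMeasure]
  simp [SignedMeasure.totalVariation, key]

/-- The derivative `Φ⁽¹⁾(ν, μ)` in the direction of a positive measure `μ`. -/
def posDeriv (Φ : FiniteMeasure X → ℝ) (ν μ : FiniteMeasure X) : ℝ :=
  dirDeriv Φ ν (μ : Measure X).toSignedMeasure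

variable [TopologicalSpace X] [OpensMeasurableSpace X] {Φ : FiniteMeasure X → ℝ}

theorem IsProperInteraction.hasDerivWithinAt_zero (hΦ : IsProperInteraction Φ)
    (ν μ : FiniteMeasure X) :
    HasDerivWithinAt (fun t : ℝ => Φ (ν + t.toNNReal • μ)) (posDeriv Φ ν μ) (Set.Ici 0) 0 := by
  have h := (hΦ.differentiable ν _ (admissible_toSignedMeasure ν μ)).hasDerivWithinAt
  refine h.congr (fun t ht => ?_) ?_
  · rw [shift_smul ν μ ht]
  · rw [shift_smul ν μ le_rfl]

theorem IsProperInteraction.hasDerivWithinAt (hΦ : IsProperInteraction Φ)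
    (ν μ : FiniteMeasure X) {s : ℝ} (hs : 0 ≤ s) :
    HasDerivWithinAt (fun t : ℝ => Φ (ν + t.toNNReal • μ))
      (posDeriv Φ (ν + s.toNNReal • μ) μ) (Set.Ici s) s := by
  have h := hΦ.hasDerivWithinAt_zero (ν + s.toNNReal • μ) μ
  have h1 : HasDerivWithinAt (fun r : ℝ => r - s) 1 (Set.Ici s) s :=
    (hasDerivWithinAt_id s _).sub_const s
  have h0 : HasDerivWithinAt (fun t : ℝ => Φ (ν + s.toNNReal • μ + t.toNNReal • μ))
      (posDeriv Φ (ν + s.toNNReal • μ) μ) (Set.Ici 0) (s - s) := by rwa [sub_self]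
  have h2 := HasDerivWithinAt.comp (h := fun r : ℝ => r - s) s h0 h1
    (fun r (hr : s ≤ r) => show 0 ≤ r - s from sub_nonneg.2 hr)
  rw [mul_one] at h2
  refine h2.congr (fun r hr => ?_) ?_
  · have hr' : s ≤ r := hr
    simp only [Function.comp]
    rw [add_assoc, ← add_smul, ← Real.toNNReal_add hs (sub_nonneg.2 hr'), add_sub_cancel]
  · simp

theorem IsProperInteraction.continuous_posDeriv (hΦ : IsProperInteraction Φ)
    (μ : FiniteMeasure X) : Continuous fun ν => posDeriv Φ ν μ := by
  have h := hΦ.continuous_dirDeriv (μ : Measure X).toSignedMeasure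
  have h2 : {ν : FiniteMeasure X | Admissible ν (μ : Measure X).toSignedMeasure} = Set.univ := by
    ext ν; simp [admissible_toSignedMeasure]
  rw [h2] at h
  exact continuousOn_univ.1 h

/-- Mean value estimate along a positive direction. -/
theorem IsProperInteraction.abs_sub_le (hΦ : IsProperInteraction Φ) (ν μ : FiniteMeasure X)
    {d C t : ℝ} (ht : 0 ≤ t)
    (h : ∀ s : ℝ, 0 ≤ s → s ≤ t → |posDeriv Φ (ν + s.toNNReal • μ) μ - d| ≤ C) :
    |Φ (ν + t.toNNReal • μ) - Φ ν - t * d| ≤ C * t := by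
  have hc : Continuous fun s : ℝ => Φ (ν + s.toNNReal • μ) - s * d := by
    have h1 : Continuous fun s : ℝ => ν + s.toNNReal • μ :=
      continuous_const.add (continuous_real_toNNReal.smul continuous_const)
    exact (hΦ.continuous.comp h1).sub (continuous_id.mul continuous_const)
  have := norm_image_sub_le_of_norm_deriv_right_le_segment (a := 0) (b := t)
    (f := fun s : ℝ => Φ (ν + s.toNNReal • μ) - s * d)
    (f' := fun s : ℝ => posDeriv Φ (ν + s.toNNReal • μ) μ - d) (C := C)
    hc.continuousOn
    (fun s hs => by
      have h2 := (hasDerivWithinAt_id s (Set.Ici s)).mul_const d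
      rw [one_mul] at h2
      exact (hΦ.hasDerivWithinAt ν μ hs.1).sub h2)
    (fun s hs => h s hs.1 hs.2.le) t ⟨ht, le_rfl⟩
  simpa [sub_right_comm] using this

/-- Difference quotients in a positive direction converge jointly in the base point and the
step: by the mean value estimate they are close to values of `Φ⁽¹⁾(·, μ)` near `ν`. -/
theorem IsProperInteraction.tendsto_slope (hΦ : IsProperInteraction Φ) (ν μ : FiniteMeasure X) :
    Tendsto (fun p : FiniteMeasure X × ℝ => (Φ (p.1 + p.2.toNNReal • μ) - Φ p.1) / p.2)
      (𝓝 ν ×ˢ 𝓝[>] 0) (𝓝 (posDeriv Φ ν μ)) := by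
  rw [Metric.tendsto_nhds]
  intro ε hε
  have hc : Continuous fun p : FiniteMeasure X × ℝ => posDeriv Φ (p.1 + p.2.toNNReal • μ) μ :=
    (hΦ.continuous_posDeriv μ).comp (continuous_fst.add
      ((continuous_real_toNNReal.comp continuous_snd).smul continuous_const))
  have h1 : ∀ᶠ p : FiniteMeasure X × ℝ in 𝓝 ν ×ˢ 𝓝 0,
      |posDeriv Φ (p.1 + p.2.toNNReal • μ) μ - posDeriv Φ ν μ| < ε / 2 := by
    have := hc.tendsto (ν, 0)
    rw [nhds_prod_eq] at this
    simp only [Real.toNNReal_zero, zero_smul, add_zero] at this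
    exact (Metric.tendsto_nhds.1 this) (ε / 2) (by positivity)
  obtain ⟨P, hP, Q, hQ, h2⟩ := eventually_prod_iff.1 h1
  obtain ⟨δ, hδ, hQ'⟩ := Metric.eventually_nhds_iff.1 hQ
  refine eventually_prod_iff.2 ⟨P, hP, fun t => 0 < t ∧ t < δ, ?_, ?_⟩
  · exact Ioo_mem_nhdsGT hδ
  · rintro ν' hν' t ⟨ht, htδ⟩
    have h3 := hΦ.abs_sub_le ν' μ (d := posDeriv Φ ν μ) (C := ε / 2) ht.le (fun s hs hst =>
      (h2 hν' (hQ' (by rw [Real.dist_eq, sub_zero, abs_of_nonneg hs]; linarith))).le)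
    rw [Real.dist_eq, div_sub' ht.ne', abs_div, abs_of_pos ht, div_lt_iff₀ ht]
    nlinarith

theorem IsProperInteraction.tendsto_slope_const (hΦ : IsProperInteraction Φ)
    (ν μ : FiniteMeasure X) :
    Tendsto (fun t : ℝ => (Φ (ν + t.toNNReal • μ) - Φ ν) / t) (𝓝[>] 0)
      (𝓝 (posDeriv Φ ν μ)) := by
  have h : Tendsto (fun t : ℝ => ((ν, t) : FiniteMeasure X × ℝ)) (𝓝[>] 0) (𝓝 ν ×ˢ 𝓝[>] 0) :=
    Tendsto.prodMk tendsto_const_nhds tendsto_id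
  have h2 := Tendsto.comp (hΦ.tendsto_slope ν μ) h
  exact h2

theorem tendsto_add_smul (ν μ : FiniteMeasure X) :
    Tendsto (fun t : ℝ => ν + t.toNNReal • μ) (𝓝[>] 0) (𝓝 ν) := by
  have h1 : Continuous fun s : ℝ => ν + s.toNNReal • μ :=
    continuous_const.add (continuous_real_toNNReal.smul continuous_const)
  have := h1.tendsto 0
  simp only [Real.toNNReal_zero, zero_smul, add_zero] at this
  exact this.mono_left nhdsWithin_le_nhds

/-- Additivity of the derivative. The increment in the direction `μ₁ + μ₂` is the sum of one in the
direction `μ₁` and one in the direction `μ₂` at the moving base point `ν + t μ₁`. -/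
theorem IsProperInteraction.posDeriv_add (hΦ : IsProperInteraction Φ) (ν μ₁ μ₂ : FiniteMeasure X) :
    posDeriv Φ ν (μ₁ + μ₂) = posDeriv Φ ν μ₁ + posDeriv Φ ν μ₂ := by
  have h : Tendsto (fun t : ℝ => ((ν + t.toNNReal • μ₁, t) : FiniteMeasure X × ℝ))
      (𝓝[>] 0) (𝓝 ν ×ˢ 𝓝[>] 0) := (tendsto_add_smul ν μ₁).prodMk tendsto_id
  have h2 := (hΦ.tendsto_slope ν μ₂).comp h
  refine tendsto_nhds_unique (hΦ.tendsto_slope_const ν (μ₁ + μ₂))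
    (((hΦ.tendsto_slope_const ν μ₁).add h2).congr fun t => ?_)
  simp only [Function.comp, smul_add, add_assoc]
  ring

theorem IsProperInteraction.posDeriv_smul (hΦ : IsProperInteraction Φ) (ν μ : FiniteMeasure X)
    (c : ℝ≥0) : posDeriv Φ ν (c • μ) = c * posDeriv Φ ν μ := by
  rcases eq_or_ne c 0 with rfl | hc
  · refine tendsto_nhds_unique (hΦ.tendsto_slope_const ν _) ?_
    simp
  have hc' : 0 < (c : ℝ) := by exact_mod_cast hc.bot_lt
  have h1 : Tendsto (fun t : ℝ => t * c) (𝓝[>] 0) (𝓝[>] 0) := by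
    refine tendsto_nhdsWithin_iff.2 ⟨?_, ?_⟩
    · have : Tendsto (fun t : ℝ => t * c) (𝓝 0) (𝓝 (0 * c)) := tendsto_id.mul_const _
      rw [zero_mul] at this
      exact this.mono_left nhdsWithin_le_nhds
    · filter_upwards [self_mem_nhdsWithin] with t ht using mul_pos ht hc'
  refine tendsto_nhds_unique (hΦ.tendsto_slope_const ν (c • μ))
    ((((hΦ.tendsto_slope_const ν μ).comp h1).const_mul (c : ℝ)).congr' ?_)
  filter_upwards [self_mem_nhdsWithin] with t ht
  have ht' : (0 : ℝ) < t := ht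
  simp only [Function.comp]
  rw [Real.toNNReal_mul ht'.le, Real.toNNReal_coe, smul_smul]
  field_simp

theorem IsProperInteraction.posDeriv_sum (hΦ : IsProperInteraction Φ) (ν : FiniteMeasure X)
    {ι : Type*} (s : Finset ι) (μ : ι → FiniteMeasure X) :
    posDeriv Φ ν (∑ i ∈ s, μ i) = ∑ i ∈ s, posDeriv Φ ν (μ i) := by
  classical
  induction s using Finset.induction_on with
  | empty => simpa using hΦ.posDeriv_smul ν 0 0
  | insert i s hi ih => rw [Finset.sum_insert hi, Finset.sum_insert hi, hΦ.posDeriv_add, ih]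

/-- `μ ↦ Φ⁽¹⁾(ν, μ)` is continuous on bounded sets, as a uniform limit of difference quotients. -/
theorem IsProperInteraction.continuousOn_posDeriv_right (hΦ : IsProperInteraction Φ)
    (ν : FiniteMeasure X) (R : ℝ≥0) :
    ContinuousOn (fun μ => posDeriv Φ ν μ) {μ | μ.mass ≤ R} := by
  refine continuousOn_of_uniform_approx_of_continuousOn fun u hu => ?_
  obtain ⟨ε, hε, hεu⟩ := Metric.mem_uniformity_dist.1 hu
  obtain ⟨t₀, ht₀, h⟩ := hΦ.uniform ν R (ε / 2) (by positivity)
  obtain ⟨t, ht, htt⟩ : ∃ t : ℝ, 0 < t ∧ t < min 1 t₀ := exists_between (by positivity)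
  refine ⟨fun μ => (Φ (ν + t.toNNReal • μ) - Φ ν) / t, ?_, fun μ hμ => hεu ?_⟩
  · have h1 : Continuous fun μ : FiniteMeasure X => ν + t.toNNReal • μ :=
      continuous_const.add (continuous_const_smul t.toNNReal)
    exact (((hΦ.continuous.comp h1).sub continuous_const).div_const _).continuousOn
  · have h2 := h t ht (htt.le.trans (min_le_left _ _)) (htt.trans_le (min_le_right _ _)) _
      (admissible_toSignedMeasure ν μ)
      (by rw [totalVariation_toSignedMeasure]; exact_mod_cast hμ)
    have h3 : dirDeriv Φ ν (t • (μ : Measure X).toSignedMeasure) = t * posDeriv Φ ν μ := by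
      rw [smul_toSignedMeasure μ ht.le]
      have := hΦ.posDeriv_smul ν μ t.toNNReal
      rwa [Real.coe_toNNReal _ ht.le] at this
    rw [remainder, h3, shift_smul ν μ ht.le] at h2
    rw [Real.dist_eq, abs_sub_comm]
    have h4 : (Φ (ν + t.toNNReal • μ) - Φ ν) / t - posDeriv Φ ν μ =
      (Φ (ν + t.toNNReal • μ) - Φ ν - t * posDeriv Φ ν μ) / t := by field_simp
    rw [h4]
    linarith

end PosDeriv

/-! ### Empirical measures and product measures -/

section Tools

theorem integral_smul_sum_pointMass {X ι : Type*} [MeasurableSpace X] [MeasurableSingletonClass X]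
    (c : ℝ≥0) (s : Finset ι) (x : ι → X) (f : X → ℝ) :
    ∫ y, f y ∂((c • ∑ j ∈ s, pointMass (x j) : FiniteMeasure X) : Measure X) =
      c * ∑ j ∈ s, f (x j) := by
  rw [FiniteMeasure.toMeasure_smul, FiniteMeasure.toMeasure_sum, integral_smul_nnreal_measure,
    integral_finsetSum_measure]
  · simp [pointMass, NNReal.smul_def]
  · intro i _
    exact integrable_dirac enorm_lt_top

theorem mass_smul_sum_pointMass {X ι : Type*} [MeasurableSpace X]
    (c : ℝ≥0) (s : Finset ι) (x : ι → X) :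
    (c • ∑ j ∈ s, pointMass (x j) : FiniteMeasure X).mass = c * s.card := by
  rw [← ENNReal.coe_inj, FiniteMeasure.ennreal_mass, FiniteMeasure.toMeasure_smul,
    FiniteMeasure.toMeasure_sum]
  simp only [Measure.coe_nnreal_smul_apply, Measure.coe_finsetSum, Finset.sum_apply, pointMass,
    FiniteMeasure.toMeasure_mk, measure_univ, Finset.sum_const, nsmul_eq_mul, mul_one]
  push_cast
  rfl

theorem tendsto_of_forall_continuousMap {X γ : Type*} [MeasurableSpace X] [TopologicalSpace X]
    [CompactSpace X] [OpensMeasurableSpace X] {F : Filter γ} {μs : γ → FiniteMeasure X}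
    {μ : FiniteMeasure X}
    (h : ∀ f : C(X, ℝ), Tendsto (fun i => ∫ x, f x ∂(μs i : Measure X)) F
      (𝓝 (∫ x, f x ∂(μ : Measure X)))) : Tendsto μs F (𝓝 μ) :=
  FiniteMeasure.tendsto_of_forall_integral_tendsto fun f => h f.toContinuousMap

theorem integrable_of_continuous {X : Type*} [MeasurableSpace X] [TopologicalSpace X]
    [CompactSpace X] [OpensMeasurableSpace X] {f : X → ℝ} (hf : Continuous f) (μ : Measure X)
    [IsFiniteMeasure μ] : Integrable f μ :=
  hf.integrable_of_hasCompactSupport (HasCompactSupport.of_compactSpace _)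

variable {X : Type*} [MetricSpace X] [CompactSpace X] [MeasurableSpace X] [BorelSpace X]

/-- Every probability measure is a limit of empirical measures of a sequence, by the strong law of
large numbers along a countable dense family of test functions. -/
theorem exists_tendsto_empirical (μ : ProbabilityMeasure X) (n : ℕ) :
    ∃ x : ℕ → X, Tendsto (fun N : ℕ => (N : ℝ≥0)⁻¹ • ∑ j ∈ Finset.Ico n N, pointMass (x j)) atTop
      (𝓝 μ.toFiniteMeasure) := by
  let P : Measure (ℕ → X) := Measure.infinitePi fun _ => (μ : Measure X)
  have hslln : ∀ f : C(X, ℝ), ∀ᵐ ω ∂P, Tendsto (fun N : ℕ => (∑ i ∈ Finset.range N, f (ω i)) / N)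
      atTop (𝓝 (∫ x, f x ∂(μ : Measure X))) := by
    intro f
    have hmp : ∀ i, MeasurePreserving (fun ω : ℕ → X => ω i) P (μ : Measure X) := fun i =>
      measurePreserving_eval_infinitePi _ i
    have h := ProbabilityTheory.strong_law_ae_real (μ := P) (fun i ω => f (ω i))
      ((hmp 0).integrable_comp_of_integrable
        (integrable_of_continuous f.continuous _))
      (fun i j hij => by
        have := ProbabilityTheory.iIndepFun_infinitePi (P := fun _ : ℕ => (μ : Measure X))
          (X := fun _ => f) (fun _ => f.continuous.measurable)
        exact this.indepFun hij)
      (fun i => by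
        refine ⟨(f.continuous.measurable.comp (measurable_pi_apply i)).aemeasurable,
          (f.continuous.measurable.comp (measurable_pi_apply 0)).aemeasurable, ?_⟩
        have : ∀ i, P.map (fun ω : ℕ → X => f (ω i)) = (μ : Measure X).map f := fun i => by
          rw [← (hmp i).map_eq, Measure.map_map f.continuous.measurable (measurable_pi_apply i)]
          rfl
        rw [this, this])
    have h0 : ∫ ω, f (ω 0) ∂P = ∫ x, f x ∂(μ : Measure X) := by
      rw [← (hmp 0).map_eq, integral_map (measurable_pi_apply 0).aemeasurable
        f.continuous.aestronglyMeasurable]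
    rw [h0] at h
    exact h
  have hall : ∀ᵐ ω ∂P, ∀ i : ℕ, Tendsto (fun N : ℕ =>
      (∑ j ∈ Finset.range N, TopologicalSpace.denseSeq C(X, ℝ) i (ω j)) / N)
      atTop (𝓝 (∫ x, TopologicalSpace.denseSeq C(X, ℝ) i x ∂(μ : Measure X))) :=
    ae_all_iff.2 fun i => hslln _
  -- `x` is a generic sample; the dense family suffices by uniform approximation
  obtain ⟨x, hx⟩ := hall.exists
  have hx' : ∀ f : C(X, ℝ), Tendsto (fun N : ℕ => (∑ j ∈ Finset.range N, f (x j)) / N)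
      atTop (𝓝 (∫ y, f y ∂(μ : Measure X))) := by
    intro f
    rw [Metric.tendsto_nhds]
    intro ε hε
    obtain ⟨i, hi⟩ := (TopologicalSpace.denseRange_denseSeq C(X, ℝ)).exists_dist_lt f
      (show 0 < ε / 3 by positivity)
    set g := TopologicalSpace.denseSeq C(X, ℝ) i
    have hfg : ∀ y, |f y - g y| ≤ ε / 3 := fun y =>
      (ContinuousMap.dist_apply_le_dist (f := f) (g := g) y).trans hi.le
    filter_upwards [Metric.tendsto_nhds.1 (hx i) (ε / 3) (by positivity), eventually_gt_atTop 0]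
      with N hN hN0
    have hN0' : (0 : ℝ) < N := by exact_mod_cast hN0
    have h1 : |(∑ j ∈ Finset.range N, f (x j)) / N - (∑ j ∈ Finset.range N, g (x j)) / N|
        ≤ ε / 3 := by
      rw [← sub_div, abs_div, abs_of_pos hN0', div_le_iff₀ hN0', ← Finset.sum_sub_distrib]
      calc _ ≤ ∑ j ∈ Finset.range N, |f (x j) - g (x j)| := Finset.abs_sum_le_sum_abs _ _
        _ ≤ ∑ j ∈ Finset.range N, ε / 3 := Finset.sum_le_sum fun j _ => hfg _
        _ = _ := by simp [mul_comm]
    have hint : ∀ f : C(X, ℝ), Integrable f (μ : Measure X) := fun f =>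
      integrable_of_continuous f.continuous _
    have h2 : |∫ y, g y ∂(μ : Measure X) - ∫ y, f y ∂(μ : Measure X)| ≤ ε / 3 := by
      rw [abs_sub_comm, ← integral_sub (hint f) (hint g), ← Real.norm_eq_abs]
      simpa using norm_integral_le_of_norm_le_const (μ := (μ : Measure X))
        (f := fun y => f y - g y) (ae_of_all _ hfg)
    rw [Real.dist_eq] at hN ⊢
    rw [abs_lt] at *
    rw [abs_le] at *
    constructor <;> linarith
  refine ⟨x, tendsto_of_forall_continuousMap fun f => ?_⟩
  have hinv : Tendsto (fun N : ℕ => (N : ℝ)⁻¹ * ∑ j ∈ Finset.range n, f (x j)) atTop (𝓝 0) := by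
    simpa using tendsto_inv_atTop_nhds_zero_nat.mul_const (∑ j ∈ Finset.range n, f (x j))
  -- leaving out the first `n` terms does not change the limit of the averages
  have h3 := (hx' f).sub hinv
  rw [sub_zero] at h3
  refine h3.congr' ?_
  filter_upwards [eventually_ge_atTop n] with N hN
  rw [integral_smul_sum_pointMass, Finset.sum_Ico_eq_sub _ hN]
  push_cast
  ring

theorem lintegral_pi_prod {ι Y : Type*} [Fintype ι] [MeasurableSpace Y]
    (μ : ι → Measure Y) [∀ i, IsProbabilityMeasure (μ i)] {f : ι → Y → ℝ≥0∞}
    (hf : ∀ i, Measurable (f i)) :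
    ∫⁻ x, ∏ i, f i (x i) ∂(Measure.pi μ) = ∏ i, ∫⁻ y, f i y ∂(μ i) := by
  have h := ProbabilityTheory.iIndepFun_pi (μ := μ) (X := f) (fun i => (hf i).aemeasurable)
  rw [ProbabilityTheory.lintegral_prod_eq_prod_lintegral_of_indepFun _ _ h
    (fun i => (hf i).comp (measurable_pi_apply i))]
  refine Finset.prod_congr rfl fun i _ => ?_
  have h2 := measurePreserving_eval μ i
  conv_rhs => rw [← h2.map_eq]
  rw [lintegral_map (hf i) (measurable_pi_apply i)]

theorem pi_withDensity {ι Y : Type*} [Fintype ι] [MeasurableSpace Y]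
    (μ : ι → Measure Y) [∀ i, IsProbabilityMeasure (μ i)] {f : ι → Y → ℝ≥0∞}
    (hf : ∀ i, Measurable (f i)) [∀ i, SigmaFinite ((μ i).withDensity (f i))] :
    Measure.pi (fun i => (μ i).withDensity (f i)) =
      (Measure.pi μ).withDensity fun x => ∏ i, f i (x i) := by
  refine (Measure.pi_eq (μ := fun i => (μ i).withDensity (f i)) fun s hs => ?_)
  rw [withDensity_apply _ (MeasurableSet.univ_pi hs),
    ← lintegral_indicator (MeasurableSet.univ_pi hs)]
  have : ∀ x : ι → Y, (Set.univ.pi s).indicator (fun x => ∏ i, f i (x i)) x =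
      ∏ i, (s i).indicator (f i) (x i) := by
    intro x
    by_cases hx : x ∈ Set.univ.pi s
    · rw [Set.indicator_of_mem hx]
      exact Finset.prod_congr rfl fun i _ =>
        (Set.indicator_of_mem (hx i (Set.mem_univ i)) _).symm
    · rw [Set.indicator_of_notMem hx]
      simp only [Set.mem_pi, Set.mem_univ, true_implies, not_forall] at hx
      obtain ⟨i, hi⟩ := hx
      exact (Finset.prod_eq_zero (Finset.mem_univ i) (Set.indicator_of_notMem hi _)).symm
  simp_rw [this]
  rw [lintegral_pi_prod μ fun i => (hf i).indicator (hs i)]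
  refine Finset.prod_congr rfl fun i _ => ?_
  rw [lintegral_indicator (hs i), withDensity_apply _ (hs i)]

/-- Splitting the coordinates of a power of a measure into a first and a second block. -/
theorem lintegral_pi_append {Y : Type*} [MeasurableSpace Y] (μ : Measure Y)
    [IsProbabilityMeasure μ] (n m : ℕ) {f : (Fin (n + m) → Y) → ℝ≥0∞} (hf : Measurable f) :
    ∫⁻ x, f x ∂(Measure.pi fun _ => μ) =
      ∫⁻ u, ∫⁻ v, f (Fin.append u v) ∂(Measure.pi fun _ : Fin m => μ)
        ∂(Measure.pi fun _ : Fin n => μ) := by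
  have hm : Measurable fun p : (Fin n → Y) × (Fin m → Y) => Fin.append p.1 p.2 := by
    refine measurable_pi_iff.2 fun i => ?_
    induction i using Fin.addCases with
    | left i =>
      simp only [Fin.append_left]
      exact (measurable_pi_apply i).comp measurable_fst
    | right i =>
      simp only [Fin.append_right]
      exact (measurable_pi_apply i).comp measurable_snd
  have hmap : ((Measure.pi fun _ : Fin n => μ).prod (Measure.pi fun _ : Fin m => μ)).map
      (fun p => Fin.append p.1 p.2) = Measure.pi fun _ : Fin (n + m) => μ := by
    refine (Measure.pi_eq fun s hs => ?_).symm
    rw [Measure.map_apply hm (MeasurableSet.univ_pi hs)]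
    have : (fun p : (Fin n → Y) × (Fin m → Y) => Fin.append p.1 p.2) ⁻¹' Set.univ.pi s =
        (Set.univ.pi fun i => s (Fin.castAdd m i)) ×ˢ
          (Set.univ.pi fun i => s (Fin.natAdd n i)) := by
      ext p
      simp only [Set.mem_preimage, Set.mem_pi, Set.mem_univ, true_implies, Set.mem_prod]
      constructor
      · intro h
        exact ⟨fun i => by simpa using h (Fin.castAdd m i),
          fun i => by simpa using h (Fin.natAdd n i)⟩
      · rintro ⟨h1, h2⟩ i
        induction i using Fin.addCases with
        | left i => simpa using h1 i
        | right i => simpa using h2 i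
    rw [this, Measure.prod_prod, Measure.pi_pi, Measure.pi_pi, Fin.prod_univ_add]
  rw [← hmap, lintegral_map hf hm]
  exact lintegral_prod _ (hf.comp hm).aemeasurable

end Tools

/-! ### Integral representation and uniform bounds for the derivative -/

section Representation

theorem mass_pointMass {X : Type*} [MeasurableSpace X] (x : X) : (pointMass x).mass = 1 := by
  simpa using mass_smul_sum_pointMass (1 : ℝ≥0) {()} (fun _ => x)

variable {X : Type*} [MetricSpace X] [CompactSpace X] [MeasurableSpace X] [BorelSpace X]
  {Φ : FiniteMeasure X → ℝ}

theorem continuous_pointMass : Continuous (pointMass : X → FiniteMeasure X) := by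
  refine FiniteMeasure.continuous_iff_forall_continuousMap_continuous_integral.2 fun f => ?_
  simpa [pointMass] using f.continuous

theorem IsProperInteraction.continuous_pointDeriv (hΦ : IsProperInteraction Φ)
    (ν : FiniteMeasure X) : Continuous (pointDeriv Φ ν) := by
  have h := (hΦ.continuousOn_posDeriv_right ν 1).comp_continuous continuous_pointMass
    (fun x => (mass_pointMass x).le)
  exact h

/-- `Φ⁽¹⁾(ν, ·)` is integration of `Φ⁽¹⁾(ν, δ_x)`: both sides are continuous, and they agree on
empirical measures by linearity. -/
theorem IsProperInteraction.posDeriv_eq_integral_of_probability (hΦ : IsProperInteraction Φ)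
    (ν : FiniteMeasure X) (μ : ProbabilityMeasure X) :
    posDeriv Φ ν μ.toFiniteMeasure = ∫ x, pointDeriv Φ ν x ∂(μ : Measure X) := by
  obtain ⟨x, hx⟩ := exists_tendsto_empirical μ 0
  have hmass : ∀ N : ℕ, ((N : ℝ≥0)⁻¹ • ∑ j ∈ Finset.Ico 0 N, pointMass (x j)).mass ≤ 1 := by
    intro N
    rw [mass_smul_sum_pointMass, Nat.card_Ico, Nat.sub_zero]
    exact inv_mul_le_one
  have h1 : Tendsto (fun N : ℕ => posDeriv Φ ν
      ((N : ℝ≥0)⁻¹ • ∑ j ∈ Finset.Ico 0 N, pointMass (x j))) atTop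
      (𝓝 (posDeriv Φ ν μ.toFiniteMeasure)) := by
    have h := hΦ.continuousOn_posDeriv_right ν 1 μ.toFiniteMeasure
      (show μ.toFiniteMeasure.mass ≤ 1 from (ProbabilityMeasure.mass_toFiniteMeasure μ).le)
    exact h.tendsto.comp (tendsto_nhdsWithin_iff.2 ⟨hx, Eventually.of_forall hmass⟩)
  have h2 := ((FiniteMeasure.continuous_integral_continuousMap
    (⟨_, hΦ.continuous_pointDeriv ν⟩ : C(X, ℝ))).tendsto μ.toFiniteMeasure).comp hx
  refine tendsto_nhds_unique h1 (h2.congr fun N => ?_)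
  simp only [Function.comp]
  rw [integral_smul_sum_pointMass, hΦ.posDeriv_smul, hΦ.posDeriv_sum]
  rfl

/-- The derivatives `Φ⁽¹⁾(ν, δ_x)` are bounded uniformly in `x` and in `ν` of bounded mass: by
Baire's theorem `Φ⁽¹⁾(ν, μ)` is bounded uniformly in `ν` for `μ` near some probability measure
`μ₀`, and `(1 - t) μ₀ + t δ_x` is near `μ₀` for small `t`, uniformly in `x`. -/
theorem IsProperInteraction.exists_abs_pointDeriv_le (hΦ : IsProperInteraction Φ) (R : ℝ≥0) :
    ∃ C : ℝ, 0 ≤ C ∧ ∀ ν : FiniteMeasure X, ν.mass ≤ R → ∀ x, |pointDeriv Φ ν x| ≤ C := by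
  rcases isEmpty_or_nonempty X with hX | hX
  · exact ⟨0, le_rfl, fun ν _ x => isEmptyElim x⟩
  let E : ℕ → Set (ProbabilityMeasure X) := fun m =>
    {μ | ∀ ν : FiniteMeasure X, ν.mass ≤ R → |posDeriv Φ ν μ.toFiniteMeasure| ≤ m}
  have hcont : ∀ ν : FiniteMeasure X,
      Continuous fun μ : ProbabilityMeasure X => posDeriv Φ ν μ.toFiniteMeasure := fun ν =>
    (hΦ.continuousOn_posDeriv_right ν 1).comp_continuous
      ProbabilityMeasure.toFiniteMeasure_continuous
      (fun μ => (ProbabilityMeasure.mass_toFiniteMeasure μ).le)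
  have hclosed : ∀ m, IsClosed (E m) := by
    intro m
    have : E m = ⋂ ν : FiniteMeasure X, ⋂ _ : ν.mass ≤ R,
        {μ : ProbabilityMeasure X | |posDeriv Φ ν μ.toFiniteMeasure| ≤ m} := by
      ext μ; simp [E]
    rw [this]
    exact isClosed_iInter fun ν => isClosed_iInter fun _ =>
      isClosed_le (hcont ν).abs continuous_const
  have hcover : ⋃ m, E m = Set.univ := by
    refine Set.eq_univ_of_forall fun μ => ?_
    have hK := isCompact_setOfPred_finiteMeasure_le_of_compactSpace X R
    obtain ⟨C, hC⟩ := hK.exists_bound_of_continuousOn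
      (hΦ.continuous_posDeriv μ.toFiniteMeasure).continuousOn
    obtain ⟨m, hm⟩ := exists_nat_ge C
    exact Set.mem_iUnion.2 ⟨m, fun ν hν => (hC ν hν).trans hm⟩
  have hne : Nonempty (ProbabilityMeasure X) := ⟨⟨Measure.dirac hX.some, inferInstance⟩⟩
  obtain ⟨m, μ₀, hμ₀⟩ := nonempty_interior_of_iUnion_of_closed hclosed hcover
  -- `(t, x) ↦ (1 - t) μ₀ + t δ_x` is continuous, with value `μ₀` at `t = 0`
  let G : Set.Icc (0 : ℝ) 1 × X → ProbabilityMeasure X := fun p =>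
    ⟨(Real.toNNReal (1 - p.1) • μ₀.toFiniteMeasure + Real.toNNReal p.1 • pointMass p.2 :
      FiniteMeasure X), ⟨by
        have h1 := ProbabilityMeasure.mass_toFiniteMeasure μ₀
        have h2 := mass_pointMass p.2
        rw [← FiniteMeasure.ennreal_mass, ENNReal.coe_eq_one, ← NNReal.coe_inj]
        rw [FiniteMeasure.mass] at *
        simp only [FiniteMeasure.coeFn_add, FiniteMeasure.coeFn_smul, Pi.add_apply, Pi.smul_apply,
          h1, h2, smul_eq_mul, mul_one, NNReal.coe_add, NNReal.coe_one]
        rw [Real.coe_toNNReal _ (sub_nonneg.2 p.1.2.2), Real.coe_toNNReal _ p.1.2.1]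
        ring⟩⟩
  have hGf : ∀ p, (G p).toFiniteMeasure = Real.toNNReal (1 - p.1) • μ₀.toFiniteMeasure +
      Real.toNNReal p.1 • pointMass p.2 := fun p => rfl
  have hG : Continuous G := by
    refine (ProbabilityMeasure.toFiniteMeasure_isEmbedding X).continuous_iff.2 ?_
    refine Continuous.add ?_ ?_
    · exact (continuous_real_toNNReal.comp (continuous_const.sub
        (continuous_subtype_val.comp continuous_fst))).smul continuous_const
    · exact (continuous_real_toNNReal.comp
        (continuous_subtype_val.comp continuous_fst)).smul
          (continuous_pointMass.comp continuous_snd)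
  let z : Set.Icc (0 : ℝ) 1 := ⟨0, by simp⟩
  have hz : ∀ x, G (z, x) = μ₀ := fun x => by
    apply (ProbabilityMeasure.toFiniteMeasure_isEmbedding X).injective
    rw [hGf]; simp [z]
  have hU : ∀ᶠ t in 𝓝 z, ∀ x ∈ (Set.univ : Set X), G (t, x) ∈ interior (E m) := by
    refine isCompact_univ.eventually_forall_of_forall_eventually fun x _ => ?_
    refine (hG.tendsto (z, x)).eventually_mem ?_
    rw [hz]
    exact isOpen_interior.mem_nhds hμ₀
  obtain ⟨t, ht0, ht⟩ : ∃ t : Set.Icc (0 : ℝ) 1, 0 < (t : ℝ) ∧ ∀ x, G (t, x) ∈ E m := by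
    obtain ⟨δ, hδ, h⟩ := Metric.eventually_nhds_iff.1 hU
    refine ⟨⟨min 1 (δ / 2), by positivity, min_le_left _ _⟩, by positivity, fun x =>
      interior_subset (h ?_ x trivial)⟩
    rw [Subtype.dist_eq, Real.dist_eq]
    simp only [z, sub_zero]
    rw [abs_of_pos (by positivity)]
    exact (min_le_right _ _).trans_lt (by linarith)
  refine ⟨2 * m / t, by positivity, fun ν hν x => ?_⟩
  have h1 := ht x ν hν
  have h2 := interior_subset hμ₀ ν hν
  rw [hGf, hΦ.posDeriv_add, hΦ.posDeriv_smul, hΦ.posDeriv_smul,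
    Real.coe_toNNReal _ (sub_nonneg.2 t.2.2), Real.coe_toNNReal _ t.2.1] at h1
  change |(1 - (t : ℝ)) * posDeriv Φ ν μ₀.toFiniteMeasure + t * pointDeriv Φ ν x| ≤ m at h1
  have h3 : |(1 - (t : ℝ)) * posDeriv Φ ν μ₀.toFiniteMeasure| ≤ m := by
    rw [abs_mul, abs_of_nonneg (sub_nonneg.2 t.2.2)]
    calc _ ≤ 1 * |posDeriv Φ ν μ₀.toFiniteMeasure| :=
          mul_le_mul_of_nonneg_right (by linarith) (abs_nonneg _)
      _ ≤ m := by rw [one_mul]; exact h2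
  rw [abs_le] at h1 h3
  rw [abs_le, le_div_iff₀ ht0, ← neg_div, div_le_iff₀ ht0]
  constructor <;> nlinarith

end Representation

/-! ### Relative entropy -/

section Entropy

open InformationTheory

theorem abs_exp_sub_exp_le {a b M : ℝ} (ha : a ≤ M) (hb : b ≤ M) :
    |Real.exp a - Real.exp b| ≤ Real.exp M * |a - b| := by
  wlog hab : b ≤ a generalizing a b
  · rw [abs_sub_comm, abs_sub_comm a]
    exact this hb ha (le_of_not_ge hab)
  rw [abs_of_nonneg (sub_nonneg.2 (Real.exp_le_exp.2 hab)), abs_of_nonneg (sub_nonneg.2 hab)]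
  have h1 : Real.exp b = Real.exp a * Real.exp (b - a) := by rw [← Real.exp_add]; ring_nf
  have h2 := Real.add_one_le_exp (b - a)
  have h3 := Real.exp_le_exp.2 ha
  have h4 := Real.exp_pos a
  rw [h1]
  nlinarith

theorem abs_sub_clamp_le {a M : ℝ} (h1 : -M ≤ a) (h2 : a ≤ M) (b : ℝ) :
    |a - max (-M) (min b M)| ≤ |a - b| := by
  rcases max_cases (-M) (min b M) with h | h <;> rcases min_cases b M with h' | h' <;>
    rcases abs_cases (a - max (-M) (min b M)) with h3 | h3 <;>
    rcases abs_cases (a - b) with h4 | h4 <;> linarith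

variable {X : Type*} [MetricSpace X] [CompactSpace X] [MeasurableSpace X] [BorelSpace X]

/-- A bound on `∫ f dρ - log ∫ e^f dp` for continuous `f` extends to bounded measurable `f`. -/
theorem integral_sub_log_le_of_forall_continuous (ρ p : Measure X) [IsProbabilityMeasure ρ]
    [IsProbabilityMeasure p] {a : ℝ}
    (h : ∀ f : C(X, ℝ), ∫ x, f x ∂ρ - Real.log (∫ x, Real.exp (f x) ∂p) ≤ a)
    {f : X → ℝ} (hf : Measurable f) {M : ℝ} (hM : ∀ x, |f x| ≤ M) :
    ∫ x, f x ∂ρ - Real.log (∫ x, Real.exp (f x) ∂p) ≤ a := by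
  have hMb : ∀ x, f x ≤ M ∧ -M ≤ f x := fun x => ⟨(abs_le.1 (hM x)).2, (abs_le.1 (hM x)).1⟩
  have hint : ∀ (μ : Measure X) [IsFiniteMeasure μ], Integrable f μ := fun μ _ =>
    Integrable.of_bound hf.aestronglyMeasurable M (ae_of_all _ hM)
  have hexp : Integrable (fun x => Real.exp (f x)) p :=
    Integrable.of_bound hf.exp.aestronglyMeasurable (Real.exp M) (ae_of_all _ fun x => by
      rw [Real.norm_eq_abs, abs_of_pos (Real.exp_pos _)]
      exact Real.exp_le_exp.2 (hMb x).1)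
  have hpos : 0 < ∫ x, Real.exp (f x) ∂p := integral_exp_pos hexp
  -- approximation of `f` in `L¹(ρ + p)` by continuous functions truncated to `[-M, M]`
  have key : ∀ i : ℕ, ∃ g : C(X, ℝ), (∀ x, g x ≤ M) ∧
      ∫ x, |f x - g x| ∂(ρ + p) ≤ 1 / ((i : ℝ) + 1) := by
    intro i
    obtain ⟨g, hg, -⟩ := (hint (ρ + p)).exists_boundedContinuous_integral_sub_le
      (Nat.one_div_pos_of_nat (α := ℝ) (n := i))
    have hgc : Continuous g := g.continuous
    let g' : C(X, ℝ) := ⟨fun x => max (-M) (min (g x) M), by fun_prop⟩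
    refine ⟨g', fun x => max_le (by linarith [(hMb x).1, (hMb x).2]) (min_le_right _ _),
      (integral_mono ?_ ?_ fun x => ?_).trans hg⟩
    · exact ((hint _).sub (integrable_of_continuous g'.continuous _)).abs
    · exact ((hint _).sub (integrable_of_continuous hgc _)).norm
    · have h1 := hMb x
      change |f x - max (-M) (min (g x) M)| ≤ |f x - g x|
      exact abs_sub_clamp_le h1.2 h1.1 _
  choose g hgM hg using key
  have hlim : Tendsto (fun i : ℕ => 1 / ((i : ℝ) + 1)) atTop (𝓝 0) :=
    tendsto_one_div_add_atTop_nhds_zero_nat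
  have hgi : ∀ i (μ : Measure X) [IsFiniteMeasure μ], Integrable (g i) μ := fun i μ _ =>
    integrable_of_continuous (g i).continuous _
  have hsum : ∀ i, ∫ x, |f x - g i x| ∂ρ ≤ 1 / ((i : ℝ) + 1) ∧
      ∫ x, |f x - g i x| ∂p ≤ 1 / ((i : ℝ) + 1) := by
    intro i
    have hd : ∀ (μ : Measure X) [IsFiniteMeasure μ], Integrable (fun x => |f x - g i x|) μ :=
      fun μ _ => ((hint μ).sub (hgi i μ)).abs
    have h1 := hg i
    rw [integral_add_measure (hd ρ) (hd p)] at h1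
    have h2 : 0 ≤ ∫ x, |f x - g i x| ∂ρ := integral_nonneg fun x => abs_nonneg _
    have h3 : 0 ≤ ∫ x, |f x - g i x| ∂p := integral_nonneg fun x => abs_nonneg _
    exact ⟨by linarith, by linarith⟩
  have ht1 : Tendsto (fun i => ∫ x, g i x ∂ρ) atTop (𝓝 (∫ x, f x ∂ρ)) := by
    rw [tendsto_iff_dist_tendsto_zero]
    refine squeeze_zero (fun _ => dist_nonneg) (fun i => ?_) hlim
    rw [dist_comm, Real.dist_eq, ← integral_sub (hint ρ) (hgi i ρ)]
    exact (abs_integral_le_integral_abs).trans (hsum i).1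
  have ht2 : Tendsto (fun i => ∫ x, Real.exp (g i x) ∂p) atTop (𝓝 (∫ x, Real.exp (f x) ∂p)) := by
    rw [tendsto_iff_dist_tendsto_zero]
    have hlim2 := hlim.const_mul (Real.exp M)
    rw [mul_zero] at hlim2
    refine squeeze_zero (fun _ => dist_nonneg) (fun i => ?_) hlim2
    have hge : Integrable (fun x => Real.exp (g i x)) p :=
      integrable_of_continuous (Real.continuous_exp.comp (g i).continuous) _
    rw [dist_comm, Real.dist_eq, ← integral_sub hexp hge]
    calc _ ≤ ∫ x, |Real.exp (f x) - Real.exp (g i x)| ∂p := abs_integral_le_integral_abs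
      _ ≤ ∫ x, Real.exp M * |f x - g i x| ∂p := integral_mono (hexp.sub hge).abs
          (((hint p).sub (hgi i p)).abs.const_mul _)
          (fun x => abs_exp_sub_exp_le (hMb x).1 (hgM i x))
      _ ≤ _ := by
          rw [integral_const_mul]
          exact mul_le_mul_of_nonneg_left (hsum i).2 (Real.exp_pos _).le
  exact le_of_tendsto (ht1.sub (ht2.log hpos.ne')) (Eventually.of_forall fun i => h (g i))

/-- The Donsker–Varadhan bound: relative entropy is at most the supremum of
`∫ f dρ - log ∫ e^f dp` over continuous functions `f`. -/
theorem exists_continuous_lt_integral_sub_log (ρ p : Measure X) [IsProbabilityMeasure ρ]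
    [IsProbabilityMeasure p] {a : ℝ} (ha : (a : EReal) < (klDiv ρ p : ℝ≥0∞)) :
    ∃ f : C(X, ℝ), a < ∫ x, f x ∂ρ - Real.log (∫ x, Real.exp (f x) ∂p) := by
  by_contra! hcon
  have hB := fun {f : X → ℝ} (hf : Measurable f) {M : ℝ} (hM : ∀ x, |f x| ≤ M) =>
    integral_sub_log_le_of_forall_continuous ρ p hcon hf hM
  have ha0 : 0 ≤ a := by simpa using hcon 0
  -- if `p A = 0 < ρ A`, large multiples of the indicator of `A` violate the bound
  have hac : ρ ≪ p := by
    refine Measure.AbsolutelyContinuous.mk fun A hA hpA => ?_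
    by_contra hρA
    have hpos : 0 < ρ.real A := ENNReal.toReal_pos hρA (measure_ne_top _ _)
    obtain ⟨M, hM⟩ := exists_nat_gt (a / ρ.real A)
    rw [div_lt_iff₀ hpos] at hM
    have h1 := hB (f := A.indicator fun _ => (M : ℝ)) (measurable_const.indicator hA) (M := M)
      (fun x => by
        by_cases hx : x ∈ A <;> simp [hx])
    have h2 : ∫ x, Real.exp (A.indicator (fun _ => (M : ℝ)) x) ∂p = 1 := by
      have : (fun x => Real.exp (A.indicator (fun _ => (M : ℝ)) x)) =ᵐ[p] fun _ => 1 := by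
        filter_upwards [measure_eq_zero_iff_ae_notMem.1 hpA] with x hx
        simp [hx]
      rw [integral_congr_ae this]
      simp
    rw [h2, integral_indicator hA] at h1
    simp only [integral_const, MeasurableSet.univ, measureReal_restrict_apply, Set.univ_inter,
      smul_eq_mul, Real.log_one, sub_zero] at h1
    linarith
  set h : X → ℝ := fun x => (ρ.rnDeriv p x).toReal with hh
  have hhm : Measurable h := (Measure.measurable_rnDeriv ρ p).ennreal_toReal
  have hh0 : ∀ x, 0 ≤ h x := fun x => ENNReal.toReal_nonneg
  have hhi : Integrable h p := Measure.integrable_toReal_rnDeriv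
  have hh1 : ∫ x, h x ∂p = 1 := by
    rw [hh, Measure.integral_toReal_rnDeriv hac]; simp
  -- the truncation of `h` to `[e^{-M}, e^M]` with `M = i + 1`
  let c : ℕ → X → ℝ := fun i x =>
    max (Real.exp (-((i : ℝ) + 1))) (min (h x) (Real.exp ((i : ℝ) + 1)))
  have hc0 : ∀ (i : ℕ) x, Real.exp (-((i : ℝ) + 1)) ≤ c i x := fun i x => le_max_left _ _
  have hc0' : ∀ (i : ℕ) x, 0 < c i x := fun i x => (Real.exp_pos _).trans_le (hc0 i x)
  have hc1 : ∀ (i : ℕ) x, c i x ≤ Real.exp ((i : ℝ) + 1) := fun i x =>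
    max_le (Real.exp_le_exp.2 (by linarith [(Nat.cast_nonneg i : (0 : ℝ) ≤ i)])) (min_le_right _ _)
  have hcm : ∀ i, Measurable (c i) := fun i => measurable_const.max (hhm.min measurable_const)
  have hlog : ∀ (i : ℕ) x, |Real.log (c i x)| ≤ (i : ℝ) + 1 := by
    intro i x
    rw [abs_le]
    exact ⟨(Real.le_log_iff_exp_le (hc0' i x)).2 (hc0 i x),
      (Real.log_le_iff_le_exp (hc0' i x)).2 (hc1 i x)⟩
  have hcint : ∀ i, Integrable (c i) p := fun i =>
    Integrable.of_bound (hcm i).aestronglyMeasurable (Real.exp ((i : ℝ) + 1))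
      (ae_of_all _ fun x => by
        rw [Real.norm_eq_abs, abs_of_pos (hc0' i x)]; exact hc1 i x)
  have hbound : ∀ i : ℕ, ∫ x, Real.log (c i x) ∂ρ ≤ a + Real.exp (-((i : ℝ) + 1)) := by
    intro i
    have h1 := hB (f := fun x => Real.log (c i x)) (hcm i).log (hlog i)
    simp_rw [Real.exp_log (hc0' i _)] at h1
    have h2 : ∫ x, c i x ∂p ≤ 1 + Real.exp (-((i : ℝ) + 1)) := by
      calc _ ≤ ∫ x, (h x + Real.exp (-((i : ℝ) + 1))) ∂p :=
            integral_mono (hcint i) (hhi.add (integrable_const _)) fun x =>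
              max_le (by linarith [hh0 x])
                ((min_le_left _ _).trans (by linarith [Real.exp_pos (-((i : ℝ) + 1))]))
        _ = _ := by rw [integral_add hhi (integrable_const _), hh1]; simp
    have h3 : 0 < ∫ x, c i x ∂p := by
      calc 0 < Real.exp (-((i : ℝ) + 1)) := Real.exp_pos _
        _ = ∫ x, Real.exp (-((i : ℝ) + 1)) ∂p := by simp
        _ ≤ _ := integral_mono (integrable_const _) (hcint i) (hc0 i)
    have h4 := Real.log_le_sub_one_of_pos h3
    linarith
  -- `φ i ≥ 0` approximates `klFun h = h log h + 1 - h`, so that Fatou's lemma applies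
  let φ : ℕ → X → ℝ := fun i x => h x * Real.log (c i x) + 1 - h x
  have hφ0 : ∀ (i : ℕ) x, 0 ≤ φ i x := by
    intro i x
    have hi : (0 : ℝ) ≤ i := Nat.cast_nonneg i
    have hx := hh0 x
    simp only [φ]
    rcases le_total (h x) (Real.exp (i + 1)) with h1 | h1
    · rcases le_total (Real.exp (-(i + 1))) (h x) with h2 | h2
      · have : c i x = h x := by simp only [c]; rw [min_eq_left h1, max_eq_right h2]
        rw [this]
        exact klFun_nonneg hx
      · have : c i x = Real.exp (-(i + 1)) := by
          simp only [c]; rw [min_eq_left h1, max_eq_left h2]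
        rw [this, Real.log_exp]
        have h3 := Real.add_one_le_exp ((i : ℝ) + 1)
        have h4 : Real.exp (-((i : ℝ) + 1)) * Real.exp (i + 1) = 1 := by
          rw [← Real.exp_add]; simp
        nlinarith [Real.exp_pos (-((i : ℝ) + 1))]
    · have : c i x = Real.exp (i + 1) := by
        simp only [c]
        rw [min_eq_right h1, max_eq_right (Real.exp_le_exp.2 (by linarith))]
      rw [this, Real.log_exp]
      nlinarith
  have hφm : ∀ i, Measurable (φ i) := fun i =>
    ((hhm.mul (hcm i).log).add_const _).sub hhm
  have hφlim : ∀ x, Tendsto (fun i => φ i x) atTop (𝓝 (klFun (h x))) := by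
    intro x
    rcases (hh0 x).eq_or_lt with h0 | h0
    · simp only [φ, ← h0, klFun_zero, zero_mul]
      simp
    · refine tendsto_const_nhds.congr' ?_
      obtain ⟨m, hm⟩ := exists_nat_ge |Real.log (h x)|
      filter_upwards [eventually_ge_atTop m] with i hi
      have hi' : |Real.log (h x)| ≤ (i : ℝ) + 1 := by
        have : (m : ℝ) ≤ i := by exact_mod_cast hi
        linarith
      have h1 : h x ≤ Real.exp (i + 1) := (Real.log_le_iff_le_exp h0).1 (abs_le.1 hi').2
      have h2 : Real.exp (-(i + 1)) ≤ h x := (Real.le_log_iff_exp_le h0).1 (abs_le.1 hi').1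
      have : c i x = h x := by simp only [c]; rw [min_eq_left h1, max_eq_right h2]
      simp only [φ, this, klFun_apply]
  have hφint : ∀ i, ∫⁻ x, ENNReal.ofReal (φ i x) ∂p ≤
      ENNReal.ofReal (a + Real.exp (-((i : ℝ) + 1))) := by
    intro i
    have hlogint : Integrable (fun x => h x * Real.log (c i x)) p :=
      hhi.mul_bdd (c := (i : ℝ) + 1) (hcm i).log.aestronglyMeasurable (ae_of_all _ (hlog i))
    have hlogint' : Integrable (fun x => h x * Real.log (c i x) + 1) p :=
      hlogint.add (integrable_const _)
    have hφi : Integrable (φ i) p := hlogint'.sub hhi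
    rw [← ofReal_integral_eq_lintegral_ofReal hφi (ae_of_all _ (hφ0 i))]
    refine ENNReal.ofReal_le_ofReal ?_
    have e1 : ∫ x, φ i x ∂p = ∫ x, Real.log (c i x) ∂ρ := by
      simp only [φ]
      rw [integral_sub hlogint' hhi,
        integral_add hlogint (integrable_const _), hh1]
      have := integral_rnDeriv_smul (f := fun x => Real.log (c i x)) hac
      simp only [smul_eq_mul] at this
      rw [hh, this]
      simp
    rw [e1]
    exact hbound i
  have hkl : klDiv ρ p ≤ ENNReal.ofReal a := by
    rw [klDiv_eq_lintegral_klFun_of_ac hac]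
    calc ∫⁻ x, ENNReal.ofReal (klFun (h x)) ∂p
        = ∫⁻ x, liminf (fun i => ENNReal.ofReal (φ i x)) atTop ∂p :=
          lintegral_congr fun x => (ENNReal.tendsto_ofReal (hφlim x)).liminf_eq.symm
      _ ≤ liminf (fun i => ∫⁻ x, ENNReal.ofReal (φ i x) ∂p) atTop :=
          lintegral_liminf_le fun i => (hφm i).ennreal_ofReal
      _ ≤ liminf (fun i : ℕ => ENNReal.ofReal (a + Real.exp (-((i : ℝ) + 1)))) atTop :=
          liminf_le_liminf (Eventually.of_forall hφint)
      _ = ENNReal.ofReal a := by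
          refine Tendsto.liminf_eq (ENNReal.tendsto_ofReal ?_)
          have h1 : Tendsto (fun i : ℕ => Real.exp (-((i : ℝ) + 1))) atTop (𝓝 0) :=
            Real.tendsto_exp_neg_atTop_nhds_zero.comp
              (tendsto_atTop_add_const_right _ _ tendsto_natCast_atTop_atTop)
          simpa using h1.const_add a
  have h1 : ((klDiv ρ p : ℝ≥0∞) : EReal) ≤ a := by
    have := EReal.coe_ennreal_le_coe_ennreal_iff.2 hkl
    rwa [EReal.coe_ennreal_ofReal, max_eq_left ha0] at this
  exact absurd ha (not_lt.2 h1)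

/-- Convexity of relative entropy along the segment from `ρ` to the reference measure `p`. -/
theorem klDiv_mix_le {Y : Type*} [MeasurableSpace Y] (ρ p : Measure Y) [IsProbabilityMeasure ρ]
    [IsProbabilityMeasure p] (hρ : klDiv ρ p ≠ ∞) {t : ℝ≥0} (ht : t ≤ 1) :
    klDiv ((1 - t) • ρ + t • p) p ≤ (1 - t : ℝ≥0) * klDiv ρ p := by
  have hac : ρ ≪ p := (klDiv_ne_top_iff.1 hρ).1
  have hac' : (1 - t) • ρ + t • p ≪ p :=
    Measure.AbsolutelyContinuous.add_left (hac.smul_left _)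
      (Measure.AbsolutelyContinuous.rfl.smul_left _)
  rw [klDiv_eq_lintegral_klFun_of_ac hac, klDiv_eq_lintegral_klFun_of_ac hac',
    ← lintegral_const_mul']
  swap; · exact ENNReal.coe_ne_top
  refine lintegral_mono_ae ?_
  filter_upwards [Measure.rnDeriv_add ((1 - t) • ρ) (t • p) p,
    Measure.rnDeriv_smul_left ρ p (1 - t), Measure.rnDeriv_smul_left p p t,
    Measure.rnDeriv_self p, Measure.rnDeriv_ne_top ρ p] with x h1 h2 h3 h4 h5
  have e : (((1 - t) • ρ + t • p).rnDeriv p x).toReal =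
      (1 - (t : ℝ)) * (ρ.rnDeriv p x).toReal + t * 1 := by
    rw [h1, Pi.add_apply, h2, h3, Pi.smul_apply, Pi.smul_apply, h4, ENNReal.toReal_add]
    · simp [ht, ENNReal.smul_def]
    · exact ENNReal.mul_ne_top ENNReal.coe_ne_top h5
    · exact ENNReal.mul_ne_top ENNReal.coe_ne_top ENNReal.one_ne_top
  have ht' : (t : ℝ) ≤ 1 := by exact_mod_cast ht
  have hconv := convexOn_klFun.2
    (show (ρ.rnDeriv p x).toReal ∈ Set.Ici (0 : ℝ) from ENNReal.toReal_nonneg)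
    (show (1 : ℝ) ∈ Set.Ici (0 : ℝ) by simp) (show 0 ≤ 1 - (t : ℝ) by linarith) t.2
    (sub_add_cancel 1 (t : ℝ))
  rw [smul_eq_mul, smul_eq_mul, smul_eq_mul, smul_eq_mul, klFun_one, mul_zero, add_zero] at hconv
  rw [e, ← ENNReal.ofReal_coe_nnreal, ← ENNReal.ofReal_mul (NNReal.coe_nonneg _), NNReal.coe_sub ht]
  exact ENNReal.ofReal_le_ofReal hconv

end Entropy

/-! ### Feller densities -/

section Feller

open InformationTheory

variable {S S' : Type*}
    [MetricSpace S] [CompactSpace S] [MeasurableSpace S] [BorelSpace S]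
    [MetricSpace S'] [CompactSpace S'] [MeasurableSpace S'] [BorelSpace S']

/-- `q` is the density with respect to `α` of a probability kernel from `S'` to `S` that is weakly
continuous in its parameter, with `log q` bounded. -/
structure IsFellerDensity (α : Measure S) (q : S → S' → ℝ) : Prop where
  measurable : Measurable (Function.uncurry q)
  pos : ∀ σ η, 0 < q σ η
  bounded_log : ∃ C : ℝ, ∀ σ η, |Real.log (q σ η)| ≤ C
  mass : ∀ η, ∫ σ, q σ η ∂α = 1
  weakly_continuous : ∀ f : S → ℝ, Continuous f → Continuous fun η => ∫ σ, f σ * q σ η ∂α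

theorem le_exp_of_abs_log_le {x C : ℝ} (hx : 0 < x) (h : |Real.log x| ≤ C) :
    x ≤ Real.exp C ∧ Real.exp (-C) ≤ x :=
  ⟨(Real.log_le_iff_le_exp hx).1 (abs_le.1 h).2, (Real.le_log_iff_exp_le hx).1 (abs_le.1 h).1⟩

namespace IsFellerDensity

variable {α : Measure S} [IsProbabilityMeasure α] {q : S → S' → ℝ}

theorem measurable_left (hq : IsFellerDensity α q) (η : S') : Measurable fun σ => q σ η :=
  hq.measurable.comp (measurable_id.prodMk measurable_const)

theorem exists_bound (hq : IsFellerDensity α q) : ∃ C : ℝ, 0 < C ∧ ∀ σ η, q σ η ≤ C := by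
  obtain ⟨C, hC⟩ := hq.bounded_log
  exact ⟨Real.exp C, Real.exp_pos _, fun σ η => (le_exp_of_abs_log_le (hq.pos σ η) (hC σ η)).1⟩

theorem integrable_mul (hq : IsFellerDensity α q) {f : S → ℝ} (hf : Continuous f) (η : S') :
    Integrable (fun σ => f σ * q σ η) α := by
  obtain ⟨C, hC, h⟩ := hq.exists_bound
  refine (integrable_of_continuous hf α).mul_bdd (c := C)
    (hq.measurable_left η).aestronglyMeasurable (ae_of_all _ fun σ => ?_)
  rw [Real.norm_eq_abs, abs_of_pos (hq.pos σ η)]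
  exact h σ η

/-- The probability kernel with density `q`. -/
def _root_.MeanField.site (α : Measure S) (q : S → S' → ℝ) (η : S') : Measure S :=
  α.withDensity fun σ => ENNReal.ofReal (q σ η)

theorem integral_site (hq : IsFellerDensity α q) (f : S → ℝ) (η : S') :
    ∫ σ, f σ ∂(site α q η) = ∫ σ, f σ * q σ η ∂α := by
  rw [site, integral_withDensity_eq_integral_toReal_smul (hq.measurable_left η).ennreal_ofReal
    (ae_of_all _ fun _ => ENNReal.ofReal_lt_top)]
  refine integral_congr_ae (ae_of_all _ fun σ => ?_)
  simp only [smul_eq_mul]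
  rw [ENNReal.toReal_ofReal (hq.pos σ η).le, mul_comm]

theorem isProbabilityMeasure_site (hq : IsFellerDensity α q) (η : S') :
    IsProbabilityMeasure (site α q η) := by
  constructor
  rw [site, withDensity_apply _ MeasurableSet.univ, Measure.restrict_univ,
    ← ofReal_integral_eq_lintegral_ofReal _ (ae_of_all _ fun σ => (hq.pos σ η).le), hq.mass]
  · simp
  · simpa using hq.integrable_mul (f := fun _ => 1) continuous_const η

/-- Weak continuity of the kernel also holds for test functions that depend on the parameter. -/
theorem continuous_integral (hq : IsFellerDensity α q) (f : C(S × S', ℝ)) :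
    Continuous fun η => ∫ σ, f (σ, η) ∂(site α q η) := by
  let F : C(S', C(S, ℝ)) := (f.comp ⟨Prod.swap, continuous_swap⟩).curry
  have hF : ∀ η σ, F η σ = f (σ, η) := fun η σ => rfl
  refine continuous_iff_continuousAt.2 fun η₀ => ?_
  have h1 : Tendsto (fun η => ∫ σ, F η₀ σ ∂(site α q η)) (𝓝 η₀)
      (𝓝 (∫ σ, F η₀ σ ∂(site α q η₀))) := by
    simp_rw [hq.integral_site]
    exact (hq.weakly_continuous _ (F η₀).continuous).tendsto η₀
  have h2 : Tendsto (fun η => dist (F η) (F η₀)) (𝓝 η₀) (𝓝 0) :=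
    tendsto_iff_dist_tendsto_zero.1 (F.continuous.tendsto η₀)
  refine tendsto_of_tendsto_of_dist h1 (squeeze_zero (fun _ => dist_nonneg) (fun η => ?_) h2)
  have := hq.isProbabilityMeasure_site η
  rw [dist_comm, Real.dist_eq]
  change |∫ σ, F η σ ∂_ - ∫ σ, F η₀ σ ∂_| ≤ _
  rw [← integral_sub (integrable_of_continuous (F η).continuous _)
    (integrable_of_continuous (F η₀).continuous _), ← Real.norm_eq_abs]
  simpa using norm_integral_le_of_norm_le_const (μ := site α q η)
    (f := fun σ => F η σ - F η₀ σ)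
    (ae_of_all _ fun σ => ContinuousMap.dist_apply_le_dist (f := F η) (g := F η₀) σ)

/-- The law on `S × S'` with second marginal `lam` and conditional laws `q(σ, η) α(dσ)`. -/
def couplingMeasure (α : Measure S) (q : S → S' → ℝ) (lam : Measure S') : Measure (S × S') :=
  (α.prod lam).withDensity fun ξ => ENNReal.ofReal (q ξ.1 ξ.2)

theorem lintegral_coupling (hq : IsFellerDensity α q) (lam : Measure S') [IsProbabilityMeasure lam]
    {f : S × S' → ℝ≥0∞} (hf : Measurable f) :
    ∫⁻ ξ, f ξ ∂(couplingMeasure α q lam) = ∫⁻ η, ∫⁻ σ, f (σ, η) ∂(site α q η) ∂lam := by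
  have hm : Measurable fun ξ : S × S' => ENNReal.ofReal (q ξ.1 ξ.2) :=
    hq.measurable.ennreal_ofReal
  rw [couplingMeasure, lintegral_withDensity_eq_lintegral_mul _ hm hf,
    lintegral_prod_symm' _ (hm.mul hf)]
  refine lintegral_congr fun η => ?_
  have hfη : Measurable fun σ => f (σ, η) := hf.comp (measurable_id.prodMk measurable_const)
  rw [site, lintegral_withDensity_eq_lintegral_mul _ (hq.measurable_left η).ennreal_ofReal hfη]
  rfl

theorem couplingMeasure_preimage_snd (hq : IsFellerDensity α q) (lam : Measure S')
    [IsProbabilityMeasure lam] : (couplingMeasure α q lam).map Prod.snd = lam := by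
  ext s hs
  rw [Measure.map_apply measurable_snd hs, ← lintegral_indicator_one (measurable_snd hs),
    hq.lintegral_coupling lam (measurable_one.indicator (measurable_snd hs))]
  have : ∀ η, ∫⁻ σ, (Prod.snd ⁻¹' s : Set (S × S')).indicator 1 (σ, η) ∂(site α q η) =
      s.indicator 1 η := by
    intro η
    have := hq.isProbabilityMeasure_site η
    by_cases h : η ∈ s <;> simp [Set.indicator, h]
  simp_rw [this]
  exact lintegral_indicator_one hs

theorem isProbabilityMeasure_couplingMeasure (hq : IsFellerDensity α q) (lam : Measure S')
    [IsProbabilityMeasure lam] : IsProbabilityMeasure (couplingMeasure α q lam) := by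
  constructor
  have h := congrArg (fun μ : Measure S' => μ Set.univ) (hq.couplingMeasure_preimage_snd lam)
  simpa [Measure.map_apply measurable_snd MeasurableSet.univ] using h

/-- The coupling as a probability measure. -/
def coupling (hq : IsFellerDensity α q) (lam : ProbabilityMeasure S') :
    ProbabilityMeasure (S × S') :=
  ⟨couplingMeasure α q lam, hq.isProbabilityMeasure_couplingMeasure lam⟩

theorem coupling_mem_constrained (hq : IsFellerDensity α q) (lam : ProbabilityMeasure S') :
    hq.coupling lam ∈ constrained lam := hq.couplingMeasure_preimage_snd lam

theorem integral_coupling (hq : IsFellerDensity α q) (lam : ProbabilityMeasure S')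
    (f : C(S × S', ℝ)) :
    ∫ ξ, f ξ ∂(hq.coupling lam : Measure (S × S')) =
      ∫ η, ∫ σ, f (σ, η) ∂(site α q η) ∂(lam : Measure S') := by
  obtain ⟨C, hC, hqC⟩ := hq.exists_bound
  have hm : Measurable fun ξ : S × S' => ENNReal.ofReal (q ξ.1 ξ.2) :=
    hq.measurable.ennreal_ofReal
  change ∫ ξ, f ξ ∂(couplingMeasure α q lam) = _
  rw [couplingMeasure, integral_withDensity_eq_integral_toReal_smul hm
    (ae_of_all _ fun _ => ENNReal.ofReal_lt_top)]
  simp_rw [hq.integral_site]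
  rw [integral_prod_symm]
  · refine integral_congr_ae (ae_of_all _ fun η => integral_congr_ae (ae_of_all _ fun σ => ?_))
    simp only [smul_eq_mul]
    rw [ENNReal.toReal_ofReal (hq.pos σ η).le, mul_comm]
  · refine (integrable_of_continuous f.continuous _).bdd_mul (c := C)
      hm.ennreal_toReal.aestronglyMeasurable (ae_of_all _ fun ξ => ?_)
    rw [Real.norm_eq_abs, ENNReal.toReal_ofReal (hq.pos _ _).le, abs_of_pos (hq.pos _ _)]
    exact hqC _ _

theorem continuous_coupling (hq : IsFellerDensity α q) : Continuous hq.coupling := by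
  refine (ProbabilityMeasure.toFiniteMeasure_isEmbedding _).continuous_iff.2 ?_
  refine FiniteMeasure.continuous_iff_forall_continuousMap_continuous_integral.2 fun f => ?_
  have h := (FiniteMeasure.continuous_integral_continuousMap
    (⟨_, hq.continuous_integral f⟩ : C(S', ℝ))).comp
      (ProbabilityMeasure.toFiniteMeasure_continuous (Ω := S'))
  refine h.congr fun lam => ?_
  exact (hq.integral_coupling lam f).symm

/-- The logarithmic moment generating function of `f(·, η)` under the kernel. -/
def _root_.MeanField.logMoment (α : Measure S) (q : S → S' → ℝ) (f : C(S × S', ℝ)) (η : S') : ℝ :=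
  Real.log (∫ σ, Real.exp (f (σ, η)) ∂(site α q η))

theorem integral_exp_pos' (hq : IsFellerDensity α q) (f : C(S × S', ℝ)) (η : S') :
    0 < ∫ σ, Real.exp (f (σ, η)) ∂(site α q η) := by
  have := hq.isProbabilityMeasure_site η
  have hc : Continuous fun σ => Real.exp (f (σ, η)) := by fun_prop
  exact integral_exp_pos (integrable_of_continuous hc _)

theorem continuous_logMoment (hq : IsFellerDensity α q) (f : C(S × S', ℝ)) :
    Continuous (logMoment α q f) :=
  (hq.continuous_integral ⟨fun ξ => Real.exp (f ξ), by fun_prop⟩).log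
    fun η => (hq.integral_exp_pos' f η).ne'

/-- Jensen's inequality for the logarithm. -/
theorem integral_logMoment_le (hq : IsFellerDensity α q) (f : C(S × S', ℝ))
    (lam : ProbabilityMeasure S') :
    ∫ η, logMoment α q f η ∂(lam : Measure S') ≤
      Real.log (∫ ξ, Real.exp (f ξ) ∂(hq.coupling lam : Measure (S × S'))) := by
  have hZ := hq.continuous_integral ⟨fun ξ => Real.exp (f ξ), by fun_prop⟩
  have h1 := hq.integral_coupling lam ⟨fun ξ => Real.exp (f ξ), by fun_prop⟩
  simp only [ContinuousMap.coe_mk] at h1 hZ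
  set Z : S' → ℝ := fun η => ∫ σ, Real.exp (f (σ, η)) ∂(site α q η) with hZdef
  rw [h1]
  have hc : 0 < ∫ η, Z η ∂(lam : Measure S') := by
    rw [← h1]
    have hfc : Continuous fun ξ => Real.exp (f ξ) := by fun_prop
    exact integral_exp_pos (integrable_of_continuous hfc _)
  set c := ∫ η, Z η ∂(lam : Measure S')
  have hZi : Integrable Z (lam : Measure S') := integrable_of_continuous hZ _
  calc ∫ η, logMoment α q f η ∂(lam : Measure S')
      ≤ ∫ η, (Z η / c + (Real.log c - 1)) ∂(lam : Measure S') := by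
        refine integral_mono (integrable_of_continuous (hq.continuous_logMoment f) _)
          ((hZi.div_const _).add (integrable_const _)) fun η => ?_
        have h2 := Real.log_le_sub_one_of_pos (div_pos (hq.integral_exp_pos' f η) hc)
        rw [Real.log_div (hq.integral_exp_pos' f η).ne' hc.ne'] at h2
        simp only [logMoment, hZdef]
        linarith
    _ = Real.log c := by
        rw [integral_add (hZi.div_const _) (integrable_const _), integral_div, div_self hc.ne']
        simp

end IsFellerDensity

end Feller

/-! ### Large deviations of the joint empirical measure -/

section LargeDeviations

open InformationTheory

variable {S S' : Type*}
    [MetricSpace S] [CompactSpace S] [MeasurableSpace S] [BorelSpace S]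
    [MetricSpace S'] [CompactSpace S'] [MeasurableSpace S'] [BorelSpace S']

/-- The joint empirical measure `N⁻¹ ∑_{n ≤ j < N} δ_{(τⱼ, ηⱼ)}` with `N = n + m`, where the sites
`n, …, N - 1` of the first layer are indexed by `Fin m`. -/
def pairEmpirical (n m : ℕ) (η : ℕ → S') (τ : Fin m → S) : FiniteMeasure (S × S') :=
  ((n + m : ℕ) : ℝ≥0)⁻¹ • ∑ j : Fin m, pointMass (τ j, η (n + j))

/-- The law under which the spins `τⱼ`, `n ≤ j < n + m`, are independent with laws
`q(·, ηⱼ) α`. -/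
def blockLaw (α : Measure S) (q : S → S' → ℝ) (n m : ℕ) (η : ℕ → S') : Measure (Fin m → S) :=
  Measure.pi fun j : Fin m => site α q (η (n + j))

theorem continuous_pairEmpirical (n m : ℕ) (η : ℕ → S') :
    Continuous (pairEmpirical n m η : (Fin m → S) → FiniteMeasure (S × S')) := by
  refine FiniteMeasure.continuous_iff_forall_continuousMap_continuous_integral.2 fun f => ?_
  simp_rw [pairEmpirical, integral_smul_sum_pointMass]
  fun_prop

theorem mass_pairEmpirical_le (n m : ℕ) (η : ℕ → S') (τ : Fin m → S) :
    (pairEmpirical n m η τ).mass ≤ 1 := by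
  rw [pairEmpirical, mass_smul_sum_pointMass, Finset.card_univ, Fintype.card_fin]
  have h : (m : ℝ≥0) ≤ ((n + m : ℕ) : ℝ≥0) := by exact_mod_cast Nat.le_add_left m n
  calc ((n + m : ℕ) : ℝ≥0)⁻¹ * m ≤ ((n + m : ℕ) : ℝ≥0)⁻¹ * ((n + m : ℕ) : ℝ≥0) := by gcongr
    _ ≤ 1 := inv_mul_le_one

theorem map_smul_sum_pointMass {X Y ι : Type*} [MeasurableSpace X] [MeasurableSpace Y]
    (c : ℝ≥0) (s : Finset ι) (x : ι → X) {f : X → Y} (hf : Measurable f) :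
    (c • ∑ j ∈ s, pointMass (x j)).map f = c • ∑ j ∈ s, pointMass (f (x j)) := by
  rw [FiniteMeasure.map_smul]
  have h := map_sum (FiniteMeasure.mapHom hf) (fun j => pointMass (x j)) s
  change (∑ j ∈ s, pointMass (x j)).map f = _ at h
  rw [h]
  congr 1
  refine Finset.sum_congr rfl fun j _ => ?_
  apply FiniteMeasure.toMeasure_injective
  exact Measure.map_dirac' hf _

theorem sum_block {M : Type*} [AddCommMonoid M] (n m : ℕ) (F : ℕ → M) :
    ∑ j : Fin m, F (n + j) = ∑ j ∈ Finset.Ico n (n + m), F j := by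
  rw [Finset.sum_Ico_eq_sum_range, Nat.add_sub_cancel_left,
    Fin.sum_univ_eq_sum_range (fun j => F (n + j))]

theorem map_snd_pairEmpirical (n m : ℕ) (η : ℕ → S') (τ : Fin m → S) :
    (pairEmpirical n m η τ).map Prod.snd =
      ((n + m : ℕ) : ℝ≥0)⁻¹ • ∑ j ∈ Finset.Ico n (n + m), pointMass (η j) := by
  rw [pairEmpirical, map_smul_sum_pointMass _ _ _ measurable_snd,
    sum_block n m fun j => pointMass (η j)]

theorem tendsto_average_block {n : ℕ} {η : ℕ → S'} {ν' : ProbabilityMeasure S'}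
    (hη : Tendsto (fun N : ℕ => (N : ℝ≥0)⁻¹ • ∑ j ∈ Finset.Ico n N, pointMass (η j)) atTop
      (𝓝 ν'.toFiniteMeasure)) :
    Tendsto (fun m : ℕ => ((n + m : ℕ) : ℝ≥0)⁻¹ • ∑ j ∈ Finset.Ico n (n + m), pointMass (η j))
      atTop (𝓝 ν'.toFiniteMeasure) :=
  hη.comp (tendsto_atTop_mono (fun m => Nat.le_add_left m n) tendsto_id)

theorem tendsto_average_integral_block {n : ℕ} {η : ℕ → S'} {ν' : ProbabilityMeasure S'}
    (hη : Tendsto (fun N : ℕ => (N : ℝ≥0)⁻¹ • ∑ j ∈ Finset.Ico n N, pointMass (η j)) atTop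
      (𝓝 ν'.toFiniteMeasure)) {F : S' → ℝ} (hF : Continuous F) :
    Tendsto (fun m : ℕ => ((n + m : ℕ) : ℝ)⁻¹ * ∑ j : Fin m, F (η (n + j))) atTop
      (𝓝 (∫ y, F y ∂(ν' : Measure S'))) := by
  have h := ((FiniteMeasure.continuous_integral_continuousMap (⟨F, hF⟩ : C(S', ℝ))).tendsto
    _).comp (tendsto_average_block hη)
  refine h.congr fun m => ?_
  simp only [Function.comp]
  rw [integral_smul_sum_pointMass, ← sum_block n m fun j => (⟨F, hF⟩ : C(S', ℝ)) (η j)]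
  simp

variable {α : Measure S} [IsProbabilityMeasure α] {q : S → S' → ℝ}

theorem isProbabilityMeasure_blockLaw (hq : IsFellerDensity α q) (n m : ℕ) (η : ℕ → S') :
    IsProbabilityMeasure (blockLaw α q n m η) := by
  have := hq.isProbabilityMeasure_site
  unfold blockLaw
  infer_instance

theorem integral_pairEmpirical (n : ℕ) {m : ℕ} (hm : 0 < m) (η : ℕ → S') (τ : Fin m → S)
    (f : S × S' → ℝ) :
    ((n + m : ℕ) : ℝ) * ∫ ξ, f ξ ∂(pairEmpirical n m η τ : Measure (S × S')) =
      ∑ j : Fin m, f (τ j, η (n + j)) := by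
  rw [pairEmpirical, integral_smul_sum_pointMass]
  have : ((n + m : ℕ) : ℝ) ≠ 0 := by positivity
  rw [NNReal.coe_inv, NNReal.coe_natCast, mul_inv_cancel_left₀ this]

/-- The exponential moments of `N ∫ f dL` are products of one-site moments. -/
theorem lintegral_exp_blockLaw (hq : IsFellerDensity α q) (n m : ℕ) (η : ℕ → S')
    (f : C(S × S', ℝ)) :
    ∫⁻ τ, ENNReal.ofReal (Real.exp (∑ j : Fin m, f (τ j, η (n + j)))) ∂(blockLaw α q n m η) =
      ENNReal.ofReal (Real.exp (∑ j : Fin m, logMoment α q f (η (n + j)))) := by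
  have hp := hq.isProbabilityMeasure_site
  simp_rw [Real.exp_sum, ENNReal.ofReal_prod_of_nonneg fun _ _ => (Real.exp_pos _).le]
  have hc : ∀ y, Continuous fun σ => Real.exp (f (σ, y)) := fun y => by fun_prop
  rw [blockLaw, lintegral_pi_prod (fun j : Fin m => site α q (η (n + j)))
    (f := fun j σ => ENNReal.ofReal (Real.exp (f (σ, η (n + j)))))
    fun j => (hc _).measurable.ennreal_ofReal]
  refine Finset.prod_congr rfl fun j _ => ?_
  rw [← ofReal_integral_eq_lintegral_ofReal (integrable_of_continuous (hc _) _)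
    (ae_of_all _ fun _ => (Real.exp_pos _).le), logMoment,
    Real.exp_log (hq.integral_exp_pos' f _)]

/-- The unnormalized weight `E[e^{-N Ψ(L)}; L ∈ s]` of a set `s` of joint empirical measures. -/
def blockWeight (α : Measure S) (q : S → S' → ℝ) (Ψ : FiniteMeasure (S × S') → ℝ) (n m : ℕ)
    (η : ℕ → S') (s : Set (FiniteMeasure (S × S'))) : ℝ≥0∞ :=
  ∫⁻ τ in {τ | pairEmpirical n m η τ ∈ s},
    ENNReal.ofReal (Real.exp (-(((n + m : ℕ) : ℝ) * Ψ (pairEmpirical n m η τ))))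
    ∂(blockLaw α q n m η)

theorem coe_lt_coe_add_coe_iff {c b : ℝ} {y : ℝ≥0∞} :
    (c : EReal) < (y : EReal) + (b : EReal) ↔ ((c - b : ℝ) : EReal) < (y : EReal) := by
  induction y using ENNReal.recTopCoe with
  | top => simp [-EReal.coe_sub]
  | coe y =>
    change (c : EReal) < ((y : ℝ) : EReal) + (b : EReal) ↔ ((c - b : ℝ) : EReal) < ((y : ℝ) : EReal)
    rw [← EReal.coe_add, EReal.coe_lt_coe_iff, EReal.coe_lt_coe_iff, sub_lt_iff_lt_add]

/-- The local large deviation upper bound, by exponential Chebyshev: on the neighbourhood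
`{∫ f dL + Ψ(L) > a}` of `ρ` the weight `e^{-N Ψ(L)}` is at most `e^{-N a} e^{N ∫ f dL}`, and the
mean of `e^{N ∫ f dL}` grows at a rate not above `log ∫ e^f`, the integral taken with respect to the
coupling. The Donsker–Varadhan formula provides `f`. -/
theorem tendsto_mul_blockWeight_local (hq : IsFellerDensity α q) {n : ℕ} {η : ℕ → S'}
    {ν' : ProbabilityMeasure S'}
    (hη : Tendsto (fun N : ℕ => (N : ℝ≥0)⁻¹ • ∑ j ∈ Finset.Ico n N, pointMass (η j)) atTop
      (𝓝 ν'.toFiniteMeasure))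
    {Ψ : FiniteMeasure (S × S') → ℝ} (hΨ : Continuous Ψ) {c : ℝ} {ρ : ProbabilityMeasure (S × S')}
    (h : (c : EReal) < (klDiv (ρ : Measure (S × S')) (hq.coupling ν') : ℝ≥0∞)
      + (Ψ ρ.toFiniteMeasure : ℝ)) :
    ∃ U ∈ 𝓝 ρ.toFiniteMeasure, ∃ c' > c, Tendsto (fun m : ℕ =>
      ENNReal.ofReal (Real.exp (((n + m : ℕ) : ℝ) * c')) * blockWeight α q Ψ n m η U)
      atTop (𝓝 0) := by
  obtain ⟨f, hf⟩ := exists_continuous_lt_integral_sub_log _ _ (coe_lt_coe_add_coe_iff.1 h)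
  have hJ := hq.integral_logMoment_le f ν'
  set L := ∫ y, logMoment α q f y ∂(ν' : Measure S')
  obtain ⟨a, ha1, ha2⟩ : ∃ a, c + L < a ∧
      a < ∫ ξ, f ξ ∂(ρ : Measure (S × S')) + Ψ ρ.toFiniteMeasure :=
    exists_between (by linarith)
  have hcont : Continuous fun μ : FiniteMeasure (S × S') =>
      ∫ ξ, f ξ ∂(μ : Measure (S × S')) + Ψ μ :=
    (FiniteMeasure.continuous_integral_continuousMap f).add hΨ
  refine ⟨{μ | a < ∫ ξ, f ξ ∂(μ : Measure (S × S')) + Ψ μ},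
    (isOpen_lt continuous_const hcont).mem_nhds ha2, (c + (a - L)) / 2, by linarith, ?_⟩
  set c' := (c + (a - L)) / 2 with hc'
  have hbound : ∀ᶠ m : ℕ in atTop, ENNReal.ofReal (Real.exp (((n + m : ℕ) : ℝ) * c')) *
      blockWeight α q Ψ n m η {μ | a < ∫ ξ, f ξ ∂(μ : Measure (S × S')) + Ψ μ} ≤
      ENNReal.ofReal (Real.exp (((n + m : ℕ) : ℝ) *
        (c' - a + ((n + m : ℕ) : ℝ)⁻¹ * ∑ j : Fin m, logMoment α q f (η (n + j))))) := by
    filter_upwards [eventually_gt_atTop 0] with m hm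
    have hN : (0 : ℝ) < ((n + m : ℕ) : ℝ) := by positivity
    have h1 : blockWeight α q Ψ n m η {μ | a < ∫ ξ, f ξ ∂(μ : Measure (S × S')) + Ψ μ} ≤
        ENNReal.ofReal (Real.exp (-(((n + m : ℕ) : ℝ) * a))) *
          ENNReal.ofReal (Real.exp (∑ j : Fin m, logMoment α q f (η (n + j)))) := by
      have hcm : Continuous fun τ : Fin m → S => Real.exp (∑ j : Fin m, f (τ j, η (n + j))) := by
        fun_prop
      rw [← lintegral_exp_blockLaw hq, ← lintegral_const_mul _ hcm.measurable.ennreal_ofReal]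
      refine (setLIntegral_mono (hcm.measurable.ennreal_ofReal.const_mul _)
        fun τ hτ => ?_).trans (setLIntegral_le_lintegral _ _)
      rw [← ENNReal.ofReal_mul (Real.exp_pos _).le, ← Real.exp_add,
        ← integral_pairEmpirical n hm η τ f]
      refine ENNReal.ofReal_le_ofReal (Real.exp_le_exp.2 ?_)
      have hτ' : a < ∫ ξ, f ξ ∂(pairEmpirical n m η τ : Measure (S × S')) +
        Ψ (pairEmpirical n m η τ) := hτ
      nlinarith
    refine (mul_le_mul_right h1 _).trans (le_of_eq ?_)
    rw [← ENNReal.ofReal_mul (Real.exp_pos _).le, ← Real.exp_add,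
      ← ENNReal.ofReal_mul (Real.exp_pos _).le, ← Real.exp_add]
    congr 2
    field_simp
    ring
  refine tendsto_of_tendsto_of_tendsto_of_le_of_le' tendsto_const_nhds ?_
    (Eventually.of_forall fun _ => zero_le) hbound
  rw [← ENNReal.ofReal_zero]
  refine ENNReal.tendsto_ofReal (Real.tendsto_exp_atBot.comp ?_)
  have h2 := (tendsto_average_integral_block hη (hq.continuous_logMoment f)).const_add (c' - a)
  have h3 : Tendsto (fun m : ℕ => ((n + m : ℕ) : ℝ)) atTop atTop :=
    tendsto_natCast_atTop_atTop.comp (tendsto_atTop_mono (fun m => Nat.le_add_left m n) tendsto_id)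
  exact h3.atTop_mul_neg (by simp only [hc']; linarith) h2

/-- The large deviation upper bound for the complement of an open set: if
`S(ρ | p) + Ψ(ρ) > c` for all `ρ ∈ M_{ν'}` outside `O`, where `p` is the coupling of `ν'`, then the
weight of the complement of `O` is exponentially small compared with `e^{-cN}`. Finitely many of the
neighbourhoods of the local bound cover, because the measures of mass at most one are compact. -/
theorem exists_tendsto_mul_blockWeight (hq : IsFellerDensity α q) {n : ℕ} {η : ℕ → S'}
    {ν' : ProbabilityMeasure S'}
    (hη : Tendsto (fun N : ℕ => (N : ℝ≥0)⁻¹ • ∑ j ∈ Finset.Ico n N, pointMass (η j)) atTop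
      (𝓝 ν'.toFiniteMeasure))
    {Ψ : FiniteMeasure (S × S') → ℝ} (hΨ : Continuous Ψ) {c : ℝ}
    {O : Set (FiniteMeasure (S × S'))} (hO : IsOpen O)
    (h : ∀ ρ ∈ constrained (S := S) ν', ρ.toFiniteMeasure ∉ O →
      (c : EReal) < (klDiv (ρ : Measure (S × S')) (hq.coupling ν') : ℝ≥0∞)
        + (Ψ ρ.toFiniteMeasure : ℝ)) :
    ∃ c' > c, Tendsto (fun m : ℕ =>
      ENNReal.ofReal (Real.exp (((n + m : ℕ) : ℝ) * c')) * blockWeight α q Ψ n m η Oᶜ)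
      atTop (𝓝 0) := by
  let K : Set (FiniteMeasure (S × S')) := {μ | μ.mass ≤ 1}
  have hK : IsCompact (K \ O) :=
    (isCompact_setOfPred_finiteMeasure_le_of_compactSpace (S × S') 1).diff hO
  have hKO : ∀ m, blockWeight α q Ψ n m η Oᶜ = blockWeight α q Ψ n m η (K \ O) := by
    intro m
    have : {τ : Fin m → S | pairEmpirical n m η τ ∈ Oᶜ} =
        {τ | pairEmpirical n m η τ ∈ K \ O} := by
      ext τ
      simp [K, mass_pairEmpirical_le]
    rw [blockWeight, blockWeight, this]
  simp_rw [hKO]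
  refine hK.induction_on (p := fun s => ∃ c' > c, Tendsto (fun m : ℕ =>
      ENNReal.ofReal (Real.exp (((n + m : ℕ) : ℝ) * c')) * blockWeight α q Ψ n m η s)
      atTop (𝓝 0)) ?_ ?_ ?_ ?_
  · exact ⟨c + 1, by linarith, by simp [blockWeight]⟩
  · rintro s t hst ⟨c', hc', ht⟩
    refine ⟨c', hc', tendsto_of_tendsto_of_tendsto_of_le_of_le tendsto_const_nhds ht
      (fun _ => zero_le) fun m => ?_⟩
    have h4 : blockWeight α q Ψ n m η s ≤ blockWeight α q Ψ n m η t :=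
      lintegral_mono_set fun τ hτ => hst hτ
    exact mul_le_mul_right h4 _
  · rintro s t ⟨c₁, hc₁, h₁⟩ ⟨c₂, hc₂, h₂⟩
    refine ⟨min c₁ c₂, lt_min hc₁ hc₂, ?_⟩
    have h3 := h₁.add h₂
    rw [add_zero] at h3
    refine tendsto_of_tendsto_of_tendsto_of_le_of_le tendsto_const_nhds h3
      (fun _ => zero_le) fun m => ?_
    have h4 : blockWeight α q Ψ n m η (s ∪ t) ≤
        blockWeight α q Ψ n m η s + blockWeight α q Ψ n m η t :=
      lintegral_union_le _ _ _
    refine (mul_le_mul_right h4 _).trans ?_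
    rw [mul_add]
    have hN : (0 : ℝ) ≤ ((n + m : ℕ) : ℝ) := Nat.cast_nonneg _
    gcongr
    · exact min_le_left _ _
    · exact min_le_right _ _
  · rintro μ ⟨hμK, hμO⟩
    by_cases hμ : μ.map Prod.snd = ν'.toFiniteMeasure
    · have hprob : IsProbabilityMeasure (μ : Measure (S × S')) := by
        constructor
        have h1 := congrArg (fun κ : FiniteMeasure S' => (κ : Measure S') Set.univ) hμ
        simpa [Measure.map_apply measurable_snd MeasurableSet.univ] using h1
      obtain ⟨U, hU, hU'⟩ := tendsto_mul_blockWeight_local hq hη hΨ (c := c)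
        (ρ := ⟨μ, hprob⟩) (h ⟨μ, hprob⟩
          (congrArg (fun κ : FiniteMeasure S' => (κ : Measure S')) hμ) hμO)
      exact ⟨U, mem_nhdsWithin_of_mem_nhds hU, hU'⟩
    · -- the second marginals of the empirical measures converge to `ν'`
      obtain ⟨V, W, hV, hW, hμV, hνW, hVW⟩ := t2_separation hμ
      refine ⟨(fun κ : FiniteMeasure (S × S') => κ.map Prod.snd) ⁻¹' V,
        mem_nhdsWithin_of_mem_nhds (((FiniteMeasure.continuous_map continuous_snd).tendsto μ)
          (hV.mem_nhds hμV)), c + 1, by linarith, ?_⟩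
      refine tendsto_const_nhds.congr' ?_
      filter_upwards [(tendsto_average_block hη).eventually (hW.mem_nhds hνW)] with m hm
      have : {τ : Fin m → S | pairEmpirical n m η τ ∈
          (fun κ : FiniteMeasure (S × S') => κ.map Prod.snd) ⁻¹' V} = ∅ := by
        ext τ
        simp only [Set.mem_preimage, Set.mem_ofPred_eq, Set.mem_empty_iff_false, iff_false]
        rw [map_snd_pairEmpirical]
        exact fun hτ => Set.disjoint_left.1 hVW hτ hm
      rw [blockWeight, this]
      simp

theorem continuous_exp_neg_mul {Ψ : FiniteMeasure (S × S') → ℝ} (hΨ : Continuous Ψ) (n m : ℕ)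
    (η : ℕ → S') : Continuous fun τ : Fin m → S =>
      Real.exp (-(((n + m : ℕ) : ℝ) * Ψ (pairEmpirical n m η τ))) :=
  Real.continuous_exp.comp
    (continuous_const.mul (hΨ.comp (continuous_pairEmpirical n m η))).neg

theorem blockWeight_univ_ne_top (hq : IsFellerDensity α q)
    {Ψ : FiniteMeasure (S × S') → ℝ} (hΨ : Continuous Ψ) (n m : ℕ) (η : ℕ → S') :
    blockWeight α q Ψ n m η Set.univ ≠ ∞ := by
  have := isProbabilityMeasure_blockLaw hq n m η
  have hc := continuous_exp_neg_mul hΨ n m η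
  have h := (integrable_of_continuous hc (blockLaw α q n m η)).lintegral_lt_top
  simp only [blockWeight, Set.mem_univ, Set.ofPred_true, Measure.restrict_univ]
  exact h.ne

theorem blockWeight_univ_ne_zero (hq : IsFellerDensity α q)
    {Ψ : FiniteMeasure (S × S') → ℝ} (hΨ : Continuous Ψ) (n m : ℕ) (η : ℕ → S') :
    blockWeight α q Ψ n m η Set.univ ≠ 0 := by
  have := isProbabilityMeasure_blockLaw hq n m η
  have hc := continuous_exp_neg_mul hΨ n m η
  simp only [blockWeight, Set.mem_univ, Set.ofPred_true, Measure.restrict_univ]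
  rw [Ne, lintegral_eq_zero_iff hc.measurable.ennreal_ofReal]
  intro h0
  obtain ⟨τ, hτ⟩ := h0.exists
  simp only [Pi.zero_apply, ENNReal.ofReal_eq_zero] at hτ
  exact absurd hτ (not_le.2 (Real.exp_pos _))

/-- The law of large numbers: under the block law the joint empirical measure converges to
the coupling of `ν'`, the only zero of the rate for `Ψ = 0`. -/
theorem tendsto_blockLaw_compl (hq : IsFellerDensity α q) {n : ℕ} {η : ℕ → S'}
    {ν' : ProbabilityMeasure S'}
    (hη : Tendsto (fun N : ℕ => (N : ℝ≥0)⁻¹ • ∑ j ∈ Finset.Ico n N, pointMass (η j)) atTop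
      (𝓝 ν'.toFiniteMeasure))
    {O : Set (FiniteMeasure (S × S'))} (hO : IsOpen O)
    (hmem : (hq.coupling ν').toFiniteMeasure ∈ O) :
    Tendsto (fun m => blockLaw α q n m η {τ | pairEmpirical n m η τ ∈ Oᶜ}) atTop (𝓝 0) := by
  obtain ⟨c', hc', h⟩ := exists_tendsto_mul_blockWeight hq hη (Ψ := fun _ => 0) continuous_const
    (c := 0) hO (fun ρ _ hρO => by
      have hne : klDiv (ρ : Measure (S × S')) (hq.coupling ν') ≠ 0 := by
        rw [Ne, klDiv_eq_zero_iff]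
        intro he
        have : ρ = hq.coupling ν' := Subtype.ext he
        exact hρO (this ▸ hmem)
      have : (0 : EReal) < (klDiv (ρ : Measure (S × S')) (hq.coupling ν') : ℝ≥0∞) :=
        EReal.coe_ennreal_pos.2 (pos_iff_ne_zero.2 hne)
      simpa using this)
  refine tendsto_of_tendsto_of_tendsto_of_le_of_le tendsto_const_nhds h
      (fun _ => zero_le) fun m => ?_
  have h1 : blockWeight α q (fun _ => 0) n m η Oᶜ =
      blockLaw α q n m η {τ | pairEmpirical n m η τ ∈ Oᶜ} := by
    simp [blockWeight]
  have h2 : 1 ≤ ENNReal.ofReal (Real.exp (((n + m : ℕ) : ℝ) * c')) := by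
    rw [ENNReal.one_le_ofReal]
    exact Real.one_le_exp (mul_nonneg (Nat.cast_nonneg _) (le_of_lt hc'))
  simp only
  rw [h1]
  exact le_mul_of_one_le_left' h2

/-- Concentration: if the coupling `p` of `ν'` is the strict minimizer of `S(· | p) + Ψ` on
`M_{ν'}`, then the joint empirical measure converges to it under the laws weighted by `e^{-N Ψ}`. -/
theorem tendsto_blockWeight_div (hq : IsFellerDensity α q) {n : ℕ} {η : ℕ → S'}
    {ν' : ProbabilityMeasure S'}
    (hη : Tendsto (fun N : ℕ => (N : ℝ≥0)⁻¹ • ∑ j ∈ Finset.Ico n N, pointMass (η j)) atTop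
      (𝓝 ν'.toFiniteMeasure))
    {Ψ : FiniteMeasure (S × S') → ℝ} (hΨ : Continuous Ψ)
    (h : ∀ ρ ∈ constrained (S := S) ν', ρ ≠ hq.coupling ν' →
      (Ψ (hq.coupling ν').toFiniteMeasure : EReal) <
        (klDiv (ρ : Measure (S × S')) (hq.coupling ν') : ℝ≥0∞) + (Ψ ρ.toFiniteMeasure : ℝ))
    {O : Set (FiniteMeasure (S × S'))} (hO : IsOpen O)
    (hmem : (hq.coupling ν').toFiniteMeasure ∈ O) :
    Tendsto (fun m => blockWeight α q Ψ n m η Oᶜ / blockWeight α q Ψ n m η Set.univ)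
      atTop (𝓝 0) := by
  set c := Ψ (hq.coupling ν').toFiniteMeasure with hc
  obtain ⟨c', hc', h1⟩ := exists_tendsto_mul_blockWeight hq hη hΨ (c := c) hO
    (fun ρ hρ hρO => h ρ hρ fun he => hρO (he ▸ hmem))
  -- the total weight is at least `e^{-N c'} / 2`, by the law of large numbers on `{Ψ < d}`
  set d := (c + c') / 2 with hd
  let O' : Set (FiniteMeasure (S × S')) := {μ | Ψ μ < d}
  have hO' : IsOpen O' := isOpen_lt hΨ continuous_const
  have hmem' : (hq.coupling ν').toFiniteMeasure ∈ O' := by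
    change c < d
    linarith
  have hlln := tendsto_blockLaw_compl hq hη hO' hmem'
  have hhalf : ∀ᶠ m in atTop, 1 / 2 ≤ blockLaw α q n m η {τ | pairEmpirical n m η τ ∈ O'} := by
    have := hlln.eventually (gt_mem_nhds (show (0 : ℝ≥0∞) < 1 / 2 by simp))
    filter_upwards [this] with m hm
    have hp := isProbabilityMeasure_blockLaw hq n m η
    have hcompl : {τ : Fin m → S | pairEmpirical n m η τ ∈ O'ᶜ} =
      {τ | pairEmpirical n m η τ ∈ O'}ᶜ := rfl
    have hmeas : MeasurableSet {τ : Fin m → S | pairEmpirical n m η τ ∈ O'} :=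
      (hO'.preimage (continuous_pairEmpirical n m η)).measurableSet
    rw [hcompl, prob_compl_eq_one_sub hmeas] at hm
    by_contra! hlt
    have h3 : (1 : ℝ≥0∞) - 1 / 2 ≤
        1 - blockLaw α q n m η {τ | pairEmpirical n m η τ ∈ O'} := tsub_le_tsub_left hlt.le _
    rw [one_div, ENNReal.one_sub_inv_two] at h3
    rw [one_div] at hm
    exact absurd hm (not_lt.2 h3)
  have hlower : ∀ᶠ m in atTop, ENNReal.ofReal (Real.exp (-(((n + m : ℕ) : ℝ) * c'))) * (1 / 2) ≤
      blockWeight α q Ψ n m η Set.univ := by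
    filter_upwards [hhalf] with m hm
    calc _ ≤ ENNReal.ofReal (Real.exp (-(((n + m : ℕ) : ℝ) * d))) *
            blockLaw α q n m η {τ | pairEmpirical n m η τ ∈ O'} := by
          have hN : (0 : ℝ) ≤ ((n + m : ℕ) : ℝ) := Nat.cast_nonneg _
          gcongr
          linarith
      _ = ∫⁻ τ in {τ | pairEmpirical n m η τ ∈ O'},
            ENNReal.ofReal (Real.exp (-(((n + m : ℕ) : ℝ) * d))) ∂(blockLaw α q n m η) := by
          simp
      _ ≤ blockWeight α q Ψ n m η O' := by
          refine setLIntegral_mono' (hO'.preimage (continuous_pairEmpirical n m η)).measurableSet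
            fun τ hτ => ENNReal.ofReal_le_ofReal (Real.exp_le_exp.2 (neg_le_neg ?_))
          exact mul_le_mul_of_nonneg_left (le_of_lt hτ) (Nat.cast_nonneg _)
      _ ≤ _ := lintegral_mono_set fun τ _ => Set.mem_univ _
  have h2 := ENNReal.Tendsto.const_mul (a := 2) h1 (Or.inr (by simp))
  rw [mul_zero] at h2
  refine tendsto_of_tendsto_of_tendsto_of_le_of_le' tendsto_const_nhds h2
    (Eventually.of_forall fun _ => zero_le) ?_
  filter_upwards [hlower] with m hm
  refine ENNReal.div_le_of_le_mul ?_
  set E := ENNReal.ofReal (Real.exp (((n + m : ℕ) : ℝ) * c')) with hE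
  set E' := ENNReal.ofReal (Real.exp (-(((n + m : ℕ) : ℝ) * c'))) with hE'
  have hEE : E * E' = 1 := by
    rw [hE, hE', ← ENNReal.ofReal_mul (Real.exp_pos _).le, ← Real.exp_add]
    simp
  calc blockWeight α q Ψ n m η Oᶜ
      = 2 * (E * blockWeight α q Ψ n m η Oᶜ) * (E' * (1 / 2)) := by
        have : (2 : ℝ≥0∞) * (1 / 2) = 1 := by
          rw [one_div]; exact ENNReal.mul_inv_cancel (by simp) (by simp)
        calc _ = (2 * (1 / 2)) * (E * E') * blockWeight α q Ψ n m η Oᶜ := by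
              rw [this, hEE, one_mul, one_mul]
          _ = _ := by ring
    _ ≤ _ := mul_le_mul_right hm _

end LargeDeviations

/-! ### The Euler–Lagrange equation -/

section Variational

open InformationTheory

theorem klDiv_coe_eq_of_ac {Y : Type*} [MeasurableSpace Y] (ρ ν : Measure Y)
    [IsProbabilityMeasure ρ] [IsProbabilityMeasure ν] (hac : ρ ≪ ν)
    (hint : Integrable (llr ρ ν) ρ) :
    ((klDiv ρ ν : ℝ≥0∞) : EReal) = ((∫ x, llr ρ ν x ∂ρ : ℝ) : EReal) := by
  rw [← toReal_klDiv_of_measure_eq hac (by simp), EReal.coe_ennreal_toReal]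
  exact klDiv_ne_top hac hint

/-- The effect on relative entropy of a change of reference measure with bounded log-density. -/
theorem klDiv_eq_klDiv_tilted_add {Y : Type*} [MeasurableSpace Y] (ρ ν : Measure Y)
    [IsProbabilityMeasure ρ] [IsProbabilityMeasure ν] {w : Y → ℝ} (hw : Measurable w) {C : ℝ}
    (hC : ∀ y, |w y| ≤ C) (h1 : ∫ y, Real.exp (w y) ∂ν = 1) :
    ((klDiv ρ ν : ℝ≥0∞) : EReal) =
      (klDiv ρ (ν.tilted w) : ℝ≥0∞) + ((∫ y, w y ∂ρ : ℝ) : EReal) := by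
  have hwi : Integrable w ρ := Integrable.of_bound hw.aestronglyMeasurable C (ae_of_all _ hC)
  have hei : Integrable (fun y => Real.exp (w y)) ν :=
    Integrable.of_bound hw.exp.aestronglyMeasurable (Real.exp C) (ae_of_all _ fun y => by
      rw [Real.norm_eq_abs, abs_of_pos (Real.exp_pos _)]
      exact Real.exp_le_exp.2 (abs_le.1 (hC y)).2)
  have hprob : IsProbabilityMeasure (ν.tilted w) := isProbabilityMeasure_tilted hei
  by_cases hac : ρ ≪ ν
  · have hac' : ρ ≪ ν.tilted w := hac.trans (absolutelyContinuous_tilted hei)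
    have hllr := llr_tilted_right hac hei
    by_cases hint : Integrable (llr ρ ν) ρ
    · have hint' := integrable_llr_tilted_right hac hwi hint hei
      rw [klDiv_coe_eq_of_ac ρ ν hac hint, klDiv_coe_eq_of_ac ρ _ hac' hint',
        integral_llr_tilted_right hac hwi hei hint, h1, ← EReal.coe_add]
      simp
    · have hint' : ¬ Integrable (llr ρ (ν.tilted w)) ρ := by
        rw [integrable_congr hllr]
        intro h
        have h2 : Integrable (fun y => -w y + Real.log (∫ z, Real.exp (w z) ∂ν)) ρ :=
          hwi.neg.add (integrable_const _)
        refine hint ((h.sub h2).congr (ae_of_all _ fun y => ?_))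
        simp
      rw [klDiv_of_not_integrable hint, klDiv_of_not_integrable hint']
      simp
  · have hac' : ¬ ρ ≪ ν.tilted w := fun h => hac (h.trans (tilted_absolutelyContinuous _ _))
    rw [klDiv_of_not_ac hac, klDiv_of_not_ac hac']
    simp

variable {S S' : Type*}
    [MetricSpace S] [CompactSpace S] [MeasurableSpace S] [BorelSpace S]
    [MetricSpace S'] [CompactSpace S'] [MeasurableSpace S'] [BorelSpace S']
    {α : Measure S} [IsProbabilityMeasure α] {α' : Measure S'} [IsProbabilityMeasure α']
    {k : S → S' → ℝ}

/-- The normalization `∫ e^{-g(σ)} k(σ, η) α(dσ)`. -/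
def tiltNorm (α : Measure S) (k : S → S' → ℝ) (g : S → ℝ) (η : S') : ℝ :=
  ∫ σ, Real.exp (-g σ) * k σ η ∂α

/-- The density of the conditional law of a first-layer spin given `η` in the field `g`. -/
def tiltDensity (α : Measure S) (k : S → S' → ℝ) (g : S → ℝ) (σ : S) (η : S') : ℝ :=
  Real.exp (-g σ) * k σ η / tiltNorm α k g η

namespace IsCouplingDensity

theorem measurable_left (hk : IsCouplingDensity α α' k) (η : S') : Measurable fun σ => k σ η :=
  hk.measurable.comp (measurable_id.prodMk measurable_const)

theorem exists_bound (hk : IsCouplingDensity α α' k) :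
    ∃ C : ℝ, 0 < C ∧ ∀ σ η, k σ η ≤ C := by
  obtain ⟨C, hC⟩ := hk.bounded_log
  exact ⟨Real.exp C, Real.exp_pos _, fun σ η => (le_exp_of_abs_log_le (hk.pos σ η) (hC σ η)).1⟩

theorem integrable_mul (hk : IsCouplingDensity α α' k) {f : S → ℝ} (hf : Continuous f) (η : S') :
    Integrable (fun σ => f σ * k σ η) α := by
  obtain ⟨C, hC, h⟩ := hk.exists_bound
  refine (integrable_of_continuous hf α).mul_bdd (c := C)
    (hk.measurable_left η).aestronglyMeasurable (ae_of_all _ fun σ => ?_)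
  rw [Real.norm_eq_abs, abs_of_pos (hk.pos σ η)]
  exact h σ η

theorem continuous_tiltNorm (hk : IsCouplingDensity α α' k) {g : S → ℝ} (hg : Continuous g) :
    Continuous (tiltNorm α k g) :=
  hk.weakly_continuous _ (by fun_prop)

theorem tiltNorm_pos (hk : IsCouplingDensity α α' k) {g : S → ℝ} (hg : Continuous g) (η : S') :
    0 < tiltNorm α k g η := by
  have hc : Continuous fun σ => Real.exp (-g σ) := by fun_prop
  have hpos : ∀ σ, 0 < Real.exp (-g σ) * k σ η := fun σ => mul_pos (Real.exp_pos _) (hk.pos σ η)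
  rw [tiltNorm, integral_pos_iff_support_of_nonneg (fun σ => (hpos σ).le) (hk.integrable_mul hc η)]
  have : Function.support (fun σ => Real.exp (-g σ) * k σ η) = Set.univ :=
    Set.eq_univ_of_forall fun σ => (hpos σ).ne'
  rw [this]
  simp

theorem log_tiltDensity (hk : IsCouplingDensity α α' k) {g : S → ℝ} (hg : Continuous g) (σ : S)
    (η : S') : Real.log (tiltDensity α k g σ η) =
      -g σ + Real.log (k σ η) - Real.log (tiltNorm α k g η) := by
  rw [tiltDensity, Real.log_div (mul_pos (Real.exp_pos _) (hk.pos σ η)).ne'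
    (hk.tiltNorm_pos hg η).ne', Real.log_mul (Real.exp_pos _).ne' (hk.pos σ η).ne', Real.log_exp]

theorem isFellerDensity_tiltDensity (hk : IsCouplingDensity α α' k) {g : S → ℝ}
    (hg : Continuous g) : IsFellerDensity α (tiltDensity α k g) where
  measurable := by
    have h1 : Measurable fun ξ : S × S' => Real.exp (-g ξ.1) :=
      (hg.measurable.comp measurable_fst).neg.exp
    exact (h1.mul hk.measurable).div ((hk.continuous_tiltNorm hg).measurable.comp measurable_snd)
  pos σ η := div_pos (mul_pos (Real.exp_pos _) (hk.pos σ η)) (hk.tiltNorm_pos hg η)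
  bounded_log := by
    obtain ⟨C, hC⟩ := hk.bounded_log
    obtain ⟨C₁, hC₁⟩ := isCompact_univ.exists_bound_of_continuousOn hg.continuousOn
    obtain ⟨C₂, hC₂⟩ := isCompact_univ.exists_bound_of_continuousOn
      ((hk.continuous_tiltNorm hg).log fun η => (hk.tiltNorm_pos hg η).ne').continuousOn
    refine ⟨C₁ + C + C₂, fun σ η => ?_⟩
    rw [hk.log_tiltDensity hg]
    have h1 := hC σ η
    have h2 := hC₁ σ trivial
    have h3 := hC₂ η trivial
    rw [Real.norm_eq_abs] at h2 h3
    rw [abs_le] at *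
    constructor <;> linarith
  mass η := by
    simp only [tiltDensity]
    rw [integral_div]
    exact div_self (hk.tiltNorm_pos hg η).ne'
  weakly_continuous f hf := by
    have h := (hk.weakly_continuous (fun σ => f σ * Real.exp (-g σ)) (by fun_prop)).div
      (hk.continuous_tiltNorm hg) fun η => (hk.tiltNorm_pos hg η).ne'
    refine h.congr fun η => ?_
    rw [Pi.div_apply, ← integral_div]
    refine integral_congr_ae (ae_of_all _ fun σ => ?_)
    simp only [tiltDensity]
    ring

end IsCouplingDensity

/-- The part `Φ(π₁ μ) - ∫ g d(π₁ μ)` of the interaction that is left after the field `g` has been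
absorbed into the single-spin laws. -/
def residual (Φ : FiniteMeasure S → ℝ) (g : S → ℝ) (μ : FiniteMeasure (S × S')) : ℝ :=
  Φ (μ.map Prod.fst) - ∫ σ, g σ ∂(μ.map Prod.fst : Measure S)

theorem continuous_residual {Φ : FiniteMeasure S → ℝ} (hΦ : Continuous Φ) {g : S → ℝ}
    (hg : Continuous g) : Continuous (residual (S' := S') Φ g) := by
  have h := FiniteMeasure.continuous_map (Ω := S × S') (f := Prod.fst) continuous_fst
  exact (hΦ.comp h).sub ((FiniteMeasure.continuous_integral_continuousMap
    (⟨g, hg⟩ : C(S, ℝ))).comp h)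

/-- On `M_{lam}` the rate function is the relative entropy with respect to the coupling built from
`e^{-g} k`, plus the residual interaction, up to a constant. -/
theorem rateFunction_eq (hk : IsCouplingDensity α α' k) (Φ : FiniteMeasure S → ℝ) {g : S → ℝ}
    (hg : Continuous g) (lam : ProbabilityMeasure S') {ρ : ProbabilityMeasure (S × S')}
    (hρ : ρ ∈ constrained lam) :
    rateFunction Φ α k lam ρ =
      (klDiv (ρ : Measure (S × S')) ((hk.isFellerDensity_tiltDensity hg).coupling lam) : ℝ≥0∞) +
        ((residual Φ g ρ.toFiniteMeasure -
          ∫ η, Real.log (tiltNorm α k g η) ∂(lam : Measure S') : ℝ) : EReal) := by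
  have hq := hk.isFellerDensity_tiltDensity hg
  obtain ⟨C, hC⟩ := hq.bounded_log
  obtain ⟨Ck, hCk⟩ := hk.bounded_log
  let w : S × S' → ℝ := fun ξ => Real.log (tiltDensity α k g ξ.1 ξ.2)
  have hwm : Measurable w := hq.measurable.log
  have hexp : ∀ ξ : S × S', Real.exp (w ξ) = tiltDensity α k g ξ.1 ξ.2 := fun ξ =>
    Real.exp_log (hq.pos _ _)
  have hei : Integrable (fun ξ => Real.exp (w ξ)) (α.prod (lam : Measure S')) :=
    Integrable.of_bound hwm.exp.aestronglyMeasurable (Real.exp C) (ae_of_all _ fun ξ => by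
      rw [Real.norm_eq_abs, abs_of_pos (Real.exp_pos _)]
      exact Real.exp_le_exp.2 (abs_le.1 (hC _ _)).2)
  have h1 : ∫ ξ, Real.exp (w ξ) ∂(α.prod (lam : Measure S')) = 1 := by
    rw [integral_prod_symm _ hei]
    simp_rw [hexp]
    simp [hq.mass]
  have htilt : (hq.coupling lam : Measure (S × S')) = (α.prod (lam : Measure S')).tilted w := by
    rw [Measure.tilted, h1]
    simp_rw [hexp, div_one]
    rfl
  have hw_int : ∫ ξ, w ξ ∂(ρ : Measure (S × S')) =
      -(∫ σ, g σ ∂(firstMarginal ρ : Measure S)) + ∫ ξ, Real.log (k ξ.1 ξ.2) ∂(ρ : Measure (S × S'))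
        - ∫ η, Real.log (tiltNorm α k g η) ∂(lam : Measure S') := by
    have e1 : ∫ σ, g σ ∂(firstMarginal ρ : Measure S) =
        ∫ ξ : S × S', g ξ.1 ∂(ρ : Measure (S × S')) :=
      integral_map measurable_fst.aemeasurable hg.aestronglyMeasurable
    have hnc : Continuous fun η => Real.log (tiltNorm α k g η) :=
      (hk.continuous_tiltNorm hg).log fun η => (hk.tiltNorm_pos hg η).ne'
    have e2 : ∫ η, Real.log (tiltNorm α k g η) ∂(lam : Measure S') =
        ∫ ξ : S × S', Real.log (tiltNorm α k g ξ.2) ∂(ρ : Measure (S × S')) := by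
      have hρ' : (ρ : Measure (S × S')).map Prod.snd = (lam : Measure S') := hρ
      rw [← hρ']
      exact integral_map measurable_snd.aemeasurable hnc.aestronglyMeasurable
    have i1 : Integrable (fun ξ : S × S' => g ξ.1) (ρ : Measure (S × S')) :=
      integrable_of_continuous (hg.comp continuous_fst) _
    have i2 : Integrable (fun ξ : S × S' => Real.log (tiltNorm α k g ξ.2))
        (ρ : Measure (S × S')) := integrable_of_continuous (hnc.comp continuous_snd) _
    have i3 : Integrable (fun ξ : S × S' => Real.log (k ξ.1 ξ.2)) (ρ : Measure (S × S')) :=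
      Integrable.of_bound hk.measurable.log.aestronglyMeasurable Ck
        (ae_of_all _ fun ξ => hCk _ _)
    have e3 : w = fun ξ : S × S' => -g ξ.1 + Real.log (k ξ.1 ξ.2) -
        Real.log (tiltNorm α k g ξ.2) := funext fun ξ => hk.log_tiltDensity hg _ _
    have i4 : Integrable (fun ξ : S × S' => -g ξ.1 + Real.log (k ξ.1 ξ.2))
        (ρ : Measure (S × S')) := i1.neg.add i3
    have i5 : Integrable (fun ξ : S × S' => -g ξ.1) (ρ : Measure (S × S')) := i1.neg
    rw [e1, e2, e3, integral_sub i4 i2, integral_add i5 i3, integral_neg]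
  rw [rateFunction, htilt, klDiv_eq_klDiv_tilted_add _ _ hwm (fun ξ => hC ξ.1 ξ.2) h1, add_assoc,
    ← EReal.coe_add, hw_int]
  congr 2
  rw [residual]
  change _ = Φ (firstMarginal ρ) - ∫ σ, g σ ∂(firstMarginal ρ : Measure S) - _
  ring

theorem IsProperInteraction.tendsto_slope_mix {Φ : FiniteMeasure S → ℝ}
    (hΦ : IsProperInteraction Φ) (ν μ : FiniteMeasure S) :
    Tendsto (fun t : ℝ => (Φ ((1 - t).toNNReal • ν + t.toNNReal • μ) - Φ ν) / t) (𝓝[>] 0)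
      (𝓝 (posDeriv Φ ν μ - posDeriv Φ ν ν)) := by
  have hc : Continuous fun t : ℝ => (1 - t).toNNReal • ν + t.toNNReal • μ :=
    ((continuous_real_toNNReal.comp (continuous_const.sub continuous_id)).smul
      continuous_const).add (continuous_real_toNNReal.smul continuous_const)
  have h0 : Tendsto (fun t : ℝ => (1 - t).toNNReal • ν + t.toNNReal • μ) (𝓝[>] 0) (𝓝 ν) := by
    have := hc.tendsto 0
    simp only [sub_zero, Real.toNNReal_one, one_smul, Real.toNNReal_zero, zero_smul,
      add_zero] at this
    exact this.mono_left nhdsWithin_le_nhds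
  have h1 : Tendsto (fun t : ℝ => (((1 - t).toNNReal • ν + t.toNNReal • μ, t) :
      FiniteMeasure S × ℝ)) (𝓝[>] 0) (𝓝 ν ×ˢ 𝓝[>] 0) := h0.prodMk tendsto_id
  have h2 := (hΦ.tendsto_slope ν ν).comp h1
  refine ((hΦ.tendsto_slope_const ν μ).sub h2).congr' ?_
  filter_upwards [Ioo_mem_nhdsGT (show (0 : ℝ) < 1 by norm_num)] with t ht
  have e : (1 - t).toNNReal • ν + t.toNNReal • μ + t.toNNReal • ν = ν + t.toNNReal • μ := by
    rw [add_right_comm, ← add_smul, ← Real.toNNReal_add (by linarith [ht.2]) ht.1.le]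
    simp
  simp only [Function.comp]
  rw [e]
  ring

/-- The Euler–Lagrange equation: a minimizer `ρ` is the coupling built from `e^{-g} k` with
`g(σ) = Φ⁽¹⁾(π₁ ρ, δ_σ)`. It follows by comparing `ρ` with `(1 - t) ρ + t p`, `p` the coupling,
as `t → 0`: the entropy decreases at rate at least `S(ρ | p)`, the rest is stationary. -/
theorem eq_coupling_of_isMinOn (hk : IsCouplingDensity α α' k) {Φ : FiniteMeasure S → ℝ}
    (hΦ : IsProperInteraction Φ) {ν' : ProbabilityMeasure S'} {ρ : ProbabilityMeasure (S × S')}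
    (hρ : ρ ∈ constrained ν')
    (hmin : IsMinOn (rateFunction Φ α k ν') (constrained ν') ρ) :
    ρ = (hk.isFellerDensity_tiltDensity
      (hΦ.continuous_pointDeriv (firstMarginal ρ))).coupling ν' := by
  set g := pointDeriv Φ (firstMarginal ρ) with hgdef
  have hg : Continuous g := hΦ.continuous_pointDeriv (firstMarginal ρ)
  have hq := hk.isFellerDensity_tiltDensity hg
  set p := hq.coupling ν' with hp
  set L := ∫ η, Real.log (tiltNorm α k g η) ∂(ν' : Measure S')
  have hJ : ∀ κ ∈ constrained (S := S) ν', rateFunction Φ α k ν' κ =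
      (klDiv (κ : Measure (S × S')) p : ℝ≥0∞) +
        ((residual Φ g κ.toFiniteMeasure - L : ℝ) : EReal) := fun κ hκ =>
    rateFunction_eq hk Φ hg ν' hκ
  have hpmem : p ∈ constrained ν' := hq.coupling_mem_constrained ν'
  have htop : klDiv (ρ : Measure (S × S')) p ≠ ∞ := by
    intro htop
    have h1 : rateFunction Φ α k ν' ρ ≤ rateFunction Φ α k ν' p := hmin hpmem
    rw [hJ ρ hρ, hJ p hpmem, htop, klDiv_self] at h1
    simp only [EReal.coe_ennreal_top, EReal.top_add_coe, EReal.coe_ennreal_zero, zero_add,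
      top_le_iff] at h1
    exact EReal.coe_ne_top _ h1
  set K := (klDiv (ρ : Measure (S × S')) p).toReal with hK
  have hKeq : ((klDiv (ρ : Measure (S × S')) p : ℝ≥0∞) : EReal) = (K : EReal) :=
    (EReal.coe_ennreal_toReal htop).symm
  -- comparison with the mixtures `(1 - t) ρ + t p`
  have hmix : ∀ t : ℝ, 0 < t → t < 1 → K ≤
      (Φ ((1 - t).toNNReal • firstMarginal ρ + t.toNNReal • firstMarginal p) -
        Φ (firstMarginal ρ)) / t +
      (∫ σ, g σ ∂(firstMarginal ρ : Measure S) - ∫ σ, g σ ∂(firstMarginal p : Measure S)) := by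
    intro t ht0 ht1
    let s : ℝ≥0 := t.toNNReal
    have hs : (s : ℝ) = t := Real.coe_toNNReal _ ht0.le
    have hs1 : s ≤ 1 := by rw [← NNReal.coe_le_coe, hs]; exact ht1.le
    have hs2 : (1 - t).toNNReal = 1 - s := by
      rw [← NNReal.coe_inj, NNReal.coe_sub hs1, Real.coe_toNNReal _ (by linarith), hs]; rfl
    have hprob : IsProbabilityMeasure
        ((1 - s) • (ρ : Measure (S × S')) + s • (p : Measure (S × S'))) := by
      constructor
      simp only [Measure.coe_add, Pi.add_apply, Measure.coe_nnreal_smul_apply, measure_univ,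
        mul_one]
      rw [← ENNReal.coe_add, tsub_add_cancel_of_le hs1, ENNReal.coe_one]
    let κ : ProbabilityMeasure (S × S') := ⟨_, hprob⟩
    have hκ : κ.toFiniteMeasure = (1 - s) • ρ.toFiniteMeasure + s • p.toFiniteMeasure := rfl
    have hκmem : κ ∈ constrained ν' := by
      change Measure.map Prod.snd ((1 - s) • (ρ : Measure (S × S')) + s • (p : Measure (S × S'))) =
        (ν' : Measure S')
      rw [Measure.map_add _ _ measurable_snd, Measure.map_smul, Measure.map_smul]
      rw [show Measure.map Prod.snd (ρ : Measure (S × S')) = (ν' : Measure S') from hρ,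
        show Measure.map Prod.snd (p : Measure (S × S')) = (ν' : Measure S') from hpmem,
        ← add_smul, tsub_add_cancel_of_le hs1, one_smul]
    have h1 : rateFunction Φ α k ν' ρ ≤ rateFunction Φ α k ν' κ := hmin hκmem
    have hkl := klDiv_mix_le (ρ : Measure (S × S')) p htop hs1
    have hklK : ((klDiv (κ : Measure (S × S')) p : ℝ≥0∞) : EReal) ≤
        (((1 - t) * K : ℝ) : EReal) := by
      have h2 : klDiv (κ : Measure (S × S')) p ≤ ENNReal.ofReal ((1 - t) * K) := by
        refine hkl.trans (le_of_eq ?_)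
        rw [ENNReal.ofReal_mul (by linarith), hK, ENNReal.ofReal_toReal htop, ← hs2]
        rfl
      have h3 := EReal.coe_ennreal_le_coe_ennreal_iff.2 h2
      rwa [EReal.coe_ennreal_ofReal, max_eq_left
        (mul_nonneg (by linarith) ENNReal.toReal_nonneg)] at h3
    rw [hJ ρ hρ, hJ κ hκmem, hKeq, ← EReal.coe_add] at h1
    have h4 := h1.trans (add_le_add_left hklK _)
    rw [← EReal.coe_add, EReal.coe_le_coe_iff] at h4
    have hfm : κ.toFiniteMeasure.map Prod.fst =
        (1 - t).toNNReal • firstMarginal ρ + t.toNNReal • firstMarginal p := by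
      rw [hκ, FiniteMeasure.map_add measurable_fst, FiniteMeasure.map_smul,
        FiniteMeasure.map_smul, hs2]
      rfl
    have hres : residual Φ g κ.toFiniteMeasure =
        Φ ((1 - t).toNNReal • firstMarginal ρ + t.toNNReal • firstMarginal p) -
        ((1 - t) * ∫ σ, g σ ∂(firstMarginal ρ : Measure S) +
          t * ∫ σ, g σ ∂(firstMarginal p : Measure S)) := by
      rw [residual, hfm]
      congr 1
      rw [FiniteMeasure.toMeasure_add, FiniteMeasure.toMeasure_smul, FiniteMeasure.toMeasure_smul,
        integral_add_measure (integrable_of_continuous hg _) (integrable_of_continuous hg _),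
        integral_smul_nnreal_measure, integral_smul_nnreal_measure, NNReal.smul_def,
        NNReal.smul_def, Real.coe_toNNReal _ ht0.le, Real.coe_toNNReal _ (by linarith)]
      rfl
    have hresρ : residual Φ g ρ.toFiniteMeasure =
        Φ (firstMarginal ρ) - ∫ σ, g σ ∂(firstMarginal ρ : Measure S) := rfl
    rw [hres, hresρ] at h4
    rw [← sub_le_iff_le_add, le_div_iff₀ ht0]
    nlinarith
  have hrep : ∀ κ : ProbabilityMeasure (S × S'), posDeriv Φ (firstMarginal ρ) (firstMarginal κ) =
      ∫ σ, g σ ∂(firstMarginal κ : Measure S) := by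
    intro κ
    exact hΦ.posDeriv_eq_integral_of_probability (firstMarginal ρ)
      (κ.map measurable_fst.aemeasurable)
  have hlim := (hΦ.tendsto_slope_mix (firstMarginal ρ) (firstMarginal p)).add_const
    (∫ σ, g σ ∂(firstMarginal ρ : Measure S) - ∫ σ, g σ ∂(firstMarginal p : Measure S))
  rw [hrep, hrep, sub_add_sub_cancel, sub_self] at hlim
  have hK0 : K ≤ 0 := by
    refine ge_of_tendsto hlim ?_
    filter_upwards [Ioo_mem_nhdsGT (show (0 : ℝ) < 1 by norm_num)] with t ht
    exact hmix t ht.1 ht.2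
  have hK0' : K = 0 := le_antisymm hK0 ENNReal.toReal_nonneg
  have hkl0 : klDiv (ρ : Measure (S × S')) p = 0 := by
    rcases (ENNReal.toReal_eq_zero_iff _).1 hK0' with h | h
    · exact h
    · exact absurd h htop
  rw [klDiv_eq_zero_iff] at hkl0
  exact Subtype.ext hkl0

/-- A unique minimizer is a strict minimizer of relative entropy plus residual interaction. -/
theorem IsUniqueMinimizer.residual_lt (hk : IsCouplingDensity α α' k) {Φ : FiniteMeasure S → ℝ}
    {g : S → ℝ} (hg : Continuous g) {ν' : ProbabilityMeasure S'} {ρ : ProbabilityMeasure (S × S')}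
    (h : IsUniqueMinimizer Φ α k ν' ρ)
    (hρ : ρ = (hk.isFellerDensity_tiltDensity hg).coupling ν')
    {κ : ProbabilityMeasure (S × S')} (hκ : κ ∈ constrained ν') (hne : κ ≠ ρ) :
    (residual Φ g ρ.toFiniteMeasure : EReal) <
      (klDiv (κ : Measure (S × S')) ((hk.isFellerDensity_tiltDensity hg).coupling ν') : ℝ≥0∞) +
        (residual Φ g κ.toFiniteMeasure : ℝ) := by
  have hlt : rateFunction Φ α k ν' ρ < rateFunction Φ α k ν' κ := by
    by_contra! hle
    exact hne (h.2 κ hκ fun x hx => hle.trans (h.1.2 hx))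
  rw [rateFunction_eq hk Φ hg ν' hκ, rateFunction_eq hk Φ hg ν' h.1.1, ← hρ, klDiv_self,
    EReal.coe_ennreal_zero, zero_add, coe_lt_coe_add_coe_iff] at hlt
  rw [coe_lt_coe_add_coe_iff, ← hρ]
  convert hlt using 2
  ring

end Variational

/-! ### Insertion of finitely many spins -/

section Insertion

/-- Bounded functionals of random points that concentrate at `t` converge in mean. -/
theorem tendsto_lintegral_of_concentration {T : Type*} [TopologicalSpace T] {Y : ℕ → Type*}
    [∀ m, MeasurableSpace (Y m)] (μ : ∀ m, Measure (Y m)) [∀ m, IsProbabilityMeasure (μ m)]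
    (L : ∀ m, Y m → T) {t : T}
    (hL : ∀ m (O : Set T), IsOpen O → MeasurableSet (L m ⁻¹' O))
    (hconc : ∀ O : Set T, IsOpen O → t ∈ O → Tendsto (fun m => μ m (L m ⁻¹' Oᶜ)) atTop (𝓝 0))
    (F : ℕ → T → ℝ) (hF : ∀ m, Measurable fun y => F m (L m y)) {B a : ℝ}
    (h0 : ∀ m y, 0 ≤ F m (L m y)) (hB : ∀ m y, F m (L m y) ≤ B)
    (hlim : Tendsto (fun p : ℕ × T => F p.1 p.2) (atTop ×ˢ 𝓝 t) (𝓝 a)) :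
    Tendsto (fun m => ∫⁻ y, ENNReal.ofReal (F m (L m y)) ∂(μ m)) atTop (𝓝 (ENNReal.ofReal a)) := by
  have hint : ∀ m, Integrable (fun y => F m (L m y)) (μ m) := fun m =>
    Integrable.of_bound (hF m).aestronglyMeasurable B (ae_of_all _ fun y => by
      rw [Real.norm_eq_abs, abs_of_nonneg (h0 m y)]; exact hB m y)
  have he : ∀ m, ∫⁻ y, ENNReal.ofReal (F m (L m y)) ∂(μ m) =
      ENNReal.ofReal (∫ y, F m (L m y) ∂(μ m)) := fun m =>
    (ofReal_integral_eq_lintegral_ofReal (hint m) (ae_of_all _ (h0 m))).symm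
  simp_rw [he]
  refine ENNReal.tendsto_ofReal (Metric.tendsto_atTop'.2 fun ε hε => ?_)
  obtain ⟨P, hP, Q, hQ, hPQ⟩ := eventually_prod_iff.1
    (Metric.tendsto_nhds.1 hlim (ε / 2) (by positivity))
  obtain ⟨O, hOQ, hO, htO⟩ := mem_nhds_iff.1 hQ
  have hBa : 0 ≤ |B| + |a| := by positivity
  have hsmall : ∀ᶠ m in atTop, (μ m).real (L m ⁻¹' Oᶜ) * (|B| + |a| + 1) < ε / 2 := by
    have h1 := ((ENNReal.tendsto_toReal ENNReal.zero_ne_top).comp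
      (hconc O hO htO)).mul_const (|B| + |a| + 1)
    rw [ENNReal.toReal_zero, zero_mul] at h1
    exact h1.eventually (gt_mem_nhds (by positivity))
  obtain ⟨M, hM⟩ := eventually_atTop.1 (hP.and hsmall)
  refine ⟨M, fun m hm => ?_⟩
  obtain ⟨hmP, hms⟩ := hM m (le_of_lt hm)
  have hmeas : MeasurableSet (L m ⁻¹' Oᶜ) := (hL m O hO).compl
  have hpt : ∀ y, |F m (L m y) - a| ≤ ε / 2 + (L m ⁻¹' Oᶜ).indicator (fun _ => |B| + |a|) y := by
    intro y
    by_cases hy : L m y ∈ O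
    · rw [Set.indicator_of_notMem (by simpa using hy), add_zero]
      exact (hPQ hmP (hOQ hy)).le
    · rw [Set.indicator_of_mem (by simpa using hy)]
      calc |F m (L m y) - a| ≤ |F m (L m y)| + |a| := abs_sub _ _
        _ ≤ |B| + |a| := by
            rw [abs_of_nonneg (h0 m y)]
            gcongr
            exact (hB m y).trans (le_abs_self B)
        _ ≤ _ := by linarith
  have hind : Integrable ((L m ⁻¹' Oᶜ).indicator fun _ => |B| + |a|) (μ m) :=
    (integrable_const _).indicator hmeas
  have hae : ∫ y, (F m (L m y) - a) ∂(μ m) = ∫ y, F m (L m y) ∂(μ m) - a := by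
    rw [integral_sub (hint m) (integrable_const _)]
    simp
  rw [Real.dist_eq, ← hae]
  calc |∫ y, (F m (L m y) - a) ∂(μ m)| ≤ ∫ y, |F m (L m y) - a| ∂(μ m) :=
        abs_integral_le_integral_abs
    _ ≤ ∫ y, (ε / 2 + (L m ⁻¹' Oᶜ).indicator (fun _ => |B| + |a|) y) ∂(μ m) :=
        integral_mono ((hint m).sub (integrable_const _)).abs ((integrable_const _).add hind) hpt
    _ = ε / 2 + (μ m).real (L m ⁻¹' Oᶜ) * (|B| + |a|) := by
        rw [integral_add (integrable_const _) hind, integral_indicator hmeas]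
        simp
    _ < ε := by nlinarith [measureReal_nonneg (μ := μ m) (s := L m ⁻¹' Oᶜ)]

variable {S S' : Type*}
    [MetricSpace S] [CompactSpace S] [MeasurableSpace S] [BorelSpace S]
    [MetricSpace S'] [CompactSpace S'] [MeasurableSpace S'] [BorelSpace S']

/-- The factor `e^{-N (Φ(ν + N⁻¹ ∑ᵢ δ_{uᵢ}) - Φ(ν))}` that comes from inserting the spins `uᵢ`. -/
def insertionFactor (Φ : FiniteMeasure S → ℝ) {n : ℕ} (u : Fin n → S) (N : ℕ)
    (ν : FiniteMeasure S) : ℝ :=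
  Real.exp (-((N : ℝ) * (Φ (ν + (N : ℝ≥0)⁻¹ • ∑ i, pointMass (u i)) - Φ ν)))

theorem IsProperInteraction.posDeriv_sum_pointMass {Φ : FiniteMeasure S → ℝ}
    (hΦ : IsProperInteraction Φ) (ν : FiniteMeasure S) {n : ℕ} (u : Fin n → S) :
    posDeriv Φ ν (∑ i, pointMass (u i)) = ∑ i, pointDeriv Φ ν (u i) :=
  hΦ.posDeriv_sum ν _ _

theorem IsProperInteraction.tendsto_insertionFactor {Φ : FiniteMeasure S → ℝ}
    (hΦ : IsProperInteraction Φ) (ν : FiniteMeasure S) {n : ℕ} (u : Fin n → S) :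
    Tendsto (fun p : ℕ × FiniteMeasure S => insertionFactor Φ u (n + p.1) p.2) (atTop ×ˢ 𝓝 ν)
      (𝓝 (Real.exp (-∑ i, pointDeriv Φ ν (u i)))) := by
  have h0 : Tendsto (fun m : ℕ => (((n + m : ℕ) : ℝ))⁻¹) atTop (𝓝[>] 0) := by
    have h1 : Tendsto (fun m : ℕ => n + m) atTop atTop :=
      tendsto_atTop_mono (fun m => Nat.le_add_left m n) tendsto_id
    refine tendsto_nhdsWithin_iff.2 ⟨tendsto_inv_atTop_nhds_zero_nat.comp h1, ?_⟩
    filter_upwards [eventually_gt_atTop 0] with m hm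
    have : (0 : ℝ) < ((n + m : ℕ) : ℝ) := by positivity
    exact inv_pos.2 this
  have h1 : Tendsto (fun p : ℕ × FiniteMeasure S =>
      ((p.2, (((n + p.1 : ℕ) : ℝ))⁻¹) : FiniteMeasure S × ℝ)) (atTop ×ˢ 𝓝 ν) (𝓝 ν ×ˢ 𝓝[>] 0) :=
    tendsto_snd.prodMk (h0.comp tendsto_fst)
  have h2 := (hΦ.tendsto_slope ν (∑ i, pointMass (u i))).comp h1
  rw [hΦ.posDeriv_sum_pointMass] at h2
  refine ((Real.continuous_exp.tendsto _).comp h2.neg).congr fun p => ?_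
  simp only [Function.comp, insertionFactor]
  rw [Real.toNNReal_inv, Real.toNNReal_natCast, div_inv_eq_mul, mul_comm]

/-- The insertion factors are bounded uniformly in `N`, `u` and `ν`; this is where the uniform bound
on `Φ⁽¹⁾(ν, δ_x)` enters. -/
theorem IsProperInteraction.exists_insertionFactor_le {Φ : FiniteMeasure S → ℝ}
    (hΦ : IsProperInteraction Φ) (n : ℕ) :
    ∃ B : ℝ, ∀ (u : Fin n → S) (N : ℕ) (ν : FiniteMeasure S), ν.mass ≤ 1 →
      insertionFactor Φ u N ν ≤ B := by
  obtain ⟨C, hC0, hC⟩ := hΦ.exists_abs_pointDeriv_le (1 + n : ℝ≥0)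
  refine ⟨Real.exp (n * C), fun u N ν hν => Real.exp_le_exp.2 ?_⟩
  have hN1 : (N : ℝ)⁻¹ ≤ 1 := Nat.cast_inv_le_one N
  have hmass : (∑ i, pointMass (u i) : FiniteMeasure S).mass = n := by
    simpa using mass_smul_sum_pointMass 1 Finset.univ u
  have h := hΦ.abs_sub_le ν (∑ i, pointMass (u i)) (d := 0) (C := n * C) (t := (N : ℝ)⁻¹)
    (by positivity) (fun s hs0 hs => by
      rw [sub_zero, hΦ.posDeriv_sum_pointMass]
      refine (Finset.abs_sum_le_sum_abs _ _).trans ((Finset.sum_le_sum fun i _ => hC _ ?_ _).trans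
        (by simp))
      have hs1 : s.toNNReal ≤ 1 := by
        rw [← NNReal.coe_le_coe, Real.coe_toNNReal _ hs0]; exact hs.trans hN1
      have e : (ν + s.toNNReal • ∑ i, pointMass (u i)).mass = ν.mass + s.toNNReal * n := by
        rw [← hmass]
        simp [FiniteMeasure.mass]
      rw [e]
      gcongr
      exact mul_le_of_le_one_left (by positivity) hs1)
  rw [mul_zero, sub_zero, Real.toNNReal_inv, Real.toNNReal_natCast] at h
  rcases Nat.eq_zero_or_pos N with rfl | hN
  · simp only [Nat.cast_zero, zero_mul, neg_zero]; positivity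
  have hN' : (0 : ℝ) < N := by exact_mod_cast hN
  rw [← div_eq_mul_inv, le_div_iff₀ hN'] at h
  have h2 := neg_abs_le (Φ (ν + (N : ℝ≥0)⁻¹ • ∑ i, pointMass (u i)) - Φ ν)
  nlinarith

theorem continuous_insertionFactor {Φ : FiniteMeasure S → ℝ} (hΦ : Continuous Φ) (n m : ℕ)
    (η : ℕ → S') : Continuous fun p : (Fin n → S) × (Fin m → S) =>
      insertionFactor Φ p.1 (n + m) ((pairEmpirical n m η p.2).map Prod.fst) := by
  have h1 : Continuous fun p : (Fin n → S) × (Fin m → S) =>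
      (pairEmpirical n m η p.2).map (Prod.fst : S × S' → S) :=
    (FiniteMeasure.continuous_map continuous_fst).comp
      ((continuous_pairEmpirical n m η).comp continuous_snd)
  have h2 : Continuous fun p : (Fin n → S) × (Fin m → S) =>
      ((n + m : ℕ) : ℝ≥0)⁻¹ • ∑ i, pointMass (p.1 i) := by
    refine FiniteMeasure.continuous_iff_forall_continuousMap_continuous_integral.2 fun f => ?_
    simp_rw [integral_smul_sum_pointMass]
    fun_prop
  exact Real.continuous_exp.comp
    (continuous_const.mul ((hΦ.comp (h1.add h2)).sub (hΦ.comp h1))).neg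

variable {α : Measure S} [IsProbabilityMeasure α] {q : S → S' → ℝ}

/-- The law of the first-layer spins at the sites `n, …, n + m - 1` without the first `n` spins:
the block law weighted by `e^{-N Ψ(L)}`. -/
def blockGibbs (α : Measure S) (q : S → S' → ℝ) (Ψ : FiniteMeasure (S × S') → ℝ) (n m : ℕ)
    (η : ℕ → S') : Measure (Fin m → S) :=
  (blockWeight α q Ψ n m η Set.univ)⁻¹ • (blockLaw α q n m η).withDensity fun τ =>
    ENNReal.ofReal (Real.exp (-(((n + m : ℕ) : ℝ) * Ψ (pairEmpirical n m η τ))))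

theorem blockGibbs_apply (Ψ : FiniteMeasure (S × S') → ℝ) (n m : ℕ) (η : ℕ → S')
    {s : Set (FiniteMeasure (S × S'))}
    (hs : MeasurableSet (pairEmpirical (S := S) n m η ⁻¹' s)) :
    blockGibbs α q Ψ n m η (pairEmpirical n m η ⁻¹' s) =
      blockWeight α q Ψ n m η s / blockWeight α q Ψ n m η Set.univ := by
  rw [blockGibbs, Measure.smul_apply, withDensity_apply _ hs, smul_eq_mul, mul_comm,
    ← div_eq_mul_inv]
  rfl

theorem isProbabilityMeasure_blockGibbs (hq : IsFellerDensity α q)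
    {Ψ : FiniteMeasure (S × S') → ℝ} (hΨ : Continuous Ψ) (n m : ℕ) (η : ℕ → S') :
    IsProbabilityMeasure (blockGibbs α q Ψ n m η) := by
  constructor
  have h := blockGibbs_apply (α := α) (q := q) Ψ n m η (s := Set.univ) (by simp)
  rw [Set.preimage_univ] at h
  rw [h, ENNReal.div_self (blockWeight_univ_ne_zero hq hΨ n m η)
    (blockWeight_univ_ne_top hq hΨ n m η)]

/-- The mean of the insertion factor under the law of the remaining spins. -/
def meanInsertion (Φ : FiniteMeasure S → ℝ) (α : Measure S) (q : S → S' → ℝ)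
    (Ψ : FiniteMeasure (S × S') → ℝ) (n m : ℕ) (η : ℕ → S') (u : Fin n → S) : ℝ≥0∞ :=
  ∫⁻ τ, ENNReal.ofReal (insertionFactor Φ u (n + m) ((pairEmpirical n m η τ).map Prod.fst))
    ∂(blockGibbs α q Ψ n m η)

theorem measurable_meanInsertion (hq : IsFellerDensity α q) {Φ : FiniteMeasure S → ℝ}
    (hΦ : Continuous Φ) {Ψ : FiniteMeasure (S × S') → ℝ} (hΨ : Continuous Ψ) (n m : ℕ)
    (η : ℕ → S') : Measurable (meanInsertion Φ α q Ψ n m η) := by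
  have := isProbabilityMeasure_blockGibbs hq hΨ n m η
  exact ((continuous_insertionFactor hΦ n m η).measurable.ennreal_ofReal).lintegral_prod_right'

theorem meanInsertion_le (hq : IsFellerDensity α q) {Φ : FiniteMeasure S → ℝ}
    {Ψ : FiniteMeasure (S × S') → ℝ} (hΨ : Continuous Ψ) {n : ℕ} {B : ℝ}
    (hB : ∀ (u : Fin n → S) (N : ℕ) (ν : FiniteMeasure S), ν.mass ≤ 1 →
      insertionFactor Φ u N ν ≤ B) (m : ℕ) (η : ℕ → S') (u : Fin n → S) :
    meanInsertion Φ α q Ψ n m η u ≤ ENNReal.ofReal B := by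
  have := isProbabilityMeasure_blockGibbs hq hΨ n m η
  calc meanInsertion Φ α q Ψ n m η u ≤ ∫⁻ _, ENNReal.ofReal B ∂(blockGibbs α q Ψ n m η) :=
        lintegral_mono fun τ => ENNReal.ofReal_le_ofReal (hB _ _ _
          ((FiniteMeasure.mass_map_le _ _).trans (mass_pairEmpirical_le n m η τ)))
    _ = _ := by simp

/-- The mean insertion factor converges to the product of the one-spin factors
`e^{-Φ⁽¹⁾(ν, δ_{uᵢ})}`, `ν` the first marginal of the limiting joint empirical measure. -/
theorem tendsto_meanInsertion (hq : IsFellerDensity α q) {Φ : FiniteMeasure S → ℝ}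
    (hΦ : IsProperInteraction Φ) {n : ℕ} {η : ℕ → S'} {ν' : ProbabilityMeasure S'}
    (hη : Tendsto (fun N : ℕ => (N : ℝ≥0)⁻¹ • ∑ j ∈ Finset.Ico n N, pointMass (η j)) atTop
      (𝓝 ν'.toFiniteMeasure))
    {Ψ : FiniteMeasure (S × S') → ℝ} (hΨ : Continuous Ψ)
    (h : ∀ ρ ∈ constrained (S := S) ν', ρ ≠ hq.coupling ν' →
      (Ψ (hq.coupling ν').toFiniteMeasure : EReal) <
        (InformationTheory.klDiv (ρ : Measure (S × S')) (hq.coupling ν') : ℝ≥0∞) +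
          (Ψ ρ.toFiniteMeasure : ℝ)) (u : Fin n → S) :
    Tendsto (fun m => meanInsertion Φ α q Ψ n m η u) atTop
      (𝓝 (ENNReal.ofReal (Real.exp
        (-∑ i, pointDeriv Φ (firstMarginal (hq.coupling ν')) (u i))))) := by
  have hprob := fun m => isProbabilityMeasure_blockGibbs hq hΨ n m η
  obtain ⟨B, hB⟩ := hΦ.exists_insertionFactor_le n
  have hcp := fun m => continuous_pairEmpirical (S := S) n m η
  refine tendsto_lintegral_of_concentration (fun m => blockGibbs α q Ψ n m η)
    (fun m => pairEmpirical n m η) (t := (hq.coupling ν').toFiniteMeasure) ?_ ?_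
    (fun m κ => insertionFactor Φ u (n + m) (κ.map Prod.fst)) ?_ (B := B) ?_ ?_ ?_
  · exact fun m O hO => (hO.preimage (hcp m)).measurableSet
  · intro O hO hmem
    refine (tendsto_blockWeight_div hq hη hΨ h hO hmem).congr fun m => ?_
    have hc : MeasurableSet (pairEmpirical (S := S) n m η ⁻¹' Oᶜ) :=
      (hO.preimage (hcp m)).measurableSet.compl
    exact (blockGibbs_apply Ψ n m η hc).symm
  · intro m
    have h1 : Continuous fun τ : Fin m → S => ((u, τ) : (Fin n → S) × (Fin m → S)) := by fun_prop
    exact ((continuous_insertionFactor hΦ.continuous n m η).comp h1).measurable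
  · exact fun m τ => (Real.exp_pos _).le
  · exact fun m τ => hB _ _ _
      ((FiniteMeasure.mass_map_le _ _).trans (mass_pairEmpirical_le n m η τ))
  · have h1 : Tendsto (fun κ : FiniteMeasure (S × S') => κ.map Prod.fst)
        (𝓝 (hq.coupling ν').toFiniteMeasure) (𝓝 (firstMarginal (hq.coupling ν'))) :=
      (FiniteMeasure.continuous_map continuous_fst).tendsto _
    have h2 : Tendsto (fun p : ℕ × FiniteMeasure (S × S') =>
        ((p.1, p.2.map Prod.fst) : ℕ × FiniteMeasure S))
        (atTop ×ˢ 𝓝 (hq.coupling ν').toFiniteMeasure)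
        (atTop ×ˢ 𝓝 (firstMarginal (hq.coupling ν'))) :=
      Tendsto.prodMk tendsto_fst (Tendsto.comp h1 tendsto_snd)
    have h3 := Tendsto.comp (hΦ.tendsto_insertionFactor (firstMarginal (hq.coupling ν')) u) h2
    exact h3

end Insertion

/-! ### The finite-volume conditional distributions -/

section FiniteVolume

variable {S S' : Type*}
    [MetricSpace S] [CompactSpace S] [MeasurableSpace S] [BorelSpace S]
    [MetricSpace S'] [CompactSpace S'] [MeasurableSpace S'] [BorelSpace S']

theorem continuous_empirical (N : ℕ) :
    Continuous (empirical N : (Fin N → S) → FiniteMeasure S) := by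
  refine FiniteMeasure.continuous_iff_forall_continuousMap_continuous_integral.2 fun f => ?_
  simp_rw [empirical, integral_smul_sum_pointMass]
  fun_prop

theorem empirical_append (n m : ℕ) (η : ℕ → S') (u : Fin n → S) (τ : Fin m → S) :
    empirical (n + m) (Fin.append u τ) =
      (pairEmpirical n m η τ).map Prod.fst + ((n + m : ℕ) : ℝ≥0)⁻¹ • ∑ i, pointMass (u i) := by
  rw [pairEmpirical, map_smul_sum_pointMass _ _ _ measurable_fst, empirical, ← smul_add,
    Fin.sum_univ_add]
  simp only [Fin.append_left, Fin.append_right]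
  exact congrArg _ (add_comm _ _)

theorem splice_castAdd {n : ℕ} (m : ℕ) (x : Fin n → S') (η : ℕ → S') (i : Fin n) :
    splice n x η (Fin.castAdd m i) = x i := by
  simp [splice]

theorem splice_natAdd (n : ℕ) {m : ℕ} (x : Fin n → S') (η : ℕ → S') (j : Fin m) :
    splice n x η (Fin.natAdd n j) = η (n + j) := by
  simp [splice]

variable {α : Measure S} [IsProbabilityMeasure α] {α' : Measure S'} [IsProbabilityMeasure α']
    {k : S → S' → ℝ}

/-- The factors `e^{g(τⱼ)}` split off from `∏ⱼ k(τⱼ, ηⱼ)` turn `e^{-N Φ}` into the weight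
`e^{-N (Φ - g)}` of the residual interaction. -/
theorem prod_mul_exp_append (hk : IsCouplingDensity α α' k) (Φ : FiniteMeasure S → ℝ) {g : S → ℝ}
    (hg : Continuous g) (n : ℕ) {m : ℕ} (hm : 0 < m) (η : ℕ → S') (x : Fin n → S')
    (u : Fin n → S) (τ : Fin m → S) :
    (∏ j : Fin (n + m), k (Fin.append u τ j) (splice n x η j)) *
        Real.exp (-(((n + m : ℕ) : ℝ) * Φ (empirical (n + m) (Fin.append u τ)))) =
      (∏ i, k (u i) (x i)) * (∏ j : Fin m, tiltNorm α k g (η (n + j))) *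
        ((∏ j : Fin m, tiltDensity α k g (τ j) (η (n + j))) *
          (insertionFactor Φ u (n + m) ((pairEmpirical n m η τ).map Prod.fst) *
            Real.exp (-(((n + m : ℕ) : ℝ) * residual Φ g (pairEmpirical n m η τ))))) := by
  have h1 : ∏ j : Fin m, k (τ j) (η (n + j)) =
      (∏ j : Fin m, tiltNorm α k g (η (n + j))) *
        (∏ j : Fin m, tiltDensity α k g (τ j) (η (n + j))) * Real.exp (∑ j, g (τ j)) := by
    rw [Real.exp_sum, ← Finset.prod_mul_distrib, ← Finset.prod_mul_distrib]
    refine Finset.prod_congr rfl fun j _ => ?_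
    have h := (hk.tiltNorm_pos hg (η (n + j))).ne'
    rw [tiltDensity, mul_div_cancel₀ _ h, mul_right_comm, ← Real.exp_add, neg_add_cancel,
      Real.exp_zero, one_mul]
  have h2 : ((n + m : ℕ) : ℝ) * ∫ σ, g σ ∂((pairEmpirical n m η τ).map Prod.fst : Measure S) =
      ∑ j, g (τ j) := by
    rw [← integral_pairEmpirical n hm η τ fun ξ => g ξ.1, FiniteMeasure.toMeasure_map,
      integral_map measurable_fst.aemeasurable hg.aestronglyMeasurable]
  have h3 : Real.exp (∑ j, g (τ j)) *
      Real.exp (-(((n + m : ℕ) : ℝ) * Φ (empirical (n + m) (Fin.append u τ)))) =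
      insertionFactor Φ u (n + m) ((pairEmpirical n m η τ).map Prod.fst) *
        Real.exp (-(((n + m : ℕ) : ℝ) * residual Φ g (pairEmpirical n m η τ))) := by
    rw [insertionFactor, ← Real.exp_add, ← Real.exp_add, ← h2, ← empirical_append, residual]
    congr 1
    ring
  rw [Fin.prod_univ_add]
  simp only [Fin.append_left, Fin.append_right, splice_castAdd, splice_natAdd]
  rw [h1, ← h3]
  ring

/-- The density of the transformed weight, up to a constant, in terms of the mean insertion
factor. -/
def condDensity (Φ : FiniteMeasure S → ℝ) (α : Measure S) (k : S → S' → ℝ) (g : S → ℝ) (n m : ℕ)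
    (η : ℕ → S') (x : Fin n → S') : ℝ≥0∞ :=
  ∫⁻ u, (∏ i, ENNReal.ofReal (k (u i) (x i))) *
    meanInsertion Φ α (tiltDensity α k g) (residual Φ g) n m η u ∂(Measure.pi fun _ => α)

theorem measurable_prod_ofReal (hk : IsCouplingDensity α α' k) (n : ℕ) :
    Measurable fun p : (Fin n → S') × (Fin n → S) =>
      ∏ i, ENNReal.ofReal (k (p.2 i) (p.1 i)) := by
  refine Finset.measurable_prod _ fun i _ => Measurable.ennreal_ofReal ?_
  have h : Measurable fun p : (Fin n → S') × (Fin n → S) => (p.2 i, p.1 i) := by fun_prop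
  exact hk.measurable.comp h

theorem measurable_condDensity (hk : IsCouplingDensity α α' k) {Φ : FiniteMeasure S → ℝ}
    (hΦ : Continuous Φ) {g : S → ℝ} (hg : Continuous g) (n m : ℕ) (η : ℕ → S') :
    Measurable (condDensity Φ α k g n m η) := by
  have hq := hk.isFellerDensity_tiltDensity hg
  have h := measurable_meanInsertion hq hΦ (continuous_residual (S' := S') hΦ hg) n m η
  exact ((measurable_prod_ofReal hk n).mul (h.comp measurable_snd)).lintegral_prod_right'

/-- The density of the transformed weight is `condDensity`, up to a factor `c` that does not depend
on the first `n` second-layer spins and hence cancels in the conditional distribution. -/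
theorem lintegral_gibbs_eq (hk : IsCouplingDensity α α' k) {Φ : FiniteMeasure S → ℝ}
    (hΦ : Continuous Φ) {g : S → ℝ} (hg : Continuous g) (n : ℕ) {m : ℕ} (hm : 0 < m)
    (η : ℕ → S') :
    ∃ c : ℝ≥0∞, c ≠ 0 ∧ c ≠ ∞ ∧ ∀ x : Fin n → S',
      ∫⁻ σ, ∏ j : Fin (n + m), ENNReal.ofReal (k (σ j) (splice n x η j)) ∂(gibbs Φ α (n + m)) =
        c * condDensity Φ α k g n m η x := by
  have hq := hk.isFellerDensity_tiltDensity hg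
  have hΨ := continuous_residual (S' := S') hΦ hg
  have hp := hq.isProbabilityMeasure_site
  set W := blockWeight α (tiltDensity α k g) (residual Φ g) n m η Set.univ with hWdef
  have hW0 : W ≠ 0 := blockWeight_univ_ne_zero hq hΨ n m η
  have hWt : W ≠ ∞ := blockWeight_univ_ne_top hq hΨ n m η
  set T : ℝ := ∏ j : Fin m, tiltNorm α k g (η (n + j)) with hTdef
  have hT : 0 < T := Finset.prod_pos fun j _ => hk.tiltNorm_pos hg _
  have hEc : Continuous fun σ : Fin (n + m) → S =>
      Real.exp (-(((n + m : ℕ) : ℝ) * Φ (empirical (n + m) σ))) :=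
    Real.continuous_exp.comp (continuous_const.mul (hΦ.comp (continuous_empirical _))).neg
  set Z : ℝ := ∫ σ, Real.exp (-(((n + m : ℕ) : ℝ) * Φ (empirical (n + m) σ)))
    ∂(Measure.pi fun _ : Fin (n + m) => α) with hZdef
  have hZ : 0 < Z := integral_exp_pos (integrable_of_continuous hEc _)
  have hblock : blockLaw α (tiltDensity α k g) n m η =
      (Measure.pi fun _ : Fin m => α).withDensity fun τ =>
        ∏ j : Fin m, ENNReal.ofReal (tiltDensity α k g (τ j) (η (n + j))) := by
    have hs : ∀ j : Fin m, SigmaFinite (α.withDensity fun σ =>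
        ENNReal.ofReal (tiltDensity α k g σ (η (n + j)))) := fun j => by
      have := hp (η (n + j))
      rw [site] at this
      infer_instance
    exact pi_withDensity (fun _ : Fin m => α)
      fun j => (hq.measurable_left (η (n + j))).ennreal_ofReal
  have hDm : Measurable fun τ : Fin m → S =>
      ∏ j : Fin m, ENNReal.ofReal (tiltDensity α k g (τ j) (η (n + j))) :=
    Finset.measurable_prod _ fun j _ =>
      ((hq.measurable_left _).comp (measurable_pi_apply j)).ennreal_ofReal
  have hRm : Measurable fun τ : Fin m → S => ENNReal.ofReal
      (Real.exp (-(((n + m : ℕ) : ℝ) * residual Φ g (pairEmpirical n m η τ)))) :=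
    (continuous_exp_neg_mul hΨ n m η).measurable.ennreal_ofReal
  have hIm : ∀ u : Fin n → S, Measurable fun τ : Fin m → S => ENNReal.ofReal
      (insertionFactor Φ u (n + m) ((pairEmpirical n m η τ).map Prod.fst)) := fun u => by
    have h1 : Continuous fun τ : Fin m → S => ((u, τ) : (Fin n → S) × (Fin m → S)) := by fun_prop
    exact ((continuous_insertionFactor hΦ n m η).comp h1).measurable.ennreal_ofReal
  -- the spins `n, …, n + m - 1` integrate to the mean insertion factor
  have hinner : ∀ u : Fin n → S,
      ∫⁻ τ, (∏ j : Fin m, ENNReal.ofReal (tiltDensity α k g (τ j) (η (n + j)))) *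
        (ENNReal.ofReal (insertionFactor Φ u (n + m) ((pairEmpirical n m η τ).map Prod.fst)) *
          ENNReal.ofReal
            (Real.exp (-(((n + m : ℕ) : ℝ) * residual Φ g (pairEmpirical n m η τ)))))
        ∂(Measure.pi fun _ : Fin m => α) =
      W * meanInsertion Φ α (tiltDensity α k g) (residual Φ g) n m η u := by
    intro u
    rw [meanInsertion, blockGibbs, lintegral_smul_measure, smul_eq_mul, ← hWdef, ← mul_assoc,
      ENNReal.mul_inv_cancel hW0 hWt, one_mul,
      lintegral_withDensity_eq_lintegral_mul _ hRm (hIm u), hblock,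
      lintegral_withDensity_eq_lintegral_mul _ hDm (hRm.mul (hIm u))]
    refine lintegral_congr fun τ => ?_
    simp only [Pi.mul_apply]
    ring
  refine ⟨ENNReal.ofReal Z⁻¹ * (ENNReal.ofReal T * W), ?_, ?_, fun x => ?_⟩
  · exact mul_ne_zero (by simpa using hZ) (mul_ne_zero (by simpa using hT) hW0)
  · exact ENNReal.mul_ne_top ENNReal.ofReal_ne_top (ENNReal.mul_ne_top ENNReal.ofReal_ne_top hWt)
  have hPm : Measurable fun σ : Fin (n + m) → S =>
      ∏ j : Fin (n + m), ENNReal.ofReal (k (σ j) (splice n x η j)) :=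
    Finset.measurable_prod _ fun j _ =>
      ((hk.measurable_left _).comp (measurable_pi_apply j)).ennreal_ofReal
  have hpt : ∀ (u : Fin n → S) (τ : Fin m → S),
      ENNReal.ofReal (Real.exp (-(((n + m : ℕ) : ℝ) * Φ (empirical (n + m) (Fin.append u τ))))) *
        ∏ j : Fin (n + m), ENNReal.ofReal (k (Fin.append u τ j) (splice n x η j)) =
      ((∏ i, ENNReal.ofReal (k (u i) (x i))) * ENNReal.ofReal T) *
        ((∏ j : Fin m, ENNReal.ofReal (tiltDensity α k g (τ j) (η (n + j)))) *
          (ENNReal.ofReal (insertionFactor Φ u (n + m) ((pairEmpirical n m η τ).map Prod.fst)) *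
            ENNReal.ofReal
              (Real.exp (-(((n + m : ℕ) : ℝ) * residual Φ g (pairEmpirical n m η τ)))))) := by
    intro u τ
    have e := congrArg ENNReal.ofReal (prod_mul_exp_append hk Φ hg n hm η x u τ)
    have p1 : 0 ≤ ∏ j : Fin (n + m), k (Fin.append u τ j) (splice n x η j) :=
      Finset.prod_nonneg fun j _ => (hk.pos _ _).le
    have p2 : 0 ≤ ∏ i, k (u i) (x i) := Finset.prod_nonneg fun j _ => (hk.pos _ _).le
    have p3 : 0 ≤ ∏ j : Fin m, tiltDensity α k g (τ j) (η (n + j)) :=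
      Finset.prod_nonneg fun j _ => (hq.pos _ _).le
    have p4 : 0 ≤ insertionFactor Φ u (n + m) ((pairEmpirical n m η τ).map Prod.fst) :=
      (Real.exp_pos _).le
    rw [← ENNReal.ofReal_prod_of_nonneg fun _ _ => (hk.pos _ _).le,
      ← ENNReal.ofReal_prod_of_nonneg fun _ _ => (hk.pos _ _).le,
      ← ENNReal.ofReal_prod_of_nonneg fun _ _ => (hq.pos _ _).le, mul_comm,
      ← ENNReal.ofReal_mul p1, e, ENNReal.ofReal_mul (mul_nonneg p2 hT.le),
      ENNReal.ofReal_mul p2, ENNReal.ofReal_mul p3, ENNReal.ofReal_mul p4]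
  rw [gibbs, lintegral_tilted, ← hZdef]
  simp_rw [div_eq_inv_mul, ENNReal.ofReal_mul (inv_nonneg.2 hZ.le), mul_assoc]
  have hEPm : Measurable fun σ : Fin (n + m) → S =>
      ENNReal.ofReal (Real.exp (-(((n + m : ℕ) : ℝ) * Φ (empirical (n + m) σ)))) *
        ∏ j : Fin (n + m), ENNReal.ofReal (k (σ j) (splice n x η j)) :=
    hEc.measurable.ennreal_ofReal.mul hPm
  have hDIRm : ∀ u : Fin n → S, Measurable fun τ : Fin m → S =>
      (∏ j : Fin m, ENNReal.ofReal (tiltDensity α k g (τ j) (η (n + j)))) *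
        (ENNReal.ofReal (insertionFactor Φ u (n + m) ((pairEmpirical n m η τ).map Prod.fst)) *
          ENNReal.ofReal
            (Real.exp (-(((n + m : ℕ) : ℝ) * residual Φ g (pairEmpirical n m η τ))))) :=
    fun u => hDm.mul ((hIm u).mul hRm)
  rw [lintegral_const_mul _ hEPm, lintegral_pi_append _ _ _ hEPm]
  congr 1
  rw [condDensity, ← mul_assoc, ← lintegral_const_mul']
  · refine lintegral_congr fun u => ?_
    simp_rw [hpt u]
    rw [lintegral_const_mul _ (hDIRm u), hinner]
    ring
  · exact ENNReal.mul_ne_top ENNReal.ofReal_ne_top hWt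

theorem transformedCond_apply (hk : IsCouplingDensity α α' k) {Φ : FiniteMeasure S → ℝ}
    (hΦ : Continuous Φ) {g : S → ℝ} (hg : Continuous g) (n : ℕ) {m : ℕ} (hm : 0 < m)
    (η : ℕ → S') {A : Set (Fin n → S')} (hA : MeasurableSet A) :
    transformedCond Φ α α' k n (n + m) η A =
      (∫⁻ x in A, condDensity Φ α k g n m η x ∂(Measure.pi fun _ => α')) /
        ∫⁻ x, condDensity Φ α k g n m η x ∂(Measure.pi fun _ => α') := by
  obtain ⟨c, hc0, hct, hc⟩ := lintegral_gibbs_eq hk hΦ hg n hm η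
  have hm := measurable_condDensity hk hΦ hg n m η
  have h : ∀ B : Set (Fin n → S'), MeasurableSet B → transformedWeight Φ α α' k n (n + m) η B =
      c * ∫⁻ x in B, condDensity Φ α k g n m η x ∂(Measure.pi fun _ => α') := by
    intro B hB
    rw [transformedWeight, withDensity_apply _ hB]
    simp_rw [hc]
    exact lintegral_const_mul _ hm
  rw [transformedCond, Measure.smul_apply, smul_eq_mul, h A hA, h _ MeasurableSet.univ,
    Measure.restrict_univ, mul_comm, ← div_eq_mul_inv, ENNReal.mul_div_mul_left _ _ hc0 hct]

end FiniteVolume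

/-! ### The infinite-volume kernel -/

section Limit

variable {S S' : Type*}
    [MetricSpace S] [CompactSpace S] [MeasurableSpace S] [BorelSpace S]
    [MetricSpace S'] [CompactSpace S'] [MeasurableSpace S'] [BorelSpace S']
    {α : Measure S} [IsProbabilityMeasure α] {α' : Measure S'} [IsProbabilityMeasure α']
    {k : S → S' → ℝ}

theorem ofReal_tiltNorm (hk : IsCouplingDensity α α' k) {g : S → ℝ} (hg : Continuous g) (η : S') :
    ENNReal.ofReal (tiltNorm α k g η) =
      ∫⁻ σ, ENNReal.ofReal (Real.exp (-g σ)) * ENNReal.ofReal (k σ η) ∂α := by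
  have hc : Continuous fun σ => Real.exp (-g σ) := by fun_prop
  rw [tiltNorm, ofReal_integral_eq_lintegral_ofReal (hk.integrable_mul hc η)
    (ae_of_all _ fun σ => (mul_pos (Real.exp_pos _) (hk.pos σ η)).le)]
  simp_rw [ENNReal.ofReal_mul (Real.exp_pos _).le]

/-- By the first marginal condition on `k`, the normalization of the single-site kernel does not
depend on `k`. -/
theorem lintegral_tiltNorm (hk : IsCouplingDensity α α' k) {g : S → ℝ} (hg : Continuous g) :
    ∫⁻ η, ENNReal.ofReal (tiltNorm α k g η) ∂α' = ENNReal.ofReal (∫ σ, Real.exp (-g σ) ∂α) := by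
  have hc : Continuous fun σ => Real.exp (-g σ) := by fun_prop
  have hm : Measurable fun p : S' × S => ENNReal.ofReal (Real.exp (-g p.2)) *
      ENNReal.ofReal (k p.2 p.1) := by
    have h1 : Measurable fun p : S' × S => k p.2 p.1 := hk.measurable.comp measurable_swap
    exact (hc.measurable.comp measurable_snd).ennreal_ofReal.mul h1.ennreal_ofReal
  simp_rw [ofReal_tiltNorm hk hg]
  rw [lintegral_lintegral_swap hm.aemeasurable,
    ofReal_integral_eq_lintegral_ofReal (integrable_of_continuous hc α)
      (ae_of_all _ fun σ => (Real.exp_pos _).le)]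
  refine lintegral_congr_ae ?_
  obtain ⟨C, -, hC⟩ := hk.exists_bound
  filter_upwards [hk.fst_marginal] with σ hσ
  have hkm : Measurable fun η => k σ η := hk.measurable.comp (measurable_const.prodMk measurable_id)
  have hi : Integrable (fun η => k σ η) α' :=
    Integrable.of_bound hkm.aestronglyMeasurable C (ae_of_all _ fun η => by
      rw [Real.norm_eq_abs, abs_of_pos (hk.pos σ η)]
      exact hC σ η)
  rw [lintegral_const_mul _ hkm.ennreal_ofReal, ← ofReal_integral_eq_lintegral_ofReal hi
    (ae_of_all _ fun η => (hk.pos σ η).le), hσ, ENNReal.ofReal_one, mul_one]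

theorem integral_exp_neg_pos {g : S → ℝ} (hg : Continuous g) : 0 < ∫ σ, Real.exp (-g σ) ∂α :=
  integral_exp_pos (integrable_of_continuous (by fun_prop) α)

theorem singleSite_eq (Φ : FiniteMeasure S → ℝ) (ρ : ProbabilityMeasure (S × S')) :
    singleSite Φ α α' k ρ = α'.withDensity fun η =>
      ENNReal.ofReal (tiltNorm α k (pointDeriv Φ (firstMarginal ρ)) η /
        ∫ σ, Real.exp (-pointDeriv Φ (firstMarginal ρ) σ) ∂α) := rfl

theorem isProbabilityMeasure_singleSite (hk : IsCouplingDensity α α' k) {Φ : FiniteMeasure S → ℝ}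
    (hΦ : IsProperInteraction Φ) (ρ : ProbabilityMeasure (S × S')) :
    IsProbabilityMeasure (singleSite Φ α α' k ρ) := by
  have hg := hΦ.continuous_pointDeriv (firstMarginal ρ)
  have hz := integral_exp_neg_pos (α := α) hg
  constructor
  rw [singleSite_eq, withDensity_apply _ MeasurableSet.univ, Measure.restrict_univ]
  simp_rw [ENNReal.ofReal_div_of_pos hz, div_eq_mul_inv]
  rw [lintegral_mul_const _ (hk.continuous_tiltNorm hg).measurable.ennreal_ofReal,
    lintegral_tiltNorm hk hg, ENNReal.mul_inv_cancel (by simpa using hz) ENNReal.ofReal_ne_top]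

theorem pi_singleSite (hk : IsCouplingDensity α α' k) {Φ : FiniteMeasure S → ℝ}
    (hΦ : IsProperInteraction Φ) (ρ : ProbabilityMeasure (S × S')) (n : ℕ) :
    (Measure.pi fun _ : Fin n => singleSite Φ α α' k ρ) =
      (Measure.pi fun _ : Fin n => α').withDensity fun x => ∏ i,
        ENNReal.ofReal (tiltNorm α k (pointDeriv Φ (firstMarginal ρ)) (x i) /
          ∫ σ, Real.exp (-pointDeriv Φ (firstMarginal ρ) σ) ∂α) := by
  have hg := hΦ.continuous_pointDeriv (firstMarginal ρ)
  have hp := isProbabilityMeasure_singleSite hk hΦ ρ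
  rw [singleSite_eq] at hp
  exact pi_withDensity (fun _ : Fin n => α')
    fun _ => ((hk.continuous_tiltNorm hg).measurable.div_const _).ennreal_ofReal

theorem pi_singleSite_apply (hk : IsCouplingDensity α α' k) {Φ : FiniteMeasure S → ℝ}
    (hΦ : IsProperInteraction Φ) (ρ : ProbabilityMeasure (S × S')) (n : ℕ) {A : Set (Fin n → S')}
    (hA : MeasurableSet A) :
    (Measure.pi fun _ : Fin n => singleSite Φ α α' k ρ) A =
      (∫⁻ x in A, ∏ i, ENNReal.ofReal (tiltNorm α k (pointDeriv Φ (firstMarginal ρ)) (x i))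
        ∂(Measure.pi fun _ => α')) /
      ENNReal.ofReal (∫ σ, Real.exp (-pointDeriv Φ (firstMarginal ρ) σ) ∂α) ^ n := by
  have hg := hΦ.continuous_pointDeriv (firstMarginal ρ)
  have hz := integral_exp_neg_pos (α := α) hg
  have hm : Measurable fun x : Fin n → S' => ∏ i,
      ENNReal.ofReal (tiltNorm α k (pointDeriv Φ (firstMarginal ρ)) (x i)) :=
    Finset.measurable_prod _ fun i _ =>
      ((hk.continuous_tiltNorm hg).measurable.comp (measurable_pi_apply i)).ennreal_ofReal
  rw [pi_singleSite hk hΦ, withDensity_apply _ hA]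
  simp_rw [ENNReal.ofReal_div_of_pos hz, div_eq_mul_inv, Finset.prod_mul_distrib]
  rw [lintegral_mul_const _ hm]
  simp [ENNReal.inv_pow]

/-- For a unique minimizer `ρ` the densities converge to `∏ᵢ ∫ e^{-g(σ)} k(σ, xᵢ) α(dσ)` with
`g(σ) = Φ⁽¹⁾(π₁ ρ, δ_σ)`. -/
theorem tendsto_setLIntegral_condDensity (hk : IsCouplingDensity α α' k)
    {Φ : FiniteMeasure S → ℝ} (hΦ : IsProperInteraction Φ) {ν' : ProbabilityMeasure S'}
    {ρ : ProbabilityMeasure (S × S')} (hρ : IsUniqueMinimizer Φ α k ν' ρ) {n : ℕ} {η : ℕ → S'}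
    (hη : Tendsto (fun N : ℕ => (N : ℝ≥0)⁻¹ • ∑ j ∈ Finset.Ico n N, pointMass (η j)) atTop
      (𝓝 ν'.toFiniteMeasure)) (A : Set (Fin n → S')) :
    Tendsto (fun m => ∫⁻ x in A, condDensity Φ α k (pointDeriv Φ (firstMarginal ρ)) n m η x
        ∂(Measure.pi fun _ => α')) atTop
      (𝓝 (∫⁻ x in A, ∏ i, ENNReal.ofReal (tiltNorm α k (pointDeriv Φ (firstMarginal ρ)) (x i))
        ∂(Measure.pi fun _ => α'))) := by
  have hg := hΦ.continuous_pointDeriv (firstMarginal ρ)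
  have hρeq := eq_coupling_of_isMinOn hk hΦ hρ.1.1 hρ.1.2
  set g := pointDeriv Φ (firstMarginal ρ) with hgdef
  have hq := hk.isFellerDensity_tiltDensity hg
  have hΨ := continuous_residual (S' := S') hΦ.continuous hg
  obtain ⟨C, -, hC⟩ := hk.exists_bound
  obtain ⟨B, hB⟩ := hΦ.exists_insertionFactor_le n
  have hprod : ∀ (u : Fin n → S) (x : Fin n → S'),
      ∏ i, ENNReal.ofReal (k (u i) (x i)) ≤ ENNReal.ofReal C ^ n := fun u x => by
    refine (Finset.prod_le_prod' fun i _ => ENNReal.ofReal_le_ofReal (hC _ _)).trans ?_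
    simp
  have hmean : ∀ m u, meanInsertion Φ α (tiltDensity α k g) (residual Φ g) n m η u ≤
      ENNReal.ofReal B := fun m u => meanInsertion_le hq hΨ hB m η u
  have hfin : ENNReal.ofReal C ^ n * ENNReal.ofReal B ≠ ∞ :=
    ENNReal.mul_ne_top (ENNReal.pow_ne_top ENNReal.ofReal_ne_top) ENNReal.ofReal_ne_top
  have hlim : ∀ u : Fin n → S, Tendsto
      (fun m => meanInsertion Φ α (tiltDensity α k g) (residual Φ g) n m η u) atTop
      (𝓝 (∏ i, ENNReal.ofReal (Real.exp (-g (u i))))) := by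
    intro u
    have h := tendsto_meanInsertion hq hΦ hη hΨ (fun κ hκ hne => by
      have h1 := hρ.residual_lt hk hg hρeq hκ (by rwa [hρeq])
      rwa [hρeq] at h1) u
    rw [← hρeq, ← hgdef, ← Finset.sum_neg_distrib, Real.exp_sum,
      ENNReal.ofReal_prod_of_nonneg fun _ _ => (Real.exp_pos _).le] at h
    exact h
  refine tendsto_lintegral_of_dominated_convergence
    (fun _ => ENNReal.ofReal C ^ n * ENNReal.ofReal B)
    (fun m => measurable_condDensity hk hΦ.continuous hg n m η) ?_ ?_ ?_
  · refine fun m => ae_of_all _ fun x => ?_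
    calc condDensity Φ α k g n m η x
        ≤ ∫⁻ _ : Fin n → S, ENNReal.ofReal C ^ n * ENNReal.ofReal B ∂(Measure.pi fun _ => α) :=
          lintegral_mono fun u => mul_le_mul' (hprod u x) (hmean m u)
      _ = _ := by simp
  · rw [lintegral_const]
    exact ENNReal.mul_ne_top hfin (measure_ne_top _ _)
  · refine ae_of_all _ fun x => ?_
    have hkm : ∀ i, Measurable fun σ : S => ENNReal.ofReal (k σ (x i)) := fun i =>
      (hk.measurable_left (x i)).ennreal_ofReal
    have hgm : Measurable fun σ => ENNReal.ofReal (Real.exp (-g σ)) :=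
      hg.measurable.neg.exp.ennreal_ofReal
    have hval : ∏ i, ENNReal.ofReal (tiltNorm α k g (x i)) =
        ∫⁻ u : Fin n → S, (∏ i, ENNReal.ofReal (k (u i) (x i))) *
          ∏ i, ENNReal.ofReal (Real.exp (-g (u i))) ∂(Measure.pi fun _ => α) := by
      simp_rw [← Finset.prod_mul_distrib]
      have hmul : ∀ i, Measurable fun σ : S =>
          ENNReal.ofReal (k σ (x i)) * ENNReal.ofReal (Real.exp (-g σ)) := fun i => (hkm i).mul hgm
      rw [lintegral_pi_prod (fun _ : Fin n => α) hmul]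
      refine Finset.prod_congr rfl fun i _ => ?_
      rw [ofReal_tiltNorm hk hg]
      simp_rw [mul_comm]
    rw [hval]
    refine tendsto_lintegral_of_dominated_convergence
      (fun _ => ENNReal.ofReal C ^ n * ENNReal.ofReal B) (fun m => ?_)
      (fun m => ae_of_all _ fun u => mul_le_mul' (hprod u x) (hmean m u)) (by simpa using hfin)
      (ae_of_all _ fun u => ?_)
    · exact (Finset.measurable_prod _ fun i _ => (hkm i).comp (measurable_pi_apply i)).mul
        (measurable_meanInsertion hq hΦ.continuous hΨ n m η)
    · exact ENNReal.Tendsto.const_mul (hlim u)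
        (Or.inr (ne_top_of_le_ne_top (ENNReal.pow_ne_top ENNReal.ofReal_ne_top) (hprod u x)))

theorem isLimitKernel_pi_singleSite (hk : IsCouplingDensity α α' k)
    {Φ : FiniteMeasure S → ℝ} (hΦ : IsProperInteraction Φ) {ν' : ProbabilityMeasure S'}
    {ρ : ProbabilityMeasure (S × S')} (hρ : IsUniqueMinimizer Φ α k ν' ρ) (n : ℕ) :
    IsLimitKernel Φ α α' k n ν' (Measure.pi fun _ : Fin n => singleSite Φ α α' k ρ) := by
  intro η hη A hA
  have hg := hΦ.continuous_pointDeriv (firstMarginal ρ)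
  have hz := integral_exp_neg_pos (α := α) hg
  have hA' := tendsto_setLIntegral_condDensity (α' := α') hk hΦ hρ hη A
  have hU := tendsto_setLIntegral_condDensity (α' := α') hk hΦ hρ hη Set.univ
  have hUval : ∫⁻ x : Fin n → S', ∏ i,
      ENNReal.ofReal (tiltNorm α k (pointDeriv Φ (firstMarginal ρ)) (x i))
        ∂(Measure.pi fun _ => α') =
      ENNReal.ofReal (∫ σ, Real.exp (-pointDeriv Φ (firstMarginal ρ) σ) ∂α) ^ n := by
    rw [lintegral_pi_prod (fun _ : Fin n => α')
      fun _ => (hk.continuous_tiltNorm hg).measurable.ennreal_ofReal]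
    simp [lintegral_tiltNorm hk hg]
  rw [Measure.restrict_univ, hUval] at hU
  have hne0 : ENNReal.ofReal (∫ σ, Real.exp (-pointDeriv Φ (firstMarginal ρ) σ) ∂α) ^ n ≠ 0 :=
    pow_ne_zero _ (by simpa using hz)
  have hnet : ENNReal.ofReal (∫ σ, Real.exp (-pointDeriv Φ (firstMarginal ρ) σ) ∂α) ^ n ≠ ∞ :=
    ENNReal.pow_ne_top ENNReal.ofReal_ne_top
  have h := ENNReal.Tendsto.div hA' (Or.inr hne0) hU (Or.inl hnet)
  rw [← pi_singleSite_apply hk hΦ ρ n hA] at h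
  -- from the number `m` of remaining sites to the total number `N = n + m`
  refine (tendsto_add_atTop_iff_nat n).1 (h.congr' ?_)
  filter_upwards [eventually_gt_atTop 0] with m hm
  rw [add_comm m n, transformedCond_apply hk hΦ.continuous hg n hm η hA]

/-- Every `ν'` is the limit of empirical measures of some boundary condition, so a limit kernel is
unique. -/
theorem IsLimitKernel.eq {Φ : FiniteMeasure S → ℝ} {n : ℕ} {ν' : ProbabilityMeasure S'}
    {γ₁ γ₂ : Measure (Fin n → S')} (h₁ : IsLimitKernel Φ α α' k n ν' γ₁)
    (h₂ : IsLimitKernel Φ α α' k n ν' γ₂) : γ₁ = γ₂ := by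
  obtain ⟨η, hη⟩ := exists_tendsto_empirical ν' n
  exact Measure.ext fun A hA => tendsto_nhds_unique (h₁ η hη A hA) (h₂ η hη A hA)

theorem limitKernel_eq (hk : IsCouplingDensity α α' k)
    {Φ : FiniteMeasure S → ℝ} (hΦ : IsProperInteraction Φ) {ν' : ProbabilityMeasure S'}
    {ρ : ProbabilityMeasure (S × S')} (hρ : IsUniqueMinimizer Φ α k ν' ρ) (n : ℕ) :
    limitKernel Φ α α' k n ν' = Measure.pi fun _ : Fin n => singleSite Φ α α' k ρ := by
  have h : ∃ γ, IsLimitKernel Φ α α' k n ν' γ := ⟨_, isLimitKernel_pi_singleSite hk hΦ hρ n⟩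
  rw [limitKernel, dif_pos h]
  exact h.choose_spec.eq (isLimitKernel_pi_singleSite hk hΦ hρ n)

end Limit

/-! ### Continuity of the kernel in the boundary condition -/

section Continuity

open InformationTheory

/-- The easy half of the Donsker–Varadhan formula. -/
theorem coe_integral_sub_log_le_klDiv {Y : Type*} [MeasurableSpace Y] (ρ p : Measure Y)
    [IsProbabilityMeasure ρ] [IsProbabilityMeasure p] {f : Y → ℝ} (hf : Measurable f) {C : ℝ}
    (hC : ∀ y, |f y| ≤ C) :
    ((∫ y, f y ∂ρ - Real.log (∫ y, Real.exp (f y) ∂p) : ℝ) : EReal) ≤ (klDiv ρ p : ℝ≥0∞) := by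
  have hei : Integrable (fun y => Real.exp (f y)) p :=
    Integrable.of_bound hf.exp.aestronglyMeasurable (Real.exp C) (ae_of_all _ fun y => by
      rw [Real.norm_eq_abs, abs_of_pos (Real.exp_pos _)]
      exact Real.exp_le_exp.2 (abs_le.1 (hC y)).2)
  have hfi : Integrable f ρ := Integrable.of_bound hf.aestronglyMeasurable C (ae_of_all _ hC)
  set c := Real.log (∫ y, Real.exp (f y) ∂p) with hc
  have hexp : Real.exp c = ∫ y, Real.exp (f y) ∂p := Real.exp_log (integral_exp_pos hei)
  have h1 : ∫ y, Real.exp (f y - c) ∂p = 1 := by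
    simp_rw [Real.exp_sub, integral_div, hexp]
    exact div_self (integral_exp_pos hei).ne'
  have hw : ∀ y, |f y - c| ≤ C + |c| := fun y => (abs_sub _ _).trans (by gcongr; exact hC y)
  rw [klDiv_eq_klDiv_tilted_add ρ p (hf.sub_const c) hw h1, integral_sub hfi (integrable_const _)]
  simp only [integral_const, probReal_univ, one_smul]
  exact le_add_of_nonneg_left (EReal.coe_ennreal_nonneg _)

variable {S S' : Type*}
    [MetricSpace S] [CompactSpace S] [MeasurableSpace S] [BorelSpace S]
    [MetricSpace S'] [CompactSpace S'] [MeasurableSpace S'] [BorelSpace S']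
    {α : Measure S} [IsProbabilityMeasure α] {α' : Measure S'} [IsProbabilityMeasure α']
    {k : S → S' → ℝ}

/-- Comparison of a minimizer with the coupling built from a fixed field `g`. -/
theorem integral_sub_log_add_residual_le (hk : IsCouplingDensity α α' k)
    (Φ : FiniteMeasure S → ℝ) {g : S → ℝ} (hg : Continuous g) {lam : ProbabilityMeasure S'}
    {κ : ProbabilityMeasure (S × S')} (hκ : κ ∈ constrained lam)
    (hmin : IsMinOn (rateFunction Φ α k lam) (constrained lam) κ) (f : C(S × S', ℝ)) :
    ∫ ξ, f ξ ∂(κ : Measure (S × S')) - Real.log (∫ ξ, Real.exp (f ξ)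
        ∂((hk.isFellerDensity_tiltDensity hg).coupling lam : Measure (S × S'))) +
      residual Φ g κ.toFiniteMeasure ≤
      residual Φ g ((hk.isFellerDensity_tiltDensity hg).coupling lam).toFiniteMeasure := by
  have hq := hk.isFellerDensity_tiltDensity hg
  have hmem := hq.coupling_mem_constrained lam
  have h1 : rateFunction Φ α k lam κ ≤ rateFunction Φ α k lam (hq.coupling lam) := hmin hmem
  rw [rateFunction_eq hk Φ hg lam hκ, rateFunction_eq hk Φ hg lam hmem, klDiv_self,
    EReal.coe_ennreal_zero, zero_add] at h1
  obtain ⟨C, hC⟩ := isCompact_univ.exists_bound_of_continuousOn f.continuous.continuousOn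
  have h2 := coe_integral_sub_log_le_klDiv (κ : Measure (S × S'))
    (hq.coupling lam : Measure (S × S')) f.continuous.measurable (fun ξ => hC ξ trivial)
  have h3 := (add_le_add_left h2 _).trans h1
  rw [← EReal.coe_add, EReal.coe_le_coe_iff] at h3
  linarith

/-- The minimizers depend continuously on the constraint where the limiting one is unique: by
compactness, lower semicontinuity of relative entropy and continuity of the couplings, every
cluster point of the minimizers is a minimizer. -/
theorem tendsto_minimizer (hk : IsCouplingDensity α α' k) {Φ : FiniteMeasure S → ℝ}
    (hΦ : IsProperInteraction Φ) {ν' : ProbabilityMeasure S'} {ρ : ProbabilityMeasure (S × S')}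
    (hρ : IsUniqueMinimizer Φ α k ν' ρ)
    {M : ProbabilityMeasure S' → ProbabilityMeasure (S × S')}
    (hM : ∀ᶠ lam in 𝓝 ν', M lam ∈ constrained lam ∧
      IsMinOn (rateFunction Φ α k lam) (constrained lam) (M lam)) :
    Tendsto M (𝓝 ν') (𝓝 ρ) := by
  have hg := hΦ.continuous_pointDeriv (firstMarginal ρ)
  have hρeq := eq_coupling_of_isMinOn hk hΦ hρ.1.1 hρ.1.2
  set g := pointDeriv Φ (firstMarginal ρ)
  have hq := hk.isFellerDensity_tiltDensity hg
  have hΨ := continuous_residual (S' := S') hΦ.continuous hg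
  have hint : ∀ f : C(S × S', ℝ), Continuous fun κ : ProbabilityMeasure (S × S') =>
      ∫ ξ, f ξ ∂(κ : Measure (S × S')) := fun f =>
    (FiniteMeasure.continuous_integral_continuousMap f).comp
      ProbabilityMeasure.toFiniteMeasure_continuous
  refine tendsto_nhds_of_unique_mapClusterPt fun κ hκ => ?_
  obtain ⟨U, hU, hUκ⟩ := mapClusterPt_iff_ultrafilter.1 hκ
  have hκmem : κ ∈ constrained ν' := by
    have hc : Continuous fun κ : ProbabilityMeasure (S × S') =>
        κ.map measurable_snd.aemeasurable := ProbabilityMeasure.continuous_map continuous_snd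
    have h1 : Tendsto (fun lam => (M lam).map measurable_snd.aemeasurable) U
        (𝓝 (κ.map measurable_snd.aemeasurable)) := (hc.tendsto κ).comp hUκ
    have h2 : Tendsto (fun lam => (M lam).map measurable_snd.aemeasurable) U (𝓝 ν') := by
      refine Tendsto.congr' ?_ (tendsto_id'.2 hU)
      filter_upwards [hU hM] with lam hlam
      have e : (M lam).map measurable_snd.aemeasurable = lam := Subtype.ext hlam.1
      exact e.symm
    have e : κ.map measurable_snd.aemeasurable = ν' := tendsto_nhds_unique h1 h2
    exact congrArg Subtype.val e
  by_contra hne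
  have hlt := hρ.residual_lt hk hg hρeq hκmem hne
  rw [coe_lt_coe_add_coe_iff] at hlt
  obtain ⟨f, hf⟩ := exists_continuous_lt_integral_sub_log _ _ hlt
  have hpos : ∫ ξ, Real.exp (f ξ) ∂(hq.coupling ν' : Measure (S × S')) ≠ 0 :=
    (integral_exp_pos (integrable_of_continuous (by fun_prop) _)).ne'
  have hlog := ((((hint ⟨fun ξ => Real.exp (f ξ), by fun_prop⟩).comp
    hq.continuous_coupling).tendsto ν').mono_left hU).log hpos
  have hres : Continuous fun κ : ProbabilityMeasure (S × S') => residual Φ g κ.toFiniteMeasure :=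
    hΨ.comp ProbabilityMeasure.toFiniteMeasure_continuous
  have hleft := ((((hint f).tendsto κ).comp hUκ).sub hlog).add ((hres.tendsto κ).comp hUκ)
  have hright := ((hres.comp hq.continuous_coupling).tendsto ν').mono_left hU
  have hle := le_of_tendsto_of_tendsto hleft hright (by
    filter_upwards [hU hM] with lam hlam
    exact integral_sub_log_add_residual_le hk Φ hg hlam.1 hlam.2 f)
  simp only [Function.comp] at hle
  rw [← hρeq] at hle
  have hle' : ∫ ξ, f ξ ∂(κ : Measure (S × S')) - Real.log (∫ ξ, Real.exp (f ξ)
      ∂(hq.coupling ν' : Measure (S × S'))) + residual Φ g κ.toFiniteMeasure ≤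
      residual Φ g ρ.toFiniteMeasure := by
    rw [← hρeq]; exact hle
  linarith

theorem continuous_firstMarginal :
    Continuous (firstMarginal : ProbabilityMeasure (S × S') → FiniteMeasure S) :=
  (FiniteMeasure.continuous_map continuous_fst).comp ProbabilityMeasure.toFiniteMeasure_continuous

theorem mass_firstMarginal (κ : ProbabilityMeasure (S × S')) : (firstMarginal κ).mass ≤ 1 :=
  (FiniteMeasure.mass_map_le _ _).trans (by simp)

/-- The single-site product kernel depends weakly continuously on the minimizer; this uses that
`Φ⁽¹⁾(·, δ_σ)` is continuous for each `σ` and bounded uniformly in `σ`. -/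
theorem continuous_pi_singleSite (hk : IsCouplingDensity α α' k) {Φ : FiniteMeasure S → ℝ}
    (hΦ : IsProperInteraction Φ) (n : ℕ) {A : Set (Fin n → S')} (hA : MeasurableSet A) :
    Continuous fun κ : ProbabilityMeasure (S × S') =>
      (Measure.pi fun _ : Fin n => singleSite Φ α α' k κ) A := by
  obtain ⟨B, hB0, hB⟩ := hΦ.exists_abs_pointDeriv_le 1
  obtain ⟨C, hC0, hC⟩ := hk.exists_bound
  have hg : ∀ κ : ProbabilityMeasure (S × S'), Continuous (pointDeriv Φ (firstMarginal κ)) :=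
    fun κ => hΦ.continuous_pointDeriv _
  have hexp : ∀ (κ : ProbabilityMeasure (S × S')) σ,
      Real.exp (-pointDeriv Φ (firstMarginal κ) σ) ≤ Real.exp B := fun κ σ =>
    Real.exp_le_exp.2 (by linarith [(abs_le.1 (hB _ (mass_firstMarginal κ) σ)).1])
  have hlim : ∀ (κ : ProbabilityMeasure (S × S')) σ,
      Tendsto (fun κ' : ProbabilityMeasure (S × S') =>
        Real.exp (-pointDeriv Φ (firstMarginal κ') σ)) (𝓝 κ)
        (𝓝 (Real.exp (-pointDeriv Φ (firstMarginal κ) σ))) := fun κ σ => by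
    have h1 : Continuous fun κ' : ProbabilityMeasure (S × S') =>
        pointDeriv Φ (firstMarginal κ') σ :=
      (hΦ.continuous_posDeriv (pointMass σ)).comp continuous_firstMarginal
    exact (Real.continuous_exp.comp h1.neg).tendsto κ
  have hz : Continuous fun κ : ProbabilityMeasure (S × S') =>
      ∫ σ, Real.exp (-pointDeriv Φ (firstMarginal κ) σ) ∂α := by
    refine continuous_iff_continuousAt.2 fun κ => ?_
    refine tendsto_integral_filter_of_dominated_convergence (fun _ => Real.exp B) ?_ ?_
      (integrable_const _) (ae_of_all _ (hlim κ))
    · exact Eventually.of_forall fun κ' => (hg κ').measurable.neg.exp.aestronglyMeasurable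
    · refine Eventually.of_forall fun κ' => ae_of_all _ fun σ => ?_
      rw [Real.norm_eq_abs, abs_of_pos (Real.exp_pos _)]
      exact hexp κ' σ
  have hbd : ∀ (κ : ProbabilityMeasure (S × S')) σ η,
      ‖Real.exp (-pointDeriv Φ (firstMarginal κ) σ) * k σ η‖ ≤ Real.exp B * C := fun κ σ η => by
    rw [Real.norm_eq_abs, abs_of_pos (mul_pos (Real.exp_pos _) (hk.pos σ η))]
    exact mul_le_mul (hexp κ σ) (hC σ η) (hk.pos σ η).le (Real.exp_pos _).le
  have htilt : ∀ η, Continuous fun κ : ProbabilityMeasure (S × S') =>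
      tiltNorm α k (pointDeriv Φ (firstMarginal κ)) η := fun η => by
    refine continuous_iff_continuousAt.2 fun κ => ?_
    refine tendsto_integral_filter_of_dominated_convergence (fun _ => Real.exp B * C) ?_ ?_
      (integrable_const _) (ae_of_all _ fun σ => (hlim κ σ).mul_const _)
    · exact Eventually.of_forall fun κ' =>
        ((hg κ').measurable.neg.exp.mul (hk.measurable_left η)).aestronglyMeasurable
    · exact Eventually.of_forall fun κ' => ae_of_all _ fun σ => hbd κ' σ η
  have htb : ∀ (κ : ProbabilityMeasure (S × S')) η,
      tiltNorm α k (pointDeriv Φ (firstMarginal κ)) η ≤ Real.exp B * C := fun κ η => by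
    have h := norm_integral_le_of_norm_le_const (μ := α) (ae_of_all _ fun σ => hbd κ σ η)
    rw [probReal_univ, mul_one] at h
    exact (le_abs_self _).trans h
  have hnum : Continuous fun κ : ProbabilityMeasure (S × S') => ∫⁻ x in A, ∏ i,
      ENNReal.ofReal (tiltNorm α k (pointDeriv Φ (firstMarginal κ)) (x i))
        ∂(Measure.pi fun _ : Fin n => α') := by
    refine continuous_iff_continuousAt.2 fun κ => ?_
    refine tendsto_lintegral_filter_of_dominated_convergence
      (fun _ => ENNReal.ofReal (Real.exp B * C) ^ n) ?_ ?_ ?_ (ae_of_all _ fun x => ?_)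
    · exact Eventually.of_forall fun κ' => Finset.measurable_prod _ fun i _ =>
        ((hk.continuous_tiltNorm (hg κ')).measurable.comp (measurable_pi_apply i)).ennreal_ofReal
    · refine Eventually.of_forall fun κ' => ae_of_all _ fun x => ?_
      refine (Finset.prod_le_prod' fun i _ => ENNReal.ofReal_le_ofReal (htb κ' (x i))).trans ?_
      simp
    · rw [lintegral_const]
      exact ENNReal.mul_ne_top (ENNReal.pow_ne_top ENNReal.ofReal_ne_top) (measure_ne_top _ _)
    · have h : Tendsto (fun κ' : ProbabilityMeasure (S × S') => ∏ i,
          tiltNorm α k (pointDeriv Φ (firstMarginal κ')) (x i)) (𝓝 κ)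
          (𝓝 (∏ i, tiltNorm α k (pointDeriv Φ (firstMarginal κ)) (x i))) :=
        tendsto_finsetProd _ fun i _ => (htilt (x i)).tendsto κ
      simp_rw [← ENNReal.ofReal_prod_of_nonneg fun i _ => (hk.tiltNorm_pos (hg _) (x i)).le]
      exact ENNReal.tendsto_ofReal h
  simp_rw [pi_singleSite_apply hk hΦ _ n hA]
  refine continuous_iff_continuousAt.2 fun κ => ?_
  have hzκ := integral_exp_neg_pos (α := α) (hg κ)
  have hden : Tendsto (fun κ' : ProbabilityMeasure (S × S') =>
      ENNReal.ofReal (∫ σ, Real.exp (-pointDeriv Φ (firstMarginal κ') σ) ∂α) ^ n) (𝓝 κ)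
      (𝓝 (ENNReal.ofReal (∫ σ, Real.exp (-pointDeriv Φ (firstMarginal κ) σ) ∂α) ^ n)) :=
    (((ENNReal.continuous_pow n).comp (ENNReal.continuous_ofReal.comp hz)).tendsto κ)
  exact ENNReal.Tendsto.div (hnum.tendsto κ) (Or.inr (pow_ne_zero _ (by simpa using hzκ))) hden
    (Or.inl (ENNReal.pow_ne_top ENNReal.ofReal_ne_top))

theorem continuousAt_limitKernel (hk : IsCouplingDensity α α' k) {Φ : FiniteMeasure S → ℝ}
    (hΦ : IsProperInteraction Φ) {ν' : ProbabilityMeasure S'} {ρ : ProbabilityMeasure (S × S')}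
    (hρ : IsUniqueMinimizer Φ α k ν' ρ)
    (h : ∀ᶠ lam' in 𝓝 ν', ∃ κ : ProbabilityMeasure (S × S'), IsUniqueMinimizer Φ α k lam' κ)
    (n : ℕ) {A : Set (Fin n → S')} (hA : MeasurableSet A) :
    ContinuousAt (fun lam' : ProbabilityMeasure S' => limitKernel Φ α α' k n lam' A) ν' := by
  -- where there is no unique minimizer the value of the selection does not matter
  have hch : ∀ lam' : ProbabilityMeasure S', ∃ κ : ProbabilityMeasure (S × S'),
      (∃ κ' : ProbabilityMeasure (S × S'), IsUniqueMinimizer Φ α k lam' κ') →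
        IsUniqueMinimizer Φ α k lam' κ := fun lam' => by
    by_cases hex : ∃ κ : ProbabilityMeasure (S × S'), IsUniqueMinimizer Φ α k lam' κ
    · obtain ⟨κ, hκ⟩ := hex
      exact ⟨κ, fun _ => hκ⟩
    · exact ⟨ρ, fun h' => absurd h' hex⟩
  choose M hM using hch
  have hlim : Tendsto M (𝓝 ν') (𝓝 ρ) := tendsto_minimizer hk hΦ hρ (by
    filter_upwards [h] with lam hlam
    exact (hM lam hlam).1)
  have h1 := ((continuous_pi_singleSite (α := α) (α' := α') hk hΦ n hA).tendsto ρ).comp hlim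
  rw [ContinuousAt, limitKernel_eq hk hΦ hρ n]
  refine h1.congr' ?_
  filter_upwards [h] with lam hlam
  rw [Function.comp, limitKernel_eq hk hΦ (hM lam hlam) n]

end Continuity

end MeanField

end

open MeasureTheory Filter Topology MeanField in
theorem theorem3 {S S' : Type*}
    [MetricSpace S] [CompactSpace S] [MeasurableSpace S] [BorelSpace S]
    [MetricSpace S'] [CompactSpace S'] [MeasurableSpace S'] [BorelSpace S']
    (α : Measure S) [IsProbabilityMeasure α] (α' : Measure S') [IsProbabilityMeasure α']
    (Φ : FiniteMeasure S → ℝ) (hΦ : IsProperInteraction Φ)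
    (k : S → S' → ℝ) (hk : IsCouplingDensity α α' k)
    (ν' : ProbabilityMeasure S') (ρ : ProbabilityMeasure (S × S'))
    (hρ : IsUniqueMinimizer Φ α k ν' ρ) :
    (∀ n : ℕ,
      IsLimitKernel Φ α α' k n ν' (limitKernel Φ α α' k n ν') ∧
      limitKernel Φ α α' k n ν' = Measure.pi fun _ : Fin n => singleSite Φ α α' k ρ) ∧
    ((∀ᶠ lam' in 𝓝 ν', ∃ lam : ProbabilityMeasure (S × S'), IsUniqueMinimizer Φ α k lam' lam) →
      ∀ (n : ℕ) (A : Set (Fin n → S')), MeasurableSet A →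
        ContinuousAt (fun lam' : ProbabilityMeasure S' => limitKernel Φ α α' k n lam' A) ν') := by
  exact ⟨fun n => by
    have h := limitKernel_eq (α' := α') hk hΦ hρ n
    exact ⟨h ▸ isLimitKernel_pi_singleSite hk hΦ hρ n, h⟩,
    fun h n _ hA => continuousAt_limitKernel hk hΦ hρ h n hA⟩
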